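/- Let $V,W\in C^\infty(\mathbb R,\mathbb R)$ be $1$-periodic with $V(x+\tfrac12)=V(x)$ and $W(x+\tfrac12)=-W(x)$, and let $\kappa\in C^\infty(\mathbb R,\mathbb R)$ be a domain wall: for some $L>0$, $\kappa=1$ on $[L,\infty)$ and $\kappa=-1$ on $(-\infty,-L]$. Write $D_x=\frac1i\partial_x$ and $\langle f,g\rangle=\int_0^1\overline{f}\,g\,dx$. Let $E_\star\in\mathbb R$. A Dirac eigenbasis at energy $E_\star$ is a pair $(\phi_+,\phi_-)$ of functions $\mathbb R\to\mathbb C$, normalized by $\langle\phi_\pm,\phi_\pm\rangle=1$, with $$(D_x^2+V-E_\star)\phi_\pm=0,\qquad \phi_\pm(x+\tfrac12)=\pm i\,\phi_\pm(x),\qquad \overline{\phi_+}=\phi_-.$$ (Such a pair exists exactly when $E_\star$ is an eigenvalue of $D_x^2+V$ on the $L^2_{\rm loc}$ functions with $f(x+1)=e^{i\pi}f(x)$.) Given a Dirac eigenbasis, put $$\nu_\star=2\langle\phi_+,D_x\phi_+\rangle,\qquad \vartheta_\star=\langle\phi_+,W\phi_-\rangle,\qquad \sigma_3=\begin{pmatrix}1&0\\0&-1\end{pmatrix},\qquad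 \sigma_\star=\begin{pmatrix}0&\overline{\vartheta_\star}\\ \vartheta_\star&0\end{pmatrix},$$ and consider the operator $\slashed D=\nu_\star\sigma_3D_x+\sigma_\star\kappa$ on $L^2(\mathbb R;\mathbb C^2)$ with domain $H^1(\mathbb R;\mathbb C^2)$. Let $(\phi_+,\phi_-)$ be a Dirac eigenbasis at energy $E_\star$ such that $\vartheta_\star\neq0$. Then: 1. The spectrum of $\slashed D$ is independent of the choice of the Dirac eigenbasis: every Dirac eigenbasis at energy $E_\star$ yields an operator with the same spectrum. 2. The essential spectrum of $\slashed D$ is $\mathbb R\setminus(-|\vartheta_\star|,|\vartheta_\star|)$. 3. The point spectrum (the set of eigenvalues) of $\slashed D$ consists of finitely many simple eigenvalues $$-|\vartheta_\star|<\vartheta_{-N}<\dots<\vartheta_{-1}<\vartheta_0=0<\vartheta_1<\dots<\vartheta_N<|\vartheta_\star|,\qquad \vartheta_{-j}=-\vartheta_j,$$ for some integer $N\ge 0$. -/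

import Mathlib

open MeasureTheory Set
open scoped ContDiff ComplexConjugate

noncomputable section

namespace DiracWall

/-! ### Spectra of (possibly unbounded) operators on a Hilbert space -/

section Spectrum

variable {H : Type*} [NormedAddCommGroup H] [InnerProductSpace ℂ H]

/-- `z` is in the resolvent set of the operator `A` if `A - z : dom A → H` is a bijection with
bounded inverse `R`. -/
def resolventSet (A : H →ₗ.[ℂ] H) : Set ℂ :=
  {z | ∃ R : H →L[ℂ] H,
    (∀ f : H, ∃ h : R f ∈ A.domain, A ⟨R f, h⟩ - z • R f = f) ∧
    (∀ u : A.domain, R (A u - z • (u : H)) = u)}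

/-- The spectrum `Σ(A)`: the complement of the resolvent set. -/
def spectrum (A : H →ₗ.[ℂ] H) : Set ℂ := (resolventSet A)ᶜ

/-- The eigenspace `ker (A - z)`, as a subspace of `H`. -/
def eigenspace (A : H →ₗ.[ℂ] H) (z : ℂ) : Submodule ℂ H where
  carrier := {u | ∃ h : u ∈ A.domain, A ⟨u, h⟩ = z • u}
  zero_mem' := ⟨A.domain.zero_mem, by
    have : (⟨0, A.domain.zero_mem⟩ : A.domain) = 0 := rfl
    rw [this, LinearPMap.map_zero, smul_zero]⟩
  add_mem' := by
    rintro u v ⟨hu, eu⟩ ⟨hv, ev⟩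
    refine ⟨A.domain.add_mem hu hv, ?_⟩
    have : (⟨u + v, A.domain.add_mem hu hv⟩ : A.domain) = ⟨u, hu⟩ + ⟨v, hv⟩ := rfl
    rw [this, LinearPMap.map_add, eu, ev, smul_add]
  smul_mem' := by
    rintro c u ⟨hu, eu⟩
    refine ⟨A.domain.smul_mem c hu, ?_⟩
    have : (⟨c • u, A.domain.smul_mem c hu⟩ : A.domain) = c • ⟨u, hu⟩ := rfl
    rw [this, LinearPMap.map_smul, eu, smul_comm]

/-- The (pure) point spectrum `Σ_pp(A)`: the set of eigenvalues. -/
def pointSpectrum (A : H →ₗ.[ℂ] H) : Set ℂ := {z | eigenspace A z ≠ ⊥}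

/-- The discrete spectrum of a selfadjoint operator: the eigenvalues of finite multiplicity that
are isolated points of the spectrum. -/
def discreteSpectrum (A : H →ₗ.[ℂ] H) : Set ℂ :=
  {z | z ∈ pointSpectrum A ∧ FiniteDimensional ℂ (eigenspace A z) ∧
    ∃ ε : ℝ, 0 < ε ∧ ∀ w ∈ spectrum A, ‖w - z‖ < ε → w = z}

/-- The essential spectrum `Σ_ess(A)` of a selfadjoint operator: the spectrum without the discrete
spectrum. -/
def essentialSpectrum (A : H →ₗ.[ℂ] H) : Set ℂ := spectrum A \ discreteSpectrum A

end Spectrum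

/-! ### The Hilbert space `L²(ℝ; ℂ²)` and the Sobolev space `H¹(ℝ; ℂ²)` -/

/-- `ℂ²` with its Hermitian inner product. -/
abbrev Spinor : Type := EuclideanSpace ℂ (Fin 2)

/-- `L²(ℝ; ℂ²)`. -/
abbrev L2 : Type := Lp Spinor 2 (volume : Measure ℝ)

/-- `g` is the weak derivative of `f`. -/
def IsWeakDeriv (f g : L2) : Prop :=
  ∀ χ : ℝ → ℝ, ContDiff ℝ ∞ χ → HasCompactSupport χ →
    ∫ x, deriv χ x • f x = -∫ x, χ x • g x

theorem integrable_test_smul (f : L2) {χ : ℝ → ℝ} (hχ : Continuous χ)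
    (hc : HasCompactSupport χ) : Integrable (fun x => χ x • f x) :=
  ((Lp.memLp f).locallyIntegrable (by norm_num)).integrable_smul_left_of_hasCompactSupport hχ hc

theorem integrable_deriv_test_smul (f : L2) {χ : ℝ → ℝ} (hχ : ContDiff ℝ ∞ χ)
    (hc : HasCompactSupport χ) : Integrable (fun x => deriv χ x • f x) :=
  integrable_test_smul f (hχ.continuous_deriv (by simp)) hc.deriv

theorem IsWeakDeriv.add {f₁ g₁ f₂ g₂ : L2} (h₁ : IsWeakDeriv f₁ g₁) (h₂ : IsWeakDeriv f₂ g₂) :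
    IsWeakDeriv (f₁ + f₂) (g₁ + g₂) := by
  intro χ hχ hc
  have e₁ : ∫ x, deriv χ x • (f₁ + f₂ : L2) x
      = ∫ x, (deriv χ x • f₁ x + deriv χ x • f₂ x) := by
    refine integral_congr_ae ?_
    filter_upwards [Lp.coeFn_add f₁ f₂] with x hx
    rw [hx, Pi.add_apply, smul_add]
  have e₂ : ∫ x, χ x • (g₁ + g₂ : L2) x = ∫ x, (χ x • g₁ x + χ x • g₂ x) := by
    refine integral_congr_ae ?_
    filter_upwards [Lp.coeFn_add g₁ g₂] with x hx
    rw [hx, Pi.add_apply, smul_add]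
  rw [e₁, e₂, integral_add (integrable_deriv_test_smul f₁ hχ hc)
    (integrable_deriv_test_smul f₂ hχ hc), integral_add
    (integrable_test_smul g₁ hχ.continuous hc) (integrable_test_smul g₂ hχ.continuous hc),
    h₁ χ hχ hc, h₂ χ hχ hc, neg_add]

theorem IsWeakDeriv.smul {f g : L2} (c : ℂ) (h : IsWeakDeriv f g) :
    IsWeakDeriv (c • f) (c • g) := by
  intro χ hχ hc
  have e₁ : ∫ x, deriv χ x • (c • f : L2) x = ∫ x, c • (deriv χ x • f x) := by
    refine integral_congr_ae ?_
    filter_upwards [Lp.coeFn_smul c f] with x hx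
    rw [hx, Pi.smul_apply, smul_comm]
  have e₂ : ∫ x, χ x • (c • g : L2) x = ∫ x, c • (χ x • g x) := by
    refine integral_congr_ae ?_
    filter_upwards [Lp.coeFn_smul c g] with x hx
    rw [hx, Pi.smul_apply, smul_comm]
  rw [e₁, e₂, integral_smul, integral_smul, h χ hχ hc, smul_neg]

theorem IsWeakDeriv.zero : IsWeakDeriv 0 0 := by
  have h : ∀ χ : ℝ → ℝ, ∫ x, χ x • (0 : L2) x = 0 := by
    intro χ
    rw [← integral_zero ℝ Spinor]
    refine integral_congr_ae ?_
    filter_upwards [Lp.coeFn_zero Spinor 2 (volume : Measure ℝ)] with x hx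
    rw [hx, Pi.zero_apply, smul_zero]
  intro χ _ _
  rw [h, h, neg_zero]

theorem IsWeakDeriv.unique {f g₁ g₂ : L2} (h₁ : IsWeakDeriv f g₁) (h₂ : IsWeakDeriv f g₂) :
    g₁ = g₂ := by
  refine Lp.ext ?_
  refine ae_eq_of_integral_contDiff_smul_eq ((Lp.memLp g₁).locallyIntegrable (by norm_num))
    ((Lp.memLp g₂).locallyIntegrable (by norm_num)) ?_
  intro χ hχ hc
  exact neg_injective ((h₁ χ hχ hc).symm.trans (h₂ χ hχ hc))

/-- The Sobolev space `H¹(ℝ; ℂ²)`. -/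
def H1 : Submodule ℂ L2 where
  carrier := {f | ∃ g, IsWeakDeriv f g}
  zero_mem' := ⟨0, IsWeakDeriv.zero⟩
  add_mem' := fun ⟨g₁, h₁⟩ ⟨g₂, h₂⟩ => ⟨g₁ + g₂, h₁.add h₂⟩
  smul_mem' := fun c _ ⟨g, h⟩ => ⟨c • g, h.smul c⟩

/-- The weak derivative `∂ₓ : H¹ → L²`. -/
def weakDeriv : H1 →ₗ[ℂ] L2 where
  toFun f := f.2.choose
  map_add' f₁ f₂ := (f₁ + f₂).2.choose_spec.unique (f₁.2.choose_spec.add f₂.2.choose_spec)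
  map_smul' c f := (c • f).2.choose_spec.unique (f.2.choose_spec.smul c)

/-! ### Domain walls and the Dirac operator -/

/-- A smooth domain wall: `κ = 1` on `[L, ∞)` and `κ = -1` on `(-∞, -L]` for some `L > 0`. -/
structure DomainWall where
  toFun : ℝ → ℝ
  smooth : ContDiff ℝ ∞ toFun
  eventually_const : ∃ L : ℝ, 0 < L ∧ (∀ y, L ≤ y → toFun y = 1) ∧ (∀ y, y ≤ -L → toFun y = -1)

theorem DomainWall.bounded (κ : DomainWall) : ∃ C : ℝ, ∀ x, ‖κ.toFun x‖ ≤ C := by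
  obtain ⟨L, -, h1, h2⟩ := κ.eventually_const
  obtain ⟨C, hC⟩ := (isCompact_Icc (a := -L) (b := L)).exists_bound_of_continuousOn
    κ.smooth.continuous.continuousOn
  refine ⟨max C 1, fun x => ?_⟩
  rcases le_total L x with h | h
  · rw [h1 x h]; simp
  rcases le_total x (-L) with h' | h'
  · rw [h2 x h']; simp
  · exact (hC x ⟨h', h⟩).trans (le_max_left _ _)

theorem DomainWall.memLp_mul (κ : DomainWall) (u : L2) :
    MemLp (fun x => κ.toFun x • u x) 2 (volume : Measure ℝ) := by
  obtain ⟨C, hC⟩ := κ.bounded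
  refine MemLp.of_le_mul (c := C) (Lp.memLp u)
    (κ.smooth.continuous.aestronglyMeasurable.smul (Lp.memLp u).1) ?_
  filter_upwards with x
  rw [norm_smul]
  exact mul_le_mul_of_nonneg_right (hC x) (norm_nonneg _)

/-- Multiplication by `κ` on `L²(ℝ; ℂ²)`. -/
def DomainWall.mulL2 (κ : DomainWall) : L2 →ₗ[ℂ] L2 where
  toFun u := (κ.memLp_mul u).toLp
  map_add' u v := by
    refine Lp.ext ?_
    filter_upwards [(κ.memLp_mul (u + v)).coeFn_toLp, (κ.memLp_mul u).coeFn_toLp,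
      (κ.memLp_mul v).coeFn_toLp, Lp.coeFn_add u v,
      Lp.coeFn_add (κ.memLp_mul u).toLp (κ.memLp_mul v).toLp] with x h1 h2 h3 h4 h5
    rw [h1, h5, Pi.add_apply, h2, h3, h4, Pi.add_apply, smul_add]
  map_smul' c u := by
    refine Lp.ext ?_
    filter_upwards [(κ.memLp_mul (c • u)).coeFn_toLp, (κ.memLp_mul u).coeFn_toLp,
      Lp.coeFn_smul c u, Lp.coeFn_smul c (κ.memLp_mul u).toLp] with x h1 h2 h3 h4
    rw [h1, RingHom.id_apply, h4, Pi.smul_apply, h2, h3, Pi.smul_apply, smul_comm]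

/-- The pointwise action of a constant `2 × 2` matrix on `L²(ℝ; ℂ²)`. -/
def matL2 (M : Matrix (Fin 2) (Fin 2) ℂ) : L2 →ₗ[ℂ] L2 :=
  ((Matrix.toEuclideanCLM (𝕜 := ℂ) M).compLpL 2 (volume : Measure ℝ)).toLinearMap

/-- The Pauli matrix `σ₃`. -/
def sigma3 : Matrix (Fin 2) (Fin 2) ℂ := !![1, 0; 0, -1]

/-- The matrix `σ_⋆`. -/
def sigmaStar (ϑ : ℂ) : Matrix (Fin 2) (Fin 2) ℂ := !![0, conj ϑ; ϑ, 0]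

/-- The operator `ν σ₃ Dₓ + σ_⋆ κ`, `Dₓ = -i ∂ₓ`, on `L²(ℝ; ℂ²)` with domain `H¹(ℝ; ℂ²)`. -/
def diracOperator (ν ϑ : ℂ) (κ : DomainWall) : L2 →ₗ.[ℂ] L2 where
  domain := H1
  toFun := ν • (matL2 sigma3 ∘ₗ ((1 / Complex.I) • weakDeriv))
    + matL2 (sigmaStar ϑ) ∘ₗ κ.mulL2 ∘ₗ H1.subtype

/-! ### Dirac eigenbases -/

/-- The inner product of quasi-periodic functions, over one period cell; it is conjugate-linear in
the first argument. -/
def cellInner (f g : ℝ → ℂ) : ℂ := ∫ x in (0 : ℝ)..1, conj (f x) * g x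

/-- `(φp, φm)` is a Dirac eigenbasis of `P₀ = Dₓ² + V` at energy `E`: normalized eigenfunctions
with `S φp = i φp`, `S φm = -i φm`, where `S u (x) = u (x + 1/2)`, and `φm = conj φp`. In particular
both satisfy `φ (x + 1) = exp (i π) φ x`, so `E` is an eigenvalue at quasi-momentum `π`. -/
structure IsDiracEigenbasis (V : ℝ → ℝ) (E : ℝ) (φp φm : ℝ → ℂ) : Prop where
  smooth_p : ContDiff ℝ 2 φp
  smooth_m : ContDiff ℝ 2 φm
  eigen_p : ∀ x, -deriv (deriv φp) x + V x * φp x = E * φp x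
  eigen_m : ∀ x, -deriv (deriv φm) x + V x * φm x = E * φm x
  shift_p : ∀ x, φp (x + 1 / 2) = Complex.I * φp x
  shift_m : ∀ x, φm (x + 1 / 2) = -Complex.I * φm x
  conj_eq : ∀ x, conj (φp x) = φm x
  norm_p : cellInner φp φp = 1
  norm_m : cellInner φm φm = 1

/-- `ν_⋆ = 2 ⟨φ₊, Dₓ φ₊⟩`. -/
def nuStar (φp : ℝ → ℂ) : ℂ := 2 * cellInner φp (fun x => 1 / Complex.I * deriv φp x)

/-- `ϑ_⋆ = ⟨φ₊, W φ₋⟩`. -/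
def thetaStar (W : ℝ → ℝ) (φp φm : ℝ → ℂ) : ℂ := cellInner φp (fun x => W x * φm x)

/-- The Dirac operator `ν_⋆ σ₃ Dₓ + σ_⋆ κ` attached to a Dirac eigenbasis. -/
def slashedD (W : ℝ → ℝ) (κ : DomainWall) (φp φm : ℝ → ℂ) : L2 →ₗ.[ℂ] L2 :=
  diracOperator (nuStar φp) (thetaStar W φp φm) κ

end DiracWall

end

noncomputable section

namespace DiracWall

/-! ### Self-adjoint operators with a coercivity estimate -/

section Abstract

variable {H : Type*} [NormedAddCommGroup H] [InnerProductSpace ℂ H]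

/-! The operator is determined by `ν`, `ϑ` and `κ`, and everything rests on `ν` being real and
nonzero. Integration over the cell turns `ν` into `-i` times the Wronskian of `(φp, φm)`. This
Wronskian is constant, purely imaginary, and nonzero because the two functions are independent,
lying in different eigenspaces of the half-period shift (`nuStar_eq`, `wronskian_ne_zero`). Two
Dirac eigenbases differ by a phase `c` (`exists_phase`), which leaves `ν` alone and multiplies `ϑ`
by a unimodular number. Conjugation by a constant diagonal unitary matrix absorbs that number, so
the spectrum does not change (`spectrum_gauge`).

For `ν ≠ 0` the operator `D` is selfadjoint (`isSelfAdj_diracOperator`), so its spectrum is real.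
Squaring `D` and integrating the cross term by parts gives `ν²‖u'‖²` plus a potential equal to
`|ϑ|²` off a compact interval. On short cells of that interval a Poincaré inequality absorbs the
defect into `ν²‖u'‖²`, up to finitely many averages: `|ϑ|²‖u‖² ≤ ‖Du‖² + ‖Pu‖²` with `P` of finite
rank (`dirac_coercive`). This single estimate replaces compactness arguments. It shows that a point
of the gap that is not an eigenvalue is in the resolvent set (`mem_resolventSet_of_gap`), and that
the gap contains finitely many eigenvalues (`finite_eigenvalues`).

For `|μ| ≥ |ϑ|`, plane waves with slowly varying amplitude, placed where `κ = 1`, are approximate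
eigenvectors, so `μ` is in the spectrum (`mem_spectrum_of_le`). A conserved quadratic form on that
half-line excludes square-integrable eigenfunctions, also at the threshold
(`eigenspace_eq_bot_of_le`). Hence the essential spectrum is exactly the complement of the gap.

Eigenfunctions solve a first order system with trace-free coefficients. The Wronskian of two of them
is constant and integrable, hence zero, and this gives simplicity (`finrank_eigenspace_eq_one`). A
constant matrix anticommuting with `D` makes the eigenvalues symmetric (`eigenspace_neg_ne_bot`),
and an explicit decaying exponential is a zero mode (`eigenspace_zero_ne_bot`). -/

/-- `A` is symmetric and its adjoint is contained in `A`. -/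
structure IsSelfAdj (A : H →ₗ.[ℂ] H) : Prop where
  symm : ∀ u v : A.domain, inner ℂ (A u) (v : H) = inner ℂ (u : H) (A v)
  maximal : ∀ v w : H, (∀ u : A.domain, inner ℂ w (u : H) = inner ℂ v (A u)) →
    ∃ h : v ∈ A.domain, A ⟨v, h⟩ = w

/-- The duality relation tested in `maximal` passes to limits, so the graph is closed. -/
theorem IsSelfAdj.closed {A : H →ₗ.[ℂ] H} (hA : IsSelfAdj A) {u : ℕ → A.domain} {v w : H}
    (hu : Filter.Tendsto (fun n => (u n : H)) Filter.atTop (nhds v))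
    (hw : Filter.Tendsto (fun n => A (u n)) Filter.atTop (nhds w)) :
    ∃ h : v ∈ A.domain, A ⟨v, h⟩ = w := by
  refine hA.maximal v w fun x => ?_
  have h1 : Filter.Tendsto (fun n => inner ℂ (A (u n)) (x : H)) Filter.atTop
      (nhds (inner ℂ w (x : H))) := hw.inner tendsto_const_nhds
  have h2 : Filter.Tendsto (fun n => inner ℂ (u n : H) (A x)) Filter.atTop
      (nhds (inner ℂ v (A x))) := hu.inner tendsto_const_nhds
  simp_rw [hA.symm] at h1
  exact tendsto_nhds_unique h1 h2

/-- The operator `A - z` on the domain of `A`. -/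
def shiftOp (A : H →ₗ.[ℂ] H) (z : ℂ) : A.domain →ₗ[ℂ] H :=
  A.toFun - z • A.domain.subtype

theorem shiftOp_apply (A : H →ₗ.[ℂ] H) (z : ℂ) (u : A.domain) :
    shiftOp A z u = A u - z • (u : H) := rfl

/-- The lower bound makes `A - z` injective with closed range, since `A` is closed. The orthogonal
complement of the range is the kernel of `A - conj z`, which vanishes by `hk`. The inverse then has
norm at most `c⁻¹`. -/
theorem IsSelfAdj.mem_resolventSet [CompleteSpace H] {A : H →ₗ.[ℂ] H} (hA : IsSelfAdj A) {z : ℂ}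
    {c : ℝ} (hc : 0 < c) (hb : ∀ u : A.domain, c * ‖(u : H)‖ ≤ ‖A u - z • (u : H)‖)
    (hk : eigenspace A (conj z) = ⊥) : z ∈ resolventSet A := by
  set T := shiftOp A z with hT
  have hinj : Function.Injective T := by
    rw [injective_iff_map_eq_zero]
    intro u hu
    have h := hb u
    rw [← shiftOp_apply, ← hT, hu, norm_zero] at h
    have : ‖(u : H)‖ ≤ 0 := by
      by_contra h'
      push Not at h'
      nlinarith
    exact Subtype.ext (norm_le_zero_iff.1 this)
  have hclosed : IsClosed (LinearMap.range T : Set H) := by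
    rw [← isSeqClosed_iff_isClosed]
    intro y w hy hw
    choose u hu using hy
    have hcau : CauchySeq (fun n => (u n : H)) := by
      have h1 := hw.cauchySeq
      rw [Metric.cauchySeq_iff] at h1 ⊢
      intro ε hε
      obtain ⟨N, hN⟩ := h1 (c * ε) (mul_pos hc hε)
      refine ⟨N, fun m hm n hn => ?_⟩
      have h2 := hN m hm n hn
      rw [dist_eq_norm, ← hu, ← hu, ← map_sub] at h2
      have h3 := hb (u m - u n)
      rw [← shiftOp_apply, ← hT] at h3
      rw [dist_eq_norm]
      have h4 : c * ‖(u m : H) - u n‖ < c * ε := lt_of_le_of_lt h3 h2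
      exact lt_of_mul_lt_mul_left h4 hc.le
    obtain ⟨v, hv⟩ := cauchySeq_tendsto_of_complete hcau
    have hAu : Filter.Tendsto (fun n => A (u n)) Filter.atTop (nhds (w + z • v)) := by
      have := hw.add (hv.const_smul z)
      refine this.congr fun n => ?_
      rw [← hu, hT, shiftOp_apply]; simp
    obtain ⟨h, e⟩ := hA.closed hv hAu
    exact ⟨⟨v, h⟩, by rw [hT, shiftOp_apply, e]; simp⟩
  have hperp : (LinearMap.range T)ᗮ = ⊥ := by
    rw [eq_bot_iff]
    intro v hv
    rw [← hk]
    refine hA.maximal v _ fun u => ?_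
    have h := (Submodule.mem_orthogonal' _ _).1 hv (T u) ⟨u, rfl⟩
    rw [hT, shiftOp_apply, inner_sub_right, inner_smul_right, sub_eq_zero] at h
    rw [h, inner_smul_left, Complex.conj_conj]
  have hrange : LinearMap.range T = ⊤ := by
    have : CompleteSpace (LinearMap.range T) := hclosed.completeSpace_coe
    exact (Submodule.orthogonal_eq_bot_iff).1 hperp
  let e := LinearEquiv.ofBijective T ⟨hinj, LinearMap.range_eq_top.1 hrange⟩
  have he : ∀ u, e u = A u - z • (u : H) := fun u => rfl
  let R : H →L[ℂ] H := LinearMap.mkContinuous (A.domain.subtype ∘ₗ e.symm.toLinearMap) c⁻¹ (by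
    intro f
    have h := hb (e.symm f)
    rw [← he, e.apply_symm_apply] at h
    rw [inv_mul_eq_div, le_div_iff₀ hc, mul_comm]
    exact h)
  have hR : ∀ f, R f = (e.symm f : H) := fun f => rfl
  refine ⟨R, fun f => ⟨by rw [hR]; exact (e.symm f).2, ?_⟩, fun u => ?_⟩
  · have := he (e.symm f)
    rw [e.apply_symm_apply] at this
    exact this.symm
  · rw [hR, ← he, e.symm_apply_apply]

theorem eigenspace_eq_bot_of_bound {A : H →ₗ.[ℂ] H} {z : ℂ}
    {c : ℝ} (hc : 0 < c) (hb : ∀ u : A.domain, c * ‖(u : H)‖ ≤ ‖A u - z • (u : H)‖) :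
    eigenspace A z = ⊥ := by
  rw [eq_bot_iff]
  rintro u ⟨h, e⟩
  have := hb ⟨u, h⟩
  rw [e, sub_self, norm_zero] at this
  have : ‖u‖ ≤ 0 := by
    by_contra h'
    push Not at h'
    simp only at this
    nlinarith
  exact norm_le_zero_iff.1 this

theorem IsSelfAdj.im_inner {A : H →ₗ.[ℂ] H} (hA : IsSelfAdj A) (u : A.domain) :
    (inner ℂ (u : H) (A u)).im = 0 := by
  rw [← Complex.conj_eq_iff_im, inner_conj_symm, hA.symm]

/-- As `⟨u, Au⟩` is real, the imaginary part of `⟨u, (A - z)u⟩` is `-Im z ‖u‖²`; Cauchy–Schwarz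
concludes. -/
theorem IsSelfAdj.im_bound {A : H →ₗ.[ℂ] H} (hA : IsSelfAdj A) (z : ℂ) (u : A.domain) :
    |z.im| * ‖(u : H)‖ ≤ ‖A u - z • (u : H)‖ := by
  by_cases h0 : (u : H) = 0
  · rw [h0, norm_zero, mul_zero]; exact norm_nonneg _
  have hpos : 0 < ‖(u : H)‖ := norm_pos_iff.2 h0
  have h1 : (inner ℂ (u : H) (A u - z • (u : H))).im = -(z.im * ‖(u : H)‖ ^ 2) := by
    have h : inner ℂ (u : H) (u : H) = ((‖(u : H)‖ ^ 2 : ℝ) : ℂ) := by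
      rw [inner_self_eq_norm_sq_to_K]; push_cast; rfl
    rw [inner_sub_right, inner_smul_right, Complex.sub_im, hA.im_inner, h, Complex.im_mul_ofReal,
      zero_sub]
  have h2 := (Complex.abs_im_le_norm _).trans (norm_inner_le_norm (𝕜 := ℂ) (u : H)
    (A u - z • (u : H)))
  rw [h1, abs_neg, abs_mul, abs_of_nonneg (sq_nonneg ‖(u : H)‖)] at h2
  have h3 : ‖(u : H)‖ * (|z.im| * ‖(u : H)‖) ≤ ‖(u : H)‖ * ‖A u - z • (u : H)‖ := by
    nlinarith
  exact le_of_mul_le_mul_left h3 hpos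

theorem IsSelfAdj.mem_resolventSet_of_im_ne_zero [CompleteSpace H] {A : H →ₗ.[ℂ] H}
    (hA : IsSelfAdj A) {z : ℂ} (hz : z.im ≠ 0) : z ∈ resolventSet A := by
  refine hA.mem_resolventSet (abs_pos.2 hz) (hA.im_bound z)
    (eigenspace_eq_bot_of_bound (c := |z.im|) (abs_pos.2 hz) fun u => ?_)
  have := hA.im_bound (conj z) u
  rwa [Complex.conj_im, abs_neg] at this

theorem IsSelfAdj.eigenspace_eq_bot_of_im_ne_zero {A : H →ₗ.[ℂ] H}
    (hA : IsSelfAdj A) {z : ℂ} (hz : z.im ≠ 0) : eigenspace A z = ⊥ :=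
  eigenspace_eq_bot_of_bound (abs_pos.2 hz) (hA.im_bound z)

/-- A real number below the threshold `θ` that is not an eigenvalue lies in the resolvent set. -/
theorem IsSelfAdj.mem_resolventSet_of_gap [CompleteSpace H] {A : H →ₗ.[ℂ] H} (hA : IsSelfAdj A)
    {F : Type*} [NormedAddCommGroup F] [NormedSpace ℂ F] [FiniteDimensional ℂ F] (P : H →L[ℂ] F)
    {θ : ℝ} (hP : ∀ u : A.domain, θ ^ 2 * ‖(u : H)‖ ^ 2 ≤ ‖A u‖ ^ 2 + ‖P u‖ ^ 2)
    {μ : ℝ} (hμ : |μ| < θ) (hk : eigenspace A (μ : ℂ) = ⊥) : (μ : ℂ) ∈ resolventSet A := by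
  suffices h : ∃ c > 0, ∀ u : A.domain, c * ‖(u : H)‖ ≤ ‖A u - (μ : ℂ) • (u : H)‖ by
    obtain ⟨c, hc, hb⟩ := h
    exact hA.mem_resolventSet hc hb (by rwa [Complex.conj_ofReal])
  by_contra hcon
  push Not at hcon
  -- Failure of every lower bound gives a sequence of approximate unit eigenvectors. The rest
  -- extracts a convergent subsequence, whose limit is a genuine unit eigenvector, contradicting
  -- `hk`.
  have hex : ∀ n : ℕ, ∃ u : A.domain, ‖(u : H)‖ = 1 ∧
      ‖A u - (μ : ℂ) • (u : H)‖ < 1 / ((n : ℝ) + 1) := by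
    intro n
    obtain ⟨u, hu⟩ := hcon (1 / ((n : ℝ) + 1)) (by positivity)
    have hu0 : ‖(u : H)‖ ≠ 0 := by
      intro h
      rw [h, mul_zero] at hu
      exact absurd hu (not_lt.2 (norm_nonneg _))
    have hpos : 0 < ‖(u : H)‖ := lt_of_le_of_ne (norm_nonneg _) (Ne.symm hu0)
    refine ⟨((‖(u : H)‖⁻¹ : ℝ) : ℂ) • u, ?_, ?_⟩
    · rw [Submodule.coe_smul, norm_smul, Complex.norm_real, norm_inv, norm_norm,
        inv_mul_cancel₀ hu0]
    · rw [LinearPMap.map_smul, Submodule.coe_smul, smul_comm, ← smul_sub, norm_smul,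
        Complex.norm_real, norm_inv, norm_norm, inv_mul_eq_div, div_lt_iff₀ hpos]
      exact hu
  choose u hu1 huε using hex
  have hbd : ∀ n, P (u n) ∈ Metric.closedBall (0 : F) ‖P‖ := by
    intro n
    rw [mem_closedBall_zero_iff]
    simpa [hu1 n] using P.le_opNorm (u n)
  have : ProperSpace F := FiniteDimensional.proper ℂ F
  -- Compactness enters only here, in the finite-dimensional target of `P`. The coercivity estimate
  -- applied to differences then makes the vectors themselves Cauchy.
  obtain ⟨p, -, s, hs, hp⟩ := (isCompact_closedBall (0 : F) ‖P‖).tendsto_subseq hbd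
  have hcp : CauchySeq (fun n => P (u (s n))) := hp.cauchySeq
  have hgap : 0 < θ ^ 2 - μ ^ 2 := by
    rw [← sq_abs μ]
    nlinarith [abs_nonneg μ]
  have hε0 : Filter.Tendsto (fun n : ℕ => 1 / ((n : ℝ) + 1)) Filter.atTop (nhds 0) :=
    tendsto_one_div_add_atTop_nhds_zero_nat
  have hcau : CauchySeq (fun n => (u (s n) : H)) := by
    rw [Metric.cauchySeq_iff] at hcp ⊢
    intro ε hε
    have hη : 0 < (θ ^ 2 - μ ^ 2) * ε ^ 2 / 2 := by positivity
    obtain ⟨N₁, hN₁⟩ := hcp (Real.sqrt ((θ ^ 2 - μ ^ 2) * ε ^ 2 / 2)) (Real.sqrt_pos.2 hη)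
    -- A difference `d` has `‖d‖ ≤ 2` and `‖Ad‖ ≤ 2δ + |μ|‖d‖`. For `δ < 1` the square is at most
    -- `δ(4 + 8|μ|) + μ²‖d‖²`. This explains the constant, and `μ²‖d‖²` is absorbed by `θ²‖d‖²`.
    obtain ⟨N₂, hN₂⟩ := Filter.eventually_atTop.1
      ((hε0.eventually (gt_mem_nhds (show 0 < min 1
        ((θ ^ 2 - μ ^ 2) * ε ^ 2 / 2 / (4 + 8 * |μ|)) by positivity))))
    refine ⟨max N₁ N₂, fun m hm n hn => ?_⟩
    have hPd := hN₁ m (le_of_max_le_left hm) n (le_of_max_le_left hn)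
    rw [dist_eq_norm, ← map_sub] at hPd
    have hδ := hN₂ N₂ le_rfl
    set δ := 1 / ((N₂ : ℝ) + 1) with hδdef
    have hle : ∀ k, max N₁ N₂ ≤ k → ‖A (u (s k)) - (μ : ℂ) • (u (s k) : H)‖ ≤ δ := by
      intro k hk'
      refine (huε (s k)).le.trans ?_
      have h1 : N₂ ≤ s k := (le_of_max_le_right hk').trans (hs.id_le k)
      have h2 : (N₂ : ℝ) ≤ s k := by exact_mod_cast h1
      exact one_div_le_one_div_of_le (by positivity) (by linarith)
    have hmain := hP (u (s m) - u (s n))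
    set d := u (s m) - u (s n) with hd
    have hd2 : ‖(d : H)‖ ≤ 2 := by
      rw [hd, Submodule.coe_sub]
      exact (norm_sub_le _ _).trans (by rw [hu1, hu1]; norm_num)
    have hf : ‖A d - (μ : ℂ) • (d : H)‖ ≤ 2 * δ := by
      have : A d - (μ : ℂ) • (d : H) = (A (u (s m)) - (μ : ℂ) • (u (s m) : H))
          - (A (u (s n)) - (μ : ℂ) • (u (s n) : H)) := by
        rw [hd, LinearPMap.map_sub, Submodule.coe_sub, smul_sub]; abel
      rw [this]
      exact (norm_sub_le _ _).trans (by linarith [hle m hm, hle n hn])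
    have hAd : ‖A d‖ ≤ 2 * δ + |μ| * ‖(d : H)‖ := by
      have := norm_add_le (A d - (μ : ℂ) • (d : H)) ((μ : ℂ) • (d : H))
      rw [sub_add_cancel, norm_smul, Complex.norm_real, Real.norm_eq_abs] at this
      linarith
    have hPd2 : ‖P (d : H)‖ ^ 2 < (θ ^ 2 - μ ^ 2) * ε ^ 2 / 2 :=
      (Real.lt_sqrt (norm_nonneg _)).1 hPd
    have hδ0 : 0 < δ := by positivity
    have hδ1 : δ < 1 := lt_of_lt_of_le hδ (min_le_left _ _)
    have hδ2 : δ * (4 + 8 * |μ|) < (θ ^ 2 - μ ^ 2) * ε ^ 2 / 2 := by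
      have := lt_of_lt_of_le hδ (min_le_right _ _)
      rwa [lt_div_iff₀ (by positivity)] at this
    have hAd2 : ‖A d‖ ^ 2 ≤ (2 * δ + |μ| * ‖(d : H)‖) ^ 2 :=
      pow_le_pow_left₀ (norm_nonneg _) hAd 2
    have hexp : (2 * δ + |μ| * ‖(d : H)‖) ^ 2
        ≤ δ * (4 + 8 * |μ|) + μ ^ 2 * ‖(d : H)‖ ^ 2 := by
      have e1 : δ * δ ≤ δ * 1 := mul_le_mul_of_nonneg_left hδ1.le hδ0.le
      have e2 : δ * |μ| * ‖(d : H)‖ ≤ δ * |μ| * 2 :=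
        mul_le_mul_of_nonneg_left hd2 (by positivity)
      have e3 : (2 * δ + |μ| * ‖(d : H)‖) ^ 2
        = 4 * (δ * δ) + 4 * (δ * |μ| * ‖(d : H)‖) + μ ^ 2 * ‖(d : H)‖ ^ 2 := by
          rw [← sq_abs μ]; ring
      rw [e3]
      nlinarith
    have hfin : (θ ^ 2 - μ ^ 2) * ‖(d : H)‖ ^ 2 < (θ ^ 2 - μ ^ 2) * ε ^ 2 := by
      nlinarith
    have h5 : ‖(d : H)‖ ^ 2 < ε ^ 2 := lt_of_mul_lt_mul_left hfin hgap.le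
    rw [dist_eq_norm]
    exact lt_of_pow_lt_pow_left₀ 2 hε.le h5
  obtain ⟨v, hv⟩ := cauchySeq_tendsto_of_complete hcau
  have hf0 : Filter.Tendsto (fun n => A (u (s n)) - (μ : ℂ) • (u (s n) : H)) Filter.atTop
      (nhds 0) := by
    have h1 := hε0.comp hs.tendsto_atTop
    exact squeeze_zero_norm (fun n => (huε (s n)).le) h1
  have hAv : Filter.Tendsto (fun n => A (u (s n))) Filter.atTop (nhds ((μ : ℂ) • v)) := by
    have := hf0.add (hv.const_smul (μ : ℂ))
    simpa using this
  obtain ⟨h, e⟩ := hA.closed hv hAv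
  have hv0 : v ∈ eigenspace A (μ : ℂ) := ⟨h, e⟩
  rw [hk, Submodule.mem_bot] at hv0
  have hn : Filter.Tendsto (fun n => ‖(u (s n) : H)‖) Filter.atTop (nhds ‖v‖) := hv.norm
  simp_rw [hu1] at hn
  have := tendsto_nhds_unique hn tendsto_const_nhds
  rw [hv0, norm_zero] at this
  exact zero_ne_one this

theorem IsSelfAdj.inner_eigen_eq_zero {A : H →ₗ.[ℂ] H} (hA : IsSelfAdj A) {μ ν : ℝ}
    (h : μ ≠ ν) {u v : H} (hu : u ∈ eigenspace A (μ : ℂ)) (hv : v ∈ eigenspace A (ν : ℂ)) :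
    inner ℂ u v = 0 := by
  obtain ⟨hu1, hu2⟩ := hu
  obtain ⟨hv1, hv2⟩ := hv
  have := hA.symm ⟨u, hu1⟩ ⟨v, hv1⟩
  rw [hu2, hv2] at this
  simp only [inner_smul_left, inner_smul_right, Complex.conj_ofReal] at this
  rw [← sub_eq_zero, ← sub_mul] at this
  rcases mul_eq_zero.1 this with h' | h'
  · exact absurd (by exact_mod_cast sub_eq_zero.1 h') h
  · exact h'

/-- Only finitely many eigenvalues lie below the threshold `θ`. -/
theorem IsSelfAdj.finite_eigenvalues {A : H →ₗ.[ℂ] H} (hA : IsSelfAdj A)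
    {F : Type*} [NormedAddCommGroup F] [NormedSpace ℂ F] [FiniteDimensional ℂ F] (P : H →L[ℂ] F)
    {θ : ℝ} (hP : ∀ u : A.domain, θ ^ 2 * ‖(u : H)‖ ^ 2 ≤ ‖A u‖ ^ 2 + ‖P u‖ ^ 2) :
    {μ : ℝ | |μ| < θ ∧ eigenspace A (μ : ℂ) ≠ ⊥}.Finite := by
  by_contra hinf
  -- One eigenvector more than the dimension of `F` forces a nontrivial combination killed by `P`.
  -- By orthogonality `A` has norm less than `θ‖v‖` on it, against the coercivity estimate.
  obtain ⟨t, ht, hcard⟩ := Set.Infinite.exists_subset_card_eq hinf (Module.finrank ℂ F + 1)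
  have hex : ∀ μ : t, ∃ u : H, u ∈ eigenspace A ((μ : ℝ) : ℂ) ∧ ‖u‖ = 1 := by
    intro μ
    obtain ⟨u, hu, hu0⟩ := Submodule.exists_mem_ne_zero_of_ne_bot (ht μ.2).2
    refine ⟨((‖u‖⁻¹ : ℝ) : ℂ) • u, Submodule.smul_mem _ _ hu, ?_⟩
    rw [norm_smul, Complex.norm_real, norm_inv, norm_norm, inv_mul_cancel₀ (norm_ne_zero_iff.2 hu0)]
  choose e he hn using hex
  have hon : Orthonormal ℂ e := ⟨hn, fun i j hij =>
    hA.inner_eigen_eq_zero (fun h => hij (Subtype.ext h)) (he i) (he j)⟩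
  obtain ⟨c, hc, i₀, hi₀⟩ : ∃ c : t → ℂ, ∑ i, c i • P (e i) = 0 ∧ ∃ i, c i ≠ 0 := by
    have hnl : ¬ LinearIndependent ℂ (fun i : t => P (e i)) := by
      intro hl
      have := hl.fintype_card_le_finrank
      rw [Fintype.card_coe, hcard] at this
      omega
    exact Fintype.not_linearIndependent_iff.1 hnl
  choose hdom hAe using he
  set v : A.domain := ∑ i, c i • (⟨e i, hdom i⟩ : A.domain) with hv
  have hvH : (v : H) = ∑ i, c i • e i := by
    rw [hv]; simp
  have hAv : A v = ∑ i, (c i * ((i : ℝ) : ℂ)) • e i := by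
    have h1 : A v = A.toFun v := rfl
    rw [h1, hv, map_sum]
    refine Finset.sum_congr rfl fun i _ => ?_
    rw [map_smul]
    have : A.toFun ⟨e i, hdom i⟩ = ((i : ℝ) : ℂ) • e i := hAe i
    rw [this, smul_smul]
  have hnorm : ∀ a : t → ℂ, ‖∑ i, a i • e i‖ ^ 2 = ∑ i, ‖a i‖ ^ 2 := by
    intro a
    have := hon.inner_sum a a Finset.univ
    rw [inner_self_eq_norm_sq_to_K] at this
    have h2 : ((‖∑ i, a i • e i‖ ^ 2 : ℝ) : ℂ) = ((∑ i, ‖a i‖ ^ 2 : ℝ) : ℂ) := by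
      push_cast
      refine this.trans (Finset.sum_congr rfl fun i _ => ?_)
      rw [RCLike.conj_mul]; rfl
    exact_mod_cast h2
  have hPv : P (v : H) = 0 := by
    rw [hvH, map_sum]
    simpa using hc
  have hmain := hP v
  rw [hPv, norm_zero, hvH, hAv, hnorm, hnorm, Finset.mul_sum] at hmain
  have hlt : ∑ i : t, ‖c i * ((i : ℝ) : ℂ)‖ ^ 2 < ∑ i : t, θ ^ 2 * ‖c i‖ ^ 2 := by
    have hsq : ∀ i : t, (i : ℝ) ^ 2 < θ ^ 2 := fun i => by
      have := (ht i.2).1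
      rw [← sq_abs (i : ℝ)]
      exact pow_lt_pow_left₀ this (abs_nonneg _) two_ne_zero
    refine Finset.sum_lt_sum (fun i _ => ?_) ⟨i₀, Finset.mem_univ _, ?_⟩
    · rw [norm_mul, Complex.norm_real, mul_pow, Real.norm_eq_abs, sq_abs, mul_comm]
      exact mul_le_mul_of_nonneg_right (hsq i).le (sq_nonneg _)
    · rw [norm_mul, Complex.norm_real, mul_pow, Real.norm_eq_abs, sq_abs, mul_comm]
      exact mul_lt_mul_of_pos_right (hsq i₀) (by have := norm_pos_iff.2 hi₀; positivity)
  linarith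

/-- An intertwining isomorphism carries the resolvent set of `A` into that of `B`. -/
theorem resolventSet_subset_of_intertwine {A B : H →ₗ.[ℂ] H} (T S : H →L[ℂ] H)
    (hTS : ∀ f, T (S f) = f)
    (hT : ∀ u : A.domain, ∃ h : T u ∈ B.domain, B ⟨T u, h⟩ = T (A u))
    (hS : ∀ u : B.domain, ∃ h : S u ∈ A.domain, A ⟨S u, h⟩ = S (B u)) :
    resolventSet A ⊆ resolventSet B := by
  rintro z ⟨R, h1, h2⟩
  refine ⟨T ∘L R ∘L S, fun f => ?_, fun u => ?_⟩
  · obtain ⟨h, e⟩ := h1 (S f)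
    obtain ⟨h', e'⟩ := hT ⟨_, h⟩
    refine ⟨h', ?_⟩
    have : B ⟨(T ∘L R ∘L S) f, h'⟩ = T (A ⟨R (S f), h⟩) := e'
    rw [this]
    change _ - z • T (R (S f)) = f
    rw [← map_smul, ← map_sub, e, hTS]
  · obtain ⟨h, e⟩ := hS u
    have := h2 ⟨_, h⟩
    rw [e, ← map_smul, ← map_sub] at this
    change T (R (S _)) = _
    rw [this]
    exact hTS _

end Abstract

/-! ### Primitives of locally integrable functions -/

section Primitive

variable {E E' : Type*} [NormedAddCommGroup E] [NormedSpace ℝ E] [NormedAddCommGroup E']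
  [NormedSpace ℝ E']

/-- `F` is a primitive of the locally integrable function `f`. -/
structure IsPrimitive (F f : ℝ → E) : Prop where
  int : ∀ a b, IntervalIntegrable f volume a b
  sub_eq : ∀ a b, F b - F a = ∫ x in a..b, f x

theorem IsPrimitive.eq_add {F f : ℝ → E} (h : IsPrimitive F f) (a x : ℝ) :
    F x = F a + ∫ t in a..x, f t := by rw [← h.sub_eq]; abel

theorem IsPrimitive.continuous [CompleteSpace E] {F f : ℝ → E} (h : IsPrimitive F f) :
    Continuous F := by
  have : F = fun x => F 0 + ∫ t in (0 : ℝ)..x, f t := funext fun x => h.eq_add 0 x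
  rw [this]
  exact continuous_const.add (intervalIntegral.continuous_primitive h.int 0)

theorem IsPrimitive.comp_clm [CompleteSpace E] [CompleteSpace E'] {F f : ℝ → E}
    (h : IsPrimitive F f) (ℓ : E →L[ℝ] E') :
    IsPrimitive (fun x => ℓ (F x)) (fun x => ℓ (f x)) where
  int a b := ⟨ℓ.integrable_comp (h.int a b).1, ℓ.integrable_comp (h.int a b).2⟩
  sub_eq a b := by
    rw [← map_sub, h.sub_eq, ContinuousLinearMap.intervalIntegral_comp_comm _ (h.int a b)]

theorem IsPrimitive.add {F f G g : ℝ → E} (hF : IsPrimitive F f) (hG : IsPrimitive G g) :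
    IsPrimitive (fun x => F x + G x) (fun x => f x + g x) where
  int a b := (hF.int a b).add (hG.int a b)
  sub_eq a b := by
    rw [intervalIntegral.integral_add (hF.int a b) (hG.int a b), ← hF.sub_eq, ← hG.sub_eq]
    abel

theorem IsPrimitive.of_hasDerivAt [CompleteSpace E] {F f : ℝ → E} (h : ∀ x, HasDerivAt F (f x) x)
    (hf : Continuous f) : IsPrimitive F f where
  int a b := hf.intervalIntegrable a b
  sub_eq a b := (intervalIntegral.integral_eq_sub_of_hasDerivAt (fun x _ => h x)
    (hf.intervalIntegrable a b)).symm

theorem IsPrimitive.hasDerivAt [CompleteSpace E] {F f : ℝ → E} (h : IsPrimitive F f)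
    (hf : Continuous f) (x : ℝ) : HasDerivAt F (f x) x := by
  have : F = fun x => F 0 + ∫ t in (0 : ℝ)..x, f t := funext fun x => h.eq_add 0 x
  rw [this]
  exact (intervalIntegral.integral_hasDerivAt_right (h.int 0 x)
    hf.aestronglyMeasurable.stronglyMeasurableAtFilter hf.continuousAt).const_add _

theorem IsPrimitive.congr_ae {F f g : ℝ → E} (h : IsPrimitive F f) (hfg : f =ᵐ[volume] g) :
    IsPrimitive F g where
  int a b := (h.int a b).congr_ae (ae_restrict_of_ae hfg)
  sub_eq a b := by
    rw [h.sub_eq]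
    exact intervalIntegral.integral_congr_ae (hfg.mono fun x hx _ => hx)

theorem IsPrimitive.absolutelyContinuous {F f : ℝ → ℝ} (h : IsPrimitive F f) (a b : ℝ) :
    AbsolutelyContinuousOnInterval F a b := by
  have : F = fun x => F a + ∫ t in a..x, f t := funext fun x => h.eq_add a x
  rw [this]
  have hc : AbsolutelyContinuousOnInterval (fun _ : ℝ => F a) a b :=
    ((LipschitzWith.const (F a)).lipschitzOnWith (s := uIcc a b)).absolutelyContinuousOnInterval
  exact hc.add ((h.int a b).absolutelyContinuousOnInterval_intervalIntegral left_mem_uIcc)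

theorem IsPrimitive.ae_hasDerivAt {F f : ℝ → ℝ} (h : IsPrimitive F f) (a b : ℝ) :
    ∀ᵐ x, x ∈ uIcc a b → HasDerivAt F (f x) x := by
  have : F = fun x => F a + ∫ t in a..x, f t := funext fun x => h.eq_add a x
  rw [this]
  filter_upwards [(h.int a b).ae_hasDerivAt_integral] with x hx hxab
  exact (hx hxab a left_mem_uIcc).const_add _

/-- Primitives of locally integrable functions are absolutely continuous, so the product rule holds
in integrated form. The vector-valued and complex versions below reduce to this one, by testing with
real functionals and by splitting a factor into real and imaginary parts. -/
theorem IsPrimitive.mul {F f G g : ℝ → ℝ} (hF : IsPrimitive F f) (hG : IsPrimitive G g) :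
    IsPrimitive (fun x => F x * G x) (fun x => f x * G x + F x * g x) where
  int a b := ((hF.int a b).mul_continuousOn hG.continuous.continuousOn).add
    ((hG.int a b).continuousOn_mul hF.continuous.continuousOn)
  sub_eq a b := by
    rw [← (hF.absolutelyContinuous a b).integral_deriv_mul_eq_sub (hG.absolutelyContinuous a b)]
    refine intervalIntegral.integral_congr_ae ?_
    filter_upwards [hF.ae_hasDerivAt a b, hG.ae_hasDerivAt a b] with x h1 h2 hx
    rw [(h1 (uIoc_subset_uIcc hx)).deriv, (h2 (uIoc_subset_uIcc hx)).deriv]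

theorem IsPrimitive.smul [CompleteSpace E] {F f : ℝ → ℝ} {G g : ℝ → E} (hF : IsPrimitive F f)
    (hG : IsPrimitive G g) :
    IsPrimitive (fun x => F x • G x) (fun x => f x • G x + F x • g x) := by
  have hint : ∀ a b, IntervalIntegrable (fun x => f x • G x + F x • g x) volume a b :=
    fun a b => ((hF.int a b).smul_continuousOn hG.continuous.continuousOn).add
      ((hG.int a b).continuousOn_smul hF.continuous.continuousOn)
  refine ⟨hint, fun a b => ?_⟩
  rw [SeparatingDual.eq_iff_forall_dual_eq (R := ℝ)]
  intro ℓ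
  rw [← ContinuousLinearMap.intervalIntegral_comp_comm _ (hint a b), map_sub]
  have := (hF.mul (hG.comp_clm ℓ)).sub_eq a b
  simpa using this

theorem IsPrimitive.mul_complex {F f G g : ℝ → ℂ} (hF : IsPrimitive F f) (hG : IsPrimitive G g) :
    IsPrimitive (fun x => F x * G x) (fun x => f x * G x + F x * g x) := by
  have h1 := (hF.comp_clm Complex.reCLM).smul hG
  have h2 := (hF.comp_clm Complex.imCLM).smul
    (hG.comp_clm ((ContinuousLinearMap.mul ℝ ℂ) Complex.I))
  have h := h1.add h2
  have key : ∀ z w : ℂ, Complex.reCLM z • w + Complex.imCLM z • (ContinuousLinearMap.mul ℝ ℂ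
      Complex.I) w = z * w := by
    intro z w
    conv_rhs => rw [← Complex.re_add_im z]
    simp only [Complex.reCLM_apply, Complex.imCLM_apply, Complex.real_smul,
      ContinuousLinearMap.mul_apply']
    ring
  convert h using 1
  · funext x; rw [key]
  · funext x
    rw [← key (f x) (G x), ← key (F x) (g x)]
    abel

theorem IsPrimitive.conj {F f : ℝ → ℂ} (hF : IsPrimitive F f) :
    IsPrimitive (fun x => conj (F x)) (fun x => conj (f x)) :=
  hF.comp_clm Complex.conjCLE.toContinuousLinearMap

/-- If a primitive and its derivative are integrable, the derivative has integral zero. -/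
theorem IsPrimitive.integral_eq_zero [CompleteSpace E] {F f : ℝ → E} (h : IsPrimitive F f)
    (hF : Integrable F) (hf : Integrable f) : ∫ x, f x = 0 := by
  have htop : Filter.Tendsto F Filter.atTop (nhds (F 0 + ∫ x in Ioi (0 : ℝ), f x)) := by
    have := intervalIntegral_tendsto_integral_Ioi 0 hf.integrableOn Filter.tendsto_id
    exact (this.const_add (F 0)).congr fun x => (h.eq_add 0 x).symm
  have hbot : Filter.Tendsto F Filter.atBot (nhds (F 0 - ∫ x in Iic (0 : ℝ), f x)) := by
    have := intervalIntegral_tendsto_integral_Iic 0 hf.integrableOn Filter.tendsto_id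
    refine (this.const_sub (F 0)).congr fun x => ?_
    rw [id, ← h.sub_eq]; abel
  -- A nonzero limit at infinity would keep `‖F‖` above a positive constant on a half-line, which
  -- has infinite measure.
  have htop0 : F 0 + ∫ x in Ioi (0 : ℝ), f x = 0 := by
    by_contra hne
    have hpos := norm_pos_iff.2 hne
    obtain ⟨M, hM⟩ := Filter.eventually_atTop.1
      (htop.norm.eventually (lt_mem_nhds (half_lt_self hpos)))
    have hfin := hF.norm.measure_gt_lt_top (half_pos hpos)
    have hsub : Ici M ⊆ {a | ‖F 0 + ∫ x in Ioi (0 : ℝ), f x‖ / 2 < ‖F a‖} := fun x hx => hM x hx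
    have := (measure_mono hsub).trans_lt hfin
    simp at this
  have hbot0 : F 0 - ∫ x in Iic (0 : ℝ), f x = 0 := by
    by_contra hne
    have hpos := norm_pos_iff.2 hne
    obtain ⟨M, hM⟩ := Filter.eventually_atBot.1
      (hbot.norm.eventually (lt_mem_nhds (half_lt_self hpos)))
    have hfin := hF.norm.measure_gt_lt_top (half_pos hpos)
    have hsub : Iic M ⊆ {a | ‖F 0 - ∫ x in Iic (0 : ℝ), f x‖ / 2 < ‖F a‖} := fun x hx => hM x hx
    have := (measure_mono hsub).trans_lt hfin
    simp at this
  have := integral_add_compl (s := Iic (0 : ℝ)) measurableSet_Iic hf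
  rw [compl_Iic] at this
  rw [← this, ← sub_eq_zero.1 hbot0]
  exact htop0

end Primitive

/-! ### Functions with vanishing weak derivative -/

section DuBoisReymond

variable {E : Type*} [NormedAddCommGroup E] [NormedSpace ℝ E] [CompleteSpace E]

/-- A smooth compactly supported function with integral zero is the derivative of a smooth compactly
supported function. -/
theorem exists_test_deriv_eq {ψ : ℝ → ℝ} (hψ : ContDiff ℝ ∞ ψ) (hc : HasCompactSupport ψ)
    (h0 : ∫ x, ψ x = 0) :
    ∃ χ : ℝ → ℝ, ContDiff ℝ ∞ χ ∧ HasCompactSupport χ ∧ deriv χ = ψ := by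
  obtain ⟨R, hR⟩ := hc.isCompact.isBounded.subset_closedBall 0
  have hR' : ∀ x, |x| > R → ψ x = 0 := by
    intro x hx
    by_contra hne
    have : x ∈ Metric.closedBall (0 : ℝ) R := hR (subset_tsupport _ hne)
    rw [mem_closedBall_zero_iff, Real.norm_eq_abs] at this
    linarith
  -- The base point lies to the left of the support of `ψ`. On the far right the integral is the
  -- total one, hence zero. The radius `R` may be negative, in which case `ψ` vanishes identically;
  -- this is why the sign of `R` is examined below.
  set χ : ℝ → ℝ := fun x => ∫ t in (-R - 1)..x, ψ t with hχ
  have hd : ∀ x, HasDerivAt χ (ψ x) x := fun x =>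
    intervalIntegral.integral_hasDerivAt_right (hψ.continuous.intervalIntegrable _ _)
      hψ.continuous.aestronglyMeasurable.stronglyMeasurableAtFilter hψ.continuous.continuousAt
  have hdχ : deriv χ = ψ := funext fun x => (hd x).deriv
  refine ⟨χ, ?_, ?_, hdχ⟩
  · rw [contDiff_infty_iff_deriv]
    exact ⟨fun x => (hd x).differentiableAt, by rwa [hdχ]⟩
  · refine HasCompactSupport.of_support_subset_isCompact
      (isCompact_Icc (a := -R - 1) (b := R + 1)) ?_
    intro x hx
    by_contra hout
    refine hx ?_
    rw [mem_Icc, not_and_or, not_le, not_le] at hout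
    rcases hout with h | h
    · rw [hχ]
      simp only
      rw [intervalIntegral.integral_symm, neg_eq_zero]
      refine intervalIntegral.integral_zero_ae (Filter.Eventually.of_forall fun t ht => hR' t ?_)
      rw [uIoc_of_le h.le] at ht
      rcases le_or_gt 0 R with h' | h'
      · rw [abs_of_neg (by linarith [ht.2])]; linarith [ht.2]
      · linarith [abs_nonneg t]
    · rw [hχ]
      simp only
      by_cases hlt : 0 ≤ R
      · rw [intervalIntegral.integral_of_le (by linarith),
          setIntegral_eq_integral_of_forall_compl_eq_zero, h0]
        intro t ht
        refine hR' t ?_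
        rw [mem_Ioc, not_and_or, not_lt, not_le] at ht
        rcases ht with ht | ht
        · rw [abs_of_neg (by linarith)]; linarith
        · rw [abs_of_pos (by linarith)]; linarith
      · push Not at hlt
        exact intervalIntegral.integral_zero_ae
          (Filter.Eventually.of_forall fun t _ => hR' t (by linarith [abs_nonneg t]))

/-- For a bump `ρ` of integral one, `ψ - (∫ψ)ρ` has integral zero and is therefore the derivative of
a test function. Testing `h` against it identifies the constant as `∫ ρ h`. -/
theorem ae_eq_const_of_integral_deriv_smul_eq_zero {h : ℝ → E} (hh : LocallyIntegrable h)
    (h0 : ∀ χ : ℝ → ℝ, ContDiff ℝ ∞ χ → HasCompactSupport χ → ∫ x, deriv χ x • h x = 0) :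
    ∃ c : E, h =ᵐ[volume] fun _ => c := by
  let b : ContDiffBump (0 : ℝ) := ⟨1, 2, by norm_num, by norm_num⟩
  set ρ : ℝ → ℝ := b.normed volume with hρ
  have hρs : ContDiff ℝ ∞ ρ := b.contDiff_normed
  have hρc : HasCompactSupport ρ := b.hasCompactSupport_normed
  have hρ1 : ∫ x, ρ x = 1 := b.integral_normed
  refine ⟨∫ x, ρ x • h x, ?_⟩
  refine ae_eq_of_integral_contDiff_smul_eq hh (continuous_const.locallyIntegrable) ?_
  intro ψ hψ hψc
  have hψi : Integrable ψ := hψ.continuous.integrable_of_hasCompactSupport hψc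
  have hρi : Integrable ρ := hρs.continuous.integrable_of_hasCompactSupport hρc
  have hψh : Integrable fun x => ψ x • h x :=
    hh.integrable_smul_left_of_hasCompactSupport hψ.continuous hψc
  have hρh : Integrable fun x => ρ x • h x :=
    hh.integrable_smul_left_of_hasCompactSupport hρs.continuous hρc
  obtain ⟨χ, h1, h2, h3⟩ := exists_test_deriv_eq (ψ := fun x => ψ x - (∫ t, ψ t) * ρ x)
    (hψ.sub (contDiff_const.mul hρs)) (hψc.sub hρc.mul_left) (by
      rw [integral_sub hψi (hρi.const_mul _), integral_const_mul, hρ1, mul_one, sub_self])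
  have := h0 χ h1 h2
  rw [h3] at this
  simp_rw [sub_smul, mul_smul] at this
  rw [integral_sub hψh (hρh.fun_smul (∫ t, ψ t)), integral_smul, sub_eq_zero] at this
  rw [this, integral_smul_const]

end DuBoisReymond

/-! ### Representatives of functions in `H¹(ℝ; ℂ²)` -/

section Sobolev

theorem L2.intervalIntegrable (g : L2) (a b : ℝ) : IntervalIntegrable g volume a b :=
  (((Lp.memLp g).locallyIntegrable (by norm_num)).integrableOn_isCompact
    isCompact_uIcc).intervalIntegrable

/-- Integration by parts of a primitive against a test function. -/
theorem IsPrimitive.integral_deriv_test_smul {U g : ℝ → Spinor} (h : IsPrimitive U g)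
    (hg : LocallyIntegrable g) {χ : ℝ → ℝ} (hχ : ContDiff ℝ ∞ χ) (hc : HasCompactSupport χ) :
    ∫ x, deriv χ x • U x = -∫ x, χ x • g x := by
  have hχ' : Continuous (deriv χ) := hχ.continuous_deriv (by simp)
  have hp : IsPrimitive χ (deriv χ) := IsPrimitive.of_hasDerivAt
    (fun x => (hχ.differentiable (by simp) x).hasDerivAt) hχ'
  have i1 : Integrable fun x => χ x • U x :=
    (hχ.continuous.smul h.continuous).integrable_of_hasCompactSupport hc.smul_right
  have i2 : Integrable fun x => deriv χ x • U x :=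
    (hχ'.smul h.continuous).integrable_of_hasCompactSupport hc.deriv.smul_right
  have i3 : Integrable fun x => χ x • g x :=
    hg.integrable_smul_left_of_hasCompactSupport hχ.continuous hc
  have := (hp.smul h).integral_eq_zero i1 (i2.add i3)
  rw [integral_add i2 i3] at this
  exact eq_neg_of_add_eq_zero_left this

theorem IsPrimitive.isWeakDeriv {U : ℝ → Spinor} {u g : L2} (h : IsPrimitive U g)
    (hu : u =ᵐ[volume] U) : IsWeakDeriv u g := by
  intro χ hχ hc
  rw [← h.integral_deriv_test_smul ((Lp.memLp g).locallyIntegrable (by norm_num)) hχ hc]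
  refine integral_congr_ae ?_
  filter_upwards [hu] with x hx
  rw [hx]

/-- A function with a weak derivative is almost everywhere equal to a primitive of it. -/
theorem IsWeakDeriv.exists_primitive {u g : L2} (h : IsWeakDeriv u g) :
    ∃ U : ℝ → Spinor, IsPrimitive U g ∧ u =ᵐ[volume] U := by
  set G : ℝ → Spinor := fun x => ∫ t in (0 : ℝ)..x, g t with hG
  have hGp : IsPrimitive G g := ⟨g.intervalIntegrable, fun a b => by
    rw [hG]
    exact intervalIntegral.integral_interval_sub_left (g.intervalIntegrable _ _)
      (g.intervalIntegrable _ _)⟩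
  have hgl : LocallyIntegrable g := (Lp.memLp g).locallyIntegrable (by norm_num)
  have hul : LocallyIntegrable u := (Lp.memLp u).locallyIntegrable (by norm_num)
  -- The difference between `u` and the primitive `G` of its weak derivative has zero weak
  -- derivative.
  obtain ⟨c, hc⟩ := ae_eq_const_of_integral_deriv_smul_eq_zero
    (hul.sub hGp.continuous.locallyIntegrable) (fun χ hχ hχc => by
      have i1 := integrable_deriv_test_smul u hχ hχc
      have i2 : Integrable fun x => deriv χ x • G x :=
        ((hχ.continuous_deriv (by simp)).smul hGp.continuous).integrable_of_hasCompactSupport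
          hχc.deriv.smul_right
      simp only [Pi.sub_apply, smul_sub]
      rw [integral_sub i1 i2, h χ hχ hχc, hGp.integral_deriv_test_smul hgl hχ hχc, sub_self])
  refine ⟨fun x => c + G x, ⟨g.intervalIntegrable, fun a b => ?_⟩, ?_⟩
  · rw [add_sub_add_left_eq_sub, hGp.sub_eq]
  · filter_upwards [hc] with x hx
    rw [← hx, Pi.sub_apply]; abel

theorem isWeakDeriv_toLp {F f : ℝ → Spinor} (hd : ∀ x, HasDerivAt F (f x) x) (hf : Continuous f)
    (hF2 : MemLp F 2) (hf2 : MemLp f 2) : IsWeakDeriv (hF2.toLp F) (hf2.toLp f) :=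
  ((IsPrimitive.of_hasDerivAt hd hf).congr_ae hf2.coeFn_toLp.symm).isWeakDeriv hF2.coeFn_toLp

theorem weakDeriv_eq {u g : L2} (h : IsWeakDeriv u g) (hu : u ∈ H1) : weakDeriv ⟨u, hu⟩ = g :=
  hu.choose_spec.unique h

theorem memLp_coord (u : L2) (i : Fin 2) : MemLp (fun x => u x i) 2 :=
  (EuclideanSpace.proj (𝕜 := ℂ) i).comp_memLp' (Lp.memLp u)

theorem integrable_conj_mul {p q : ℝ → ℂ} (hp : MemLp p 2) (hq : MemLp q 2) :
    Integrable fun x => conj (p x) * q x :=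
  (hp.star).integrable_mul hq

theorem integrable_real_mul {c : ℝ → ℝ} (hc : Continuous c) {C : ℝ} (hC : ∀ x, |c x| ≤ C)
    {F : ℝ → ℂ} (hF : Integrable F) : Integrable fun x => (c x : ℂ) * F x :=
  hF.bdd_mul (c := C) (Complex.continuous_ofReal.comp hc).aestronglyMeasurable
    (Filter.Eventually.of_forall fun x => by
      rw [Complex.norm_real]; exact hC x)

/-- Integration by parts in `H¹`, with a bounded weight. -/
theorem integral_weight_mul_deriv_eq_zero {u g v h : L2} (hu : IsWeakDeriv u g)
    (hv : IsWeakDeriv v h) (i j : Fin 2) {c c' : ℝ → ℝ} (hc : ∀ x, HasDerivAt c (c' x) x)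
    (hc' : Continuous c') {C C' : ℝ} (hC : ∀ x, |c x| ≤ C) (hC' : ∀ x, |c' x| ≤ C') :
    ∫ x, ((c' x : ℂ) * (conj (u x i) * v x j)
      + c x * (conj (g x i) * v x j + conj (u x i) * h x j)) = 0 := by
  have hcc : Continuous c := continuous_iff_continuousAt.2 fun x => (hc x).continuousAt
  obtain ⟨U, hU, eU⟩ := hu.exists_primitive
  obtain ⟨V, hV, eV⟩ := hv.exists_primitive
  have hUi : IsPrimitive (fun x => U x i) (fun x => g x i) :=
    hU.comp_clm ((EuclideanSpace.proj (𝕜 := ℂ) i).restrictScalars ℝ)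
  have hVj : IsPrimitive (fun x => V x j) (fun x => h x j) :=
    hV.comp_clm ((EuclideanSpace.proj (𝕜 := ℂ) j).restrictScalars ℝ)
  have hcp : IsPrimitive (fun x => (c x : ℂ)) (fun x => (c' x : ℂ)) :=
    (IsPrimitive.of_hasDerivAt hc hc').comp_clm Complex.ofRealCLM
  -- The integrand is the derivative of `c · conj(U_i) · V_j`; both are integrable since `c` and
  -- `c'` are bounded.
  have hprod := hcp.mul_complex (hUi.conj.mul_complex hVj)
  have e1 : (fun x => (c' x : ℂ) * (conj (U x i) * V x j)
      + c x * (conj (g x i) * V x j + conj (U x i) * h x j)) =ᵐ[volume]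
      fun x => ((c' x : ℂ) * (conj (u x i) * v x j)
      + c x * (conj (g x i) * v x j + conj (u x i) * h x j)) := by
    filter_upwards [eU, eV] with x h1 h2
    rw [h1, h2]
  have e2 : (fun x => (c x : ℂ) * (conj (u x i) * v x j)) =ᵐ[volume]
      fun x => (c x : ℂ) * (conj (U x i) * V x j) := by
    filter_upwards [eU, eV] with x h1 h2
    rw [h1, h2]
  have hi : Integrable fun x => ((c' x : ℂ) * (conj (u x i) * v x j)
      + c x * (conj (g x i) * v x j + conj (u x i) * h x j)) :=
    (integrable_real_mul hc' hC' (integrable_conj_mul (memLp_coord u i) (memLp_coord v j))).add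
      (integrable_real_mul hcc hC
        ((integrable_conj_mul (memLp_coord g i) (memLp_coord v j)).add
          (integrable_conj_mul (memLp_coord u i) (memLp_coord h j))))
  rw [← integral_congr_ae e1]
  exact hprod.integral_eq_zero ((integrable_real_mul hcc hC
    (integrable_conj_mul (memLp_coord u i) (memLp_coord v j))).congr e2) (hi.congr e1.symm)

end Sobolev

/-! ### The Dirac operator in coordinates -/

theorem Spinor.inner_eq (x y : Spinor) :
    inner ℂ x y = conj (x 0) * y 0 + conj (x 1) * y 1 := by
  rw [PiLp.inner_apply, Fin.sum_univ_two]
  simp only [RCLike.inner_apply]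
  ring

theorem Spinor.norm_sq_eq (x : Spinor) : ‖x‖ ^ 2 = ‖x 0‖ ^ 2 + ‖x 1‖ ^ 2 := by
  rw [EuclideanSpace.norm_sq_eq, Fin.sum_univ_two]

theorem matL2_coeFn (M : Matrix (Fin 2) (Fin 2) ℂ) (u : L2) :
    ∀ᵐ x, ∀ i, matL2 M u x i = M i 0 * u x 0 + M i 1 * u x 1 := by
  filter_upwards [(Matrix.toEuclideanCLM (𝕜 := ℂ) M).coeFn_compLpL (p := 2)
    (μ := (volume : Measure ℝ)) u] with x hx i
  have : matL2 M u x = Matrix.toEuclideanCLM (𝕜 := ℂ) M (u x) := hx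
  rw [this, Matrix.ofLp_toEuclideanCLM, Matrix.mulVec, dotProduct, Fin.sum_univ_two]

theorem DomainWall.mulL2_coeFn (κ : DomainWall) (u : L2) :
    ∀ᵐ x, ∀ i, κ.mulL2 u x i = κ.toFun x * u x i := by
  filter_upwards [(κ.memLp_mul u).coeFn_toLp] with x hx i
  have : κ.mulL2 u x = κ.toFun x • u x := hx
  rw [this, PiLp.smul_apply, Complex.real_smul]

/-- This coordinate form and its converse `exists_diracOperator_eq` are the interface through which
the operator is used: later identities become pointwise almost everywhere algebra. -/
theorem diracOperator_coeFn {ν ϑ : ℂ} {κ : DomainWall} {u g : L2} (h : IsWeakDeriv u g)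
    (hu : u ∈ (diracOperator ν ϑ κ).domain) :
    ∀ᵐ x, diracOperator ν ϑ κ ⟨u, hu⟩ x 0
        = -Complex.I * ν * g x 0 + κ.toFun x * conj ϑ * u x 1 ∧
      diracOperator ν ϑ κ ⟨u, hu⟩ x 1
        = Complex.I * ν * g x 1 + κ.toFun x * ϑ * u x 0 := by
  have e : diracOperator ν ϑ κ ⟨u, hu⟩
      = ν • matL2 sigma3 ((1 / Complex.I) • g) + matL2 (sigmaStar ϑ) (κ.mulL2 u) := by
    rw [← weakDeriv_eq h hu]; rfl
  rw [e]
  filter_upwards [Lp.coeFn_add (ν • matL2 sigma3 ((1 / Complex.I) • g))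
      (matL2 (sigmaStar ϑ) (κ.mulL2 u)), Lp.coeFn_smul ν (matL2 sigma3 ((1 / Complex.I) • g)),
    Lp.coeFn_smul (1 / Complex.I) g, matL2_coeFn sigma3 ((1 / Complex.I) • g),
    matL2_coeFn (sigmaStar ϑ) (κ.mulL2 u), κ.mulL2_coeFn u] with x h1 h2 h3 h4 h5 h6
  rw [h1, Pi.add_apply, PiLp.add_apply, PiLp.add_apply, h2, Pi.smul_apply, PiLp.smul_apply,
    PiLp.smul_apply, h4, h4, h5, h5, h6, h6, h3, Pi.smul_apply, PiLp.smul_apply, PiLp.smul_apply]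
  constructor <;> simp [sigma3, sigmaStar] <;> ring

theorem L2.ext_coord {u v : L2} (h : ∀ᵐ x, u x 0 = v x 0 ∧ u x 1 = v x 1) : u = v := by
  refine Lp.ext ?_
  filter_upwards [h] with x hx
  ext i
  fin_cases i
  · exact hx.1
  · exact hx.2

theorem exists_diracOperator_eq {ν ϑ : ℂ} {κ : DomainWall} {u g w : L2} (h : IsWeakDeriv u g)
    (hw : ∀ᵐ x, w x 0 = -Complex.I * ν * g x 0 + κ.toFun x * conj ϑ * u x 1 ∧
      w x 1 = Complex.I * ν * g x 1 + κ.toFun x * ϑ * u x 0) :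
    ∃ hu : u ∈ (diracOperator ν ϑ κ).domain, diracOperator ν ϑ κ ⟨u, hu⟩ = w := by
  refine ⟨⟨g, h⟩, L2.ext_coord ?_⟩
  filter_upwards [hw, diracOperator_coeFn (κ := κ) (ν := ν) (ϑ := ϑ) h ⟨g, h⟩] with x h1 h2
  exact ⟨h2.1.trans h1.1.symm, h2.2.trans h1.2.symm⟩

theorem L2.inner_eq (u v : L2) :
    inner ℂ u v = ∫ x, (conj (u x 0) * v x 0 + conj (u x 1) * v x 1) := by
  rw [MeasureTheory.L2.inner_def]
  simp_rw [Spinor.inner_eq]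

theorem L2.integrable_conj_mul (u v : L2) (i j : Fin 2) :
    Integrable fun x => conj (u x i) * v x j :=
  DiracWall.integrable_conj_mul (memLp_coord u i) (memLp_coord v j)

theorem L2.integrable_inner (u v : L2) :
    Integrable fun x => conj (u x 0) * v x 0 + conj (u x 1) * v x 1 :=
  (L2.integrable_conj_mul u v 0 0).add (L2.integrable_conj_mul u v 1 1)

theorem integral_deriv_eq_zero {u g v h : L2} (hu : IsWeakDeriv u g) (hv : IsWeakDeriv v h)
    (i j : Fin 2) : ∫ x, (conj (g x i) * v x j + conj (u x i) * h x j) = 0 := by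
  have := integral_weight_mul_deriv_eq_zero hu hv i j (c := fun _ => 1) (c' := fun _ => 0)
    (fun x => hasDerivAt_const x 1) continuous_const (C := 1) (C' := 0) (by simp) (by simp)
  simpa using this

theorem diracOperator_symm (ν : ℝ) (ϑ : ℂ) (κ : DomainWall)
    (u v : (diracOperator ν ϑ κ).domain) :
    inner ℂ (diracOperator ν ϑ κ u) (v : L2) = inner ℂ (u : L2) (diracOperator ν ϑ κ v) := by
  obtain ⟨u, g, hu⟩ := u
  obtain ⟨v, h, hv⟩ := v
  rw [← sub_eq_zero, L2.inner_eq, L2.inner_eq, ← integral_sub (L2.integrable_inner _ _)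
    (L2.integrable_inner _ _)]
  have i0 := integral_deriv_eq_zero hu hv 0 0
  have i1 := integral_deriv_eq_zero hu hv 1 1
  have e : ∫ x, (Complex.I * ν * (conj (g x 0) * v x 0 + conj (u x 0) * h x 0)
      - Complex.I * ν * (conj (g x 1) * v x 1 + conj (u x 1) * h x 1)) = 0 := by
    rw [integral_sub, integral_const_mul, integral_const_mul, i0, i1]
    · simp
    · exact (((L2.integrable_conj_mul _ _ 0 0).add (L2.integrable_conj_mul _ _ 0 0)).const_mul _)
    · exact (((L2.integrable_conj_mul _ _ 1 1).add (L2.integrable_conj_mul _ _ 1 1)).const_mul _)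
  rw [← e]
  refine integral_congr_ae ?_
  filter_upwards [diracOperator_coeFn (κ := κ) (ν := ν) (ϑ := ϑ) hu ⟨g, hu⟩,
    diracOperator_coeFn (κ := κ) (ν := ν) (ϑ := ϑ) hv ⟨h, hv⟩] with x h1 h2
  rw [h1.1, h1.2, h2.1, h2.2]
  simp only [map_add, map_mul, map_neg, Complex.conj_I, Complex.conj_ofReal, Complex.conj_conj]
  ring

/-- The spinor-valued function `χ e_i`. -/
def testSpinor (χ : ℝ → ℝ) (i : Fin 2) (x : ℝ) : Spinor := χ x • EuclideanSpace.single i (1 : ℂ)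

theorem memLp_testSpinor {χ : ℝ → ℝ} (hχ : Continuous χ) (hc : HasCompactSupport χ) (i : Fin 2) :
    MemLp (testSpinor χ i) 2 :=
  (hχ.smul continuous_const).memLp_of_hasCompactSupport hc.smul_right

theorem isWeakDeriv_testSpinor {χ : ℝ → ℝ} (hχ : ContDiff ℝ ∞ χ) (hc : HasCompactSupport χ)
    (i : Fin 2) :
    IsWeakDeriv ((memLp_testSpinor hχ.continuous hc i).toLp)
      ((memLp_testSpinor (hχ.continuous_deriv (by simp)) hc.deriv i).toLp) :=
  isWeakDeriv_toLp (fun x => ((hχ.differentiable (by simp) x).hasDerivAt).smul_const _)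
    ((hχ.continuous_deriv (by simp)).smul continuous_const) _ _

theorem testSpinor_apply (χ : ℝ → ℝ) (i j : Fin 2) (x : ℝ) :
    testSpinor χ i x j = if j = i then (χ x : ℂ) else 0 := by
  rw [testSpinor, PiLp.smul_apply, PiLp.single_apply]
  split_ifs <;> simp

theorem integral_coord {F : ℝ → Spinor} (hF : Integrable F) (i : Fin 2) :
    (∫ x, F x) i = ∫ x, F x i :=
  ((EuclideanSpace.proj (𝕜 := ℂ) i).integral_comp_comm hF).symm

theorem integrable_test_mul (f : L2) {χ : ℝ → ℝ} (hχ : Continuous χ)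
    (hc : HasCompactSupport χ) (i : Fin 2) : Integrable (fun x => (χ x : ℂ) * f x i) := by
  have := (EuclideanSpace.proj (𝕜 := ℂ) i).integrable_comp (integrable_test_smul f hχ hc)
  simpa using this

theorem isWeakDeriv_iff_coord {v g : L2} : IsWeakDeriv v g ↔ ∀ i, ∀ χ : ℝ → ℝ, ContDiff ℝ ∞ χ →
    HasCompactSupport χ → ∫ x, ((deriv χ x : ℝ) : ℂ) * v x i = -∫ x, (χ x : ℂ) * g x i := by
  constructor
  · intro h i χ hχ hc
    have := congrArg (fun s : Spinor => s i) (h χ hχ hc)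
    simp only [PiLp.neg_apply] at this
    rw [integral_coord (integrable_deriv_test_smul v hχ hc),
      integral_coord (integrable_test_smul g hχ.continuous hc)] at this
    simpa using this
  · intro h χ hχ hc
    ext i
    rw [PiLp.neg_apply, integral_coord (integrable_deriv_test_smul v hχ hc),
      integral_coord (integrable_test_smul g hχ.continuous hc)]
    simpa using h i χ hχ hc

/-- Testing against `χ e_i` shows that `v` has a weak derivative, namely the `g` obtained by solving
`Dv = w` for it. Solving requires dividing by `ν`. -/
theorem diracOperator_maximal {ν : ℝ} (hν : ν ≠ 0) (ϑ : ℂ) (κ : DomainWall) (v w : L2)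
    (hvw : ∀ u : (diracOperator ν ϑ κ).domain,
      inner ℂ w (u : L2) = inner ℂ v (diracOperator ν ϑ κ u)) :
    ∃ h : v ∈ (diracOperator ν ϑ κ).domain, diracOperator ν ϑ κ ⟨v, h⟩ = w := by
  have hνC : (ν : ℂ) ≠ 0 := by exact_mod_cast hν
  set r : L2 := w - matL2 (sigmaStar ϑ) (κ.mulL2 v) with hr
  set g : L2 := matL2 !![Complex.I / ν, 0; 0, -Complex.I / ν] r with hg
  have er : ∀ᵐ x, r x 0 = w x 0 - κ.toFun x * conj ϑ * v x 1 ∧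
      r x 1 = w x 1 - κ.toFun x * ϑ * v x 0 := by
    filter_upwards [Lp.coeFn_sub w (matL2 (sigmaStar ϑ) (κ.mulL2 v)),
      matL2_coeFn (sigmaStar ϑ) (κ.mulL2 v), κ.mulL2_coeFn v] with x h1 h2 h3
    rw [hr, h1, Pi.sub_apply, PiLp.sub_apply, PiLp.sub_apply, h2, h2, h3, h3]
    constructor <;> simp [sigmaStar] <;> ring
  have eg : ∀ᵐ x, g x 0 = Complex.I / ν * r x 0 ∧ g x 1 = -Complex.I / ν * r x 1 := by
    filter_upwards [matL2_coeFn !![Complex.I / ν, 0; 0, -Complex.I / ν] r] with x h1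
    rw [hg, h1, h1]
    constructor <;> simp
  have hweak : IsWeakDeriv v g := by
    rw [isWeakDeriv_iff_coord]
    intro i χ hχ hc
    have hχ' : Continuous (deriv χ) := hχ.continuous_deriv (by simp)
    have hT := isWeakDeriv_testSpinor hχ hc i
    have key := hvw ⟨_, ⟨_, hT⟩⟩
    rw [L2.inner_eq, L2.inner_eq] at key
    have ec := diracOperator_coeFn (κ := κ) (ν := ν) (ϑ := ϑ) hT ⟨_, hT⟩
    have e1 := (memLp_testSpinor hχ.continuous hc i).coeFn_toLp
    have e2 := (memLp_testSpinor hχ' hc.deriv i).coeFn_toLp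
    have iv := integrable_test_mul v hχ' hc.deriv i
    have ig := integrable_test_mul r hχ.continuous hc i
    replace key := congrArg conj key
    rw [← integral_conj, ← integral_conj] at key
    obtain rfl | rfl : i = 0 ∨ i = 1 := by fin_cases i <;> simp
    · have e3 : ∫ x, ((χ x : ℂ) * r x 0 - Complex.I * ν * (((deriv χ x : ℝ) : ℂ) * v x 0)) = 0 := by
        rw [← sub_eq_zero, ← integral_sub] at key
        · rw [← key]
          refine integral_congr_ae ?_
          filter_upwards [ec, e1, e2, er] with x h1 h2 h3 h4
          rw [h1.1, h1.2, h2, h3, h4.1]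
          simp only [testSpinor_apply]
          simp
          ring
        · exact RCLike.conjCLE.toContinuousLinearMap.integrable_comp
            (L2.integrable_inner _ _)
        · exact RCLike.conjCLE.toContinuousLinearMap.integrable_comp
            (L2.integrable_inner _ _)
      rw [integral_sub ig (iv.const_mul _), integral_const_mul, sub_eq_zero] at e3
      have e4 : ∫ x, (χ x : ℂ) * g x 0 = Complex.I / ν * ∫ x, (χ x : ℂ) * r x 0 := by
        rw [← integral_const_mul]
        refine integral_congr_ae ?_
        filter_upwards [eg] with x hx
        rw [hx.1]; ring
      change ∫ x, ((deriv χ x : ℝ) : ℂ) * v x 0 = -∫ x, (χ x : ℂ) * g x 0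
      rw [e4, e3]
      field_simp
      rw [Complex.I_sq]; ring
    · have e3 : ∫ x, ((χ x : ℂ) * r x 1 + Complex.I * ν * (((deriv χ x : ℝ) : ℂ) * v x 1)) = 0 := by
        rw [← sub_eq_zero, ← integral_sub] at key
        · rw [← key]
          refine integral_congr_ae ?_
          filter_upwards [ec, e1, e2, er] with x h1 h2 h3 h4
          rw [h1.1, h1.2, h2, h3, h4.2]
          simp only [testSpinor_apply]
          simp
          ring
        · exact RCLike.conjCLE.toContinuousLinearMap.integrable_comp
            (L2.integrable_inner _ _)
        · exact RCLike.conjCLE.toContinuousLinearMap.integrable_comp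
            (L2.integrable_inner _ _)
      rw [integral_add ig (iv.const_mul _), integral_const_mul] at e3
      have e4 : ∫ x, (χ x : ℂ) * g x 1 = -Complex.I / ν * ∫ x, (χ x : ℂ) * r x 1 := by
        rw [← integral_const_mul]
        refine integral_congr_ae ?_
        filter_upwards [eg] with x hx
        rw [hx.2]; ring
      change ∫ x, ((deriv χ x : ℝ) : ℂ) * v x 1 = -∫ x, (χ x : ℂ) * g x 1
      rw [e4, eq_neg_of_add_eq_zero_left e3]
      field_simp
      rw [Complex.I_sq]; ring
  refine exists_diracOperator_eq hweak ?_
  filter_upwards [eg, er] with x h1 h2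
  rw [h1.1, h1.2, h2.1, h2.2]
  constructor
  · field_simp
    rw [Complex.I_sq]; ring
  · field_simp
    rw [Complex.I_sq]; ring

theorem isSelfAdj_diracOperator {ν : ℝ} (hν : ν ≠ 0) (ϑ : ℂ) (κ : DomainWall) :
    IsSelfAdj (diracOperator ν ϑ κ) :=
  ⟨diracOperator_symm ν ϑ κ, diracOperator_maximal hν ϑ κ⟩

/-! ### A coercivity estimate modulo finitely many averages -/

theorem L2.integrable_norm_sq (u : L2) : Integrable fun x => ‖u x‖ ^ 2 :=
  (Lp.memLp u).integrable_norm_pow two_ne_zero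

theorem L2.norm_sq_eq (u : L2) : ‖u‖ ^ 2 = ∫ x, ‖u x‖ ^ 2 := by
  have h1 : inner ℂ u u = ((‖u‖ ^ 2 : ℝ) : ℂ) := by
    rw [inner_self_eq_norm_sq_to_K]; push_cast; rfl
  have h2 : inner ℂ u u = ((∫ x, ‖u x‖ ^ 2 : ℝ) : ℂ) := by
    rw [MeasureTheory.L2.inner_def, ← integral_complex_ofReal]
    refine integral_congr_ae (Filter.Eventually.of_forall fun x => ?_)
    simp only
    rw [inner_self_eq_norm_sq_to_K]; push_cast; rfl
  exact_mod_cast h1.symm.trans h2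

/-- Nonnegativity of the variance, that is of the integral of `(f - m)²` with `m` the mean. -/
theorem sq_integral_le {f : ℝ → ℝ} {a b : ℝ} (hab : a < b) (hf : IntervalIntegrable f volume a b)
    (hf2 : IntervalIntegrable (fun x => f x ^ 2) volume a b) :
    (∫ x in a..b, f x) ^ 2 ≤ (b - a) * ∫ x in a..b, f x ^ 2 := by
  have hpos : 0 < b - a := sub_pos.2 hab
  set m := (∫ x in a..b, f x) / (b - a) with hm
  have h0 : 0 ≤ ∫ x in a..b, (f x - m) ^ 2 :=
    intervalIntegral.integral_nonneg hab.le fun x _ => sq_nonneg _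
  have e : ∀ x, (f x - m) ^ 2 = f x ^ 2 - 2 * m * f x + m ^ 2 := fun x => by ring
  simp_rw [e] at h0
  rw [intervalIntegral.integral_add (hf2.sub (hf.const_mul _)) intervalIntegrable_const,
    intervalIntegral.integral_sub hf2 (hf.const_mul _), intervalIntegral.integral_const_mul,
    intervalIntegral.integral_const, smul_eq_mul] at h0
  have e2 : ∫ x in a..b, f x = m * (b - a) := by rw [hm]; field_simp
  rw [e2] at h0 ⊢
  nlinarith

theorem L2.intervalIntegrable_norm_sq (g : L2) (a b : ℝ) :
    IntervalIntegrable (fun x => ‖g x‖ ^ 2) volume a b :=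
  g.integrable_norm_sq.intervalIntegrable

theorem L2.sq_integral_norm_le (g : L2) {a b : ℝ} (hab : a < b) :
    (∫ x in a..b, ‖g x‖) ^ 2 ≤ (b - a) * ∫ x in a..b, ‖g x‖ ^ 2 :=
  sq_integral_le hab (g.intervalIntegrable a b).norm (g.intervalIntegrable_norm_sq a b)

/-- Integration over an interval, as a bounded operator on `L²`. -/
def cellIntegral {a b : ℝ} (hab : a < b) : L2 →L[ℂ] Spinor :=
  LinearMap.mkContinuous
    { toFun := fun v => ∫ x in a..b, v x
      map_add' := fun u v => by
        rw [← intervalIntegral.integral_add (u.intervalIntegrable a b) (v.intervalIntegrable a b)]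
        exact intervalIntegral.integral_congr_ae ((Lp.coeFn_add u v).mono fun x hx _ => hx)
      map_smul' := fun c v => by
        rw [RingHom.id_apply, ← intervalIntegral.integral_smul]
        exact intervalIntegral.integral_congr_ae ((Lp.coeFn_smul c v).mono fun x hx _ => hx) }
    (Real.sqrt (b - a)) (fun v => by
      have hpos : 0 < b - a := sub_pos.2 hab
      have h1 : ‖∫ x in a..b, v x‖ ≤ ∫ x in a..b, ‖v x‖ :=
        intervalIntegral.norm_integral_le_integral_norm hab.le
      have h2 := v.sq_integral_norm_le hab
      have h3 : ∫ x in a..b, ‖v x‖ ^ 2 ≤ ‖v‖ ^ 2 := by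
        rw [L2.norm_sq_eq, intervalIntegral.integral_of_le hab.le]
        exact setIntegral_le_integral v.integrable_norm_sq
          (Filter.Eventually.of_forall fun x => sq_nonneg _)
      refine le_of_sq_le_sq ?_ (by positivity)
      rw [mul_pow, Real.sq_sqrt hpos.le]
      refine (pow_le_pow_left₀ (norm_nonneg _) h1 2).trans (h2.trans ?_)
      exact mul_le_mul_of_nonneg_left h3 hpos.le)

/-- The Poincaré–Wirtinger inequality on an interval. -/
theorem IsWeakDeriv.poincare {v g : L2} (h : IsWeakDeriv v g) {a b : ℝ} (hab : a < b) :
    ∫ x in a..b, ‖v x‖ ^ 2 ≤ 2 / (b - a) * ‖∫ x in a..b, v x‖ ^ 2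
      + 2 * (b - a) ^ 2 * ∫ x in a..b, ‖g x‖ ^ 2 := by
  have hpos : 0 < b - a := sub_pos.2 hab
  obtain ⟨V, hV, eV⟩ := h.exists_primitive
  have e1 : ∫ x in a..b, ‖v x‖ ^ 2 = ∫ x in a..b, ‖V x‖ ^ 2 :=
    intervalIntegral.integral_congr_ae (eV.mono fun x hx _ => by rw [hx])
  have e2 : ∫ x in a..b, v x = ∫ x in a..b, V x :=
    intervalIntegral.integral_congr_ae (eV.mono fun x hx _ => hx)
  rw [e1, e2]
  set Γ := ∫ x in a..b, ‖g x‖ with hΓ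
  set M := ∫ x in a..b, V x with hM
  set G := ∫ x in a..b, ‖g x‖ ^ 2 with hG
  have hΓ2 : Γ ^ 2 ≤ (b - a) * G := g.sq_integral_norm_le hab
  have hdiff : ∀ x ∈ Icc a b, ∀ y ∈ Icc a b, ‖V x - V y‖ ≤ Γ := by
    intro x hx y hy
    rw [hV.sub_eq y x]
    refine (intervalIntegral.norm_integral_le_abs_integral_norm).trans ?_
    rw [intervalIntegral.abs_integral_eq_abs_integral_uIoc, abs_of_nonneg
      (integral_nonneg fun x => norm_nonneg _), hΓ, intervalIntegral.integral_of_le hab.le]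
    refine setIntegral_mono_set ?_ (Filter.Eventually.of_forall fun x => norm_nonneg _) ?_
    · exact ((intervalIntegrable_iff_integrableOn_Ioc_of_le hab.le).1
        (g.intervalIntegrable a b)).norm
    · refine Filter.Eventually.of_forall fun t ht => ?_
      have ht' : t ∈ uIoc y x := ht
      rw [mem_uIoc] at ht'
      change t ∈ Ioc a b
      rcases ht' with ht' | ht'
      · exact ⟨lt_of_le_of_lt hy.1 ht'.1, ht'.2.trans hx.2⟩
      · exact ⟨lt_of_le_of_lt hx.1 ht'.1, ht'.2.trans hy.2⟩
  have hpt : ∀ x ∈ Icc a b, ‖V x‖ ^ 2 ≤ 2 / (b - a) ^ 2 * ‖M‖ ^ 2 + 2 * ((b - a) * G) := by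
    intro x hx
    -- Averaging over `y` compares `V x` with the mean, with error at most the oscillation `Γ`.
    -- Cauchy–Schwarz bounds `Γ²` by `(b - a) G`, and the factors 2 come from squaring a sum.
    have h1 : (b - a) • V x - M = ∫ y in a..b, (V x - V y) := by
      rw [intervalIntegral.integral_sub intervalIntegrable_const
        (hV.continuous.intervalIntegrable _ _), intervalIntegral.integral_const]
    have h2 : ‖(b - a) • V x - M‖ ≤ Γ * (b - a) := by
      rw [h1]
      refine (intervalIntegral.norm_integral_le_of_norm_le_const (C := Γ) fun y hy => ?_).trans ?_
      · rw [uIoc_of_le hab.le] at hy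
        exact hdiff x hx y ⟨hy.1.le, hy.2⟩
      · rw [abs_of_pos hpos]
    have h3 : (b - a) * ‖V x‖ ≤ ‖M‖ + Γ * (b - a) := by
      have := norm_add_le ((b - a) • V x - M) M
      rw [sub_add_cancel, norm_smul, Real.norm_eq_abs, abs_of_pos hpos] at this
      linarith
    have h4 : ((b - a) * ‖V x‖) ^ 2 ≤ 2 * ‖M‖ ^ 2 + 2 * (b - a) ^ 2 * ((b - a) * G) := by
      refine (pow_le_pow_left₀ (by positivity) h3 2).trans ?_
      nlinarith [sq_nonneg (‖M‖ - Γ * (b - a)), mul_le_mul_of_nonneg_left hΓ2 (sq_nonneg (b - a))]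
    have h5 : ‖V x‖ ^ 2 = ((b - a) * ‖V x‖) ^ 2 / (b - a) ^ 2 := by field_simp
    rw [h5, div_le_iff₀ (by positivity)]
    refine h4.trans (le_of_eq ?_)
    field_simp
  have hint := intervalIntegral.integral_mono_on hab.le
    ((hV.continuous.norm.pow 2).intervalIntegrable (μ := volume) a b) intervalIntegrable_const hpt
  rw [intervalIntegral.integral_const, smul_eq_mul] at hint
  refine hint.trans (le_of_eq ?_)
  field_simp

theorem DomainWall.hasDerivAt (κ : DomainWall) (x : ℝ) :
    HasDerivAt κ.toFun (deriv κ.toFun x) x :=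
  (κ.smooth.differentiable (by simp) x).hasDerivAt

theorem DomainWall.continuous_deriv (κ : DomainWall) : Continuous (deriv κ.toFun) :=
  κ.smooth.continuous_deriv (by simp)

theorem DomainWall.deriv_eq_zero (κ : DomainWall) {L : ℝ} (h1 : ∀ y, L ≤ y → κ.toFun y = 1)
    (h2 : ∀ y, y ≤ -L → κ.toFun y = -1) {x : ℝ} (hx : x ∉ Icc (-L) L) :
    deriv κ.toFun x = 0 := by
  rw [mem_Icc, not_and_or, not_le, not_le] at hx
  rcases hx with hx | hx
  · have : κ.toFun =ᶠ[nhds x] fun _ => -1 :=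
      Filter.mem_of_superset (Iio_mem_nhds hx) fun y hy => h2 y (le_of_lt hy)
    rw [this.deriv_eq]; simp
  · have : κ.toFun =ᶠ[nhds x] fun _ => 1 :=
      Filter.mem_of_superset (Ioi_mem_nhds hx) fun y hy => h1 y (le_of_lt hy)
    rw [this.deriv_eq]; simp

theorem DomainWall.deriv_bounded (κ : DomainWall) : ∃ C : ℝ, ∀ x, |deriv κ.toFun x| ≤ C := by
  obtain ⟨L, -, h1, h2⟩ := κ.eventually_const
  obtain ⟨C, hC⟩ := (isCompact_Icc (a := -L) (b := L)).exists_bound_of_continuousOn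
    κ.continuous_deriv.continuousOn
  refine ⟨max C 0, fun x => ?_⟩
  by_cases hx : x ∈ Icc (-L) L
  · exact (hC x hx).trans (le_max_left _ _)
  · rw [κ.deriv_eq_zero h1 h2 hx, abs_zero]; exact le_max_right _ _

/-- The cross term is arranged to contain `k` times the derivative of `conj(v0) v1`, ready for
integration by parts when `k = κ(x)`. -/
theorem norm_sq_dirac_pointwise (ν k : ℝ) (ϑ v0 v1 g0 g1 : ℂ) :
    ‖-Complex.I * ν * g0 + k * conj ϑ * v1‖ ^ 2 + ‖Complex.I * ν * g1 + k * ϑ * v0‖ ^ 2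
      = ν ^ 2 * (‖g0‖ ^ 2 + ‖g1‖ ^ 2) + k ^ 2 * ‖ϑ‖ ^ 2 * (‖v0‖ ^ 2 + ‖v1‖ ^ 2)
        + 2 * ν * (Complex.I * conj ϑ * (k * (conj g0 * v1 + conj v0 * g1))).re := by
  simp only [← Complex.normSq_eq_norm_sq, Complex.normSq_apply, Complex.add_re, Complex.add_im,
    Complex.mul_re, Complex.mul_im, Complex.neg_re, Complex.neg_im, Complex.I_re, Complex.I_im,
    Complex.ofReal_re, Complex.ofReal_im, Complex.conj_re, Complex.conj_im]
  ring

theorem DomainWall.integrable_potential (κ : DomainWall) (ν : ℝ) (ϑ : ℂ) (v : L2) :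
    Integrable fun x => (κ.toFun x ^ 2 * ‖ϑ‖ ^ 2
        - |ν| * ‖ϑ‖ * |deriv κ.toFun x|) * ‖v x‖ ^ 2 := by
  obtain ⟨C, hC⟩ := κ.bounded
  obtain ⟨C', hC'⟩ := κ.deriv_bounded
  refine v.integrable_norm_sq.bdd_mul (c := C ^ 2 * ‖ϑ‖ ^ 2 + |ν| * ‖ϑ‖ * C') ?_ ?_
  · exact (((κ.smooth.continuous.pow 2).mul continuous_const).sub
      (continuous_const.mul κ.continuous_deriv.abs)).aestronglyMeasurable
  · refine Filter.Eventually.of_forall fun x => (norm_sub_le _ _).trans ?_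
    rw [Real.norm_eq_abs, Real.norm_eq_abs, abs_mul, abs_mul, abs_mul, abs_abs, abs_norm,
      abs_abs, abs_pow, abs_pow, abs_norm]
    have h1 := pow_le_pow_left₀ (abs_nonneg _) (hC x) 2
    gcongr
    · exact hC x
    · exact hC' x

/-- The Dirac operator controls the `H¹` norm up to a potential. -/
theorem dirac_energy (ν : ℝ) (ϑ : ℂ) (κ : DomainWall) {v g : L2} (h : IsWeakDeriv v g)
    (hv : v ∈ (diracOperator ν ϑ κ).domain) :
    ν ^ 2 * (∫ x, ‖g x‖ ^ 2) + (∫ x, (κ.toFun x ^ 2 * ‖ϑ‖ ^ 2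
        - |ν| * ‖ϑ‖ * |deriv κ.toFun x|) * ‖v x‖ ^ 2)
      ≤ ‖diracOperator ν ϑ κ ⟨v, hv⟩‖ ^ 2 := by
  obtain ⟨C, hC⟩ := κ.bounded
  obtain ⟨C', hC'⟩ := κ.deriv_bounded
  set D := diracOperator ν ϑ κ ⟨v, hv⟩ with hD
  have ibp := integral_weight_mul_deriv_eq_zero h h 0 1 κ.hasDerivAt κ.continuous_deriv hC hC'
  -- `F` is the full derivative of `κ conj(v₀) v₁`, so its integral vanishes. Replacing the cross
  -- term by `F` costs only the part with `κ'`, which is bounded pointwise in `hb`.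
  set F : ℝ → ℂ := fun x => ((deriv κ.toFun x : ℝ) : ℂ) * (conj (v x 0) * v x 1)
      + κ.toFun x * (conj (g x 0) * v x 1 + conj (v x 0) * g x 1) with hF
  have hFi : Integrable F :=
    (integrable_real_mul κ.continuous_deriv hC' (v.integrable_conj_mul v 0 1)).add
      (integrable_real_mul κ.smooth.continuous hC
        ((g.integrable_conj_mul v 0 1).add (v.integrable_conj_mul g 0 1)))
  have hFre : Integrable fun x => 2 * ν * (Complex.I * conj ϑ * F x).re :=
    ((hFi.const_mul (Complex.I * conj ϑ)).re).const_mul (2 * ν)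
  have hF0 : ∫ x, 2 * ν * (Complex.I * conj ϑ * F x).re = 0 := by
    rw [integral_const_mul]
    have := integral_re (𝕜 := ℂ) (hFi.const_mul (Complex.I * conj ϑ))
    simp only [RCLike.re_eq_complex_re] at this
    rw [this, integral_const_mul, ibp]
    simp
  have hpot := κ.integrable_potential ν ϑ v
  have hsum : ν ^ 2 * (∫ x, ‖g x‖ ^ 2) + (∫ x, (κ.toFun x ^ 2 * ‖ϑ‖ ^ 2
        - |ν| * ‖ϑ‖ * |deriv κ.toFun x|) * ‖v x‖ ^ 2)
      = ∫ x, (ν ^ 2 * ‖g x‖ ^ 2 + (κ.toFun x ^ 2 * ‖ϑ‖ ^ 2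
        - |ν| * ‖ϑ‖ * |deriv κ.toFun x|) * ‖v x‖ ^ 2 + 2 * ν * (Complex.I * conj ϑ * F x).re) := by
    rw [integral_add ((g.integrable_norm_sq.const_mul (ν ^ 2)).fun_add hpot) hFre, hF0, add_zero,
      integral_add (g.integrable_norm_sq.const_mul _) hpot, integral_const_mul]
  rw [hsum, L2.norm_sq_eq]
  refine integral_mono_ae (((g.integrable_norm_sq.const_mul _).add hpot).add hFre)
    D.integrable_norm_sq ?_
  filter_upwards [diracOperator_coeFn h hv] with x hx
  have e := norm_sq_dirac_pointwise ν (κ.toFun x) ϑ (v x 0) (v x 1) (g x 0) (g x 1)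
  rw [← hx.1, ← hx.2, ← hD, ← Spinor.norm_sq_eq, ← Spinor.norm_sq_eq, ← Spinor.norm_sq_eq] at e
  rw [e, hF]
  beta_reduce
  rw [mul_add (Complex.I * conj ϑ), Complex.add_re]
  have hb : 2 * ν * (Complex.I * conj ϑ * (((deriv κ.toFun x : ℝ) : ℂ)
      * (conj (v x 0) * v x 1))).re ≤ |ν| * ‖ϑ‖ * |deriv κ.toFun x| * ‖v x‖ ^ 2 := by
    refine (le_abs_self _).trans ?_
    rw [abs_mul, abs_mul, abs_two]
    have h1 := Complex.abs_re_le_norm (Complex.I * conj ϑ * (((deriv κ.toFun x : ℝ) : ℂ)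
      * (conj (v x 0) * v x 1)))
    rw [norm_mul, norm_mul, norm_mul, norm_mul, Complex.norm_I, Complex.norm_real,
      RCLike.norm_conj, RCLike.norm_conj, one_mul, Real.norm_eq_abs] at h1
    rw [Spinor.norm_sq_eq]
    calc 2 * |ν| * |(Complex.I * conj ϑ * (((deriv κ.toFun x : ℝ) : ℂ)
      * (conj (v x 0) * v x 1))).re|
        ≤ 2 * |ν| * (‖ϑ‖ * (|deriv κ.toFun x| * (‖v x 0‖ * ‖v x 1‖))) := by gcongr
      _ = |ν| * ‖ϑ‖ * |deriv κ.toFun x| * (2 * ‖v x 0‖ * ‖v x 1‖) := by ring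
      _ ≤ _ := by
        gcongr
        exact two_mul_le_add_sq _ _
  linarith

/-- The Dirac operator is bounded below by `‖ϑ‖`, up to a bounded operator of finite rank. -/
theorem dirac_coercive {ν : ℝ} (hν : ν ≠ 0) (ϑ : ℂ) (κ : DomainWall) :
    ∃ (n : ℕ) (P : L2 →L[ℂ] (Fin n → Spinor)), ∀ u : (diracOperator ν ϑ κ).domain,
      ‖ϑ‖ ^ 2 * ‖(u : L2)‖ ^ 2 ≤ ‖diracOperator ν ϑ κ u‖ ^ 2 + ‖P u‖ ^ 2 := by
  obtain ⟨L, hL, h1, h2⟩ := κ.eventually_const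
  -- The deficit of the potential in `dirac_energy` relative to `‖ϑ‖²`. It vanishes off `[-L, L]`,
  -- where `κ² = 1` and `κ' = 0`.
  set q : ℝ → ℝ := fun x => ‖ϑ‖ ^ 2 - (κ.toFun x ^ 2 * ‖ϑ‖ ^ 2
    - |ν| * ‖ϑ‖ * |deriv κ.toFun x|) with hq
  have hqc : Continuous q := continuous_const.sub (((κ.smooth.continuous.pow 2).mul
    continuous_const).sub (continuous_const.mul κ.continuous_deriv.abs))
  obtain ⟨Q₀, hQ₀⟩ := (isCompact_Icc (a := -L) (b := L)).exists_bound_of_continuousOn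
    hqc.continuousOn
  set Q := max Q₀ 1 with hQ
  have hQpos : 0 < Q := lt_of_lt_of_le one_pos (le_max_right _ _)
  have hqQ : ∀ x ∈ Icc (-L) L, q x ≤ Q := fun x hx =>
    (le_abs_self _).trans ((hQ₀ x hx).trans (le_max_left _ _))
  have hq0 : ∀ x ∉ Icc (-L) L, q x = 0 := by
    intro x hx
    have hκ : κ.toFun x ^ 2 = 1 := by
      rw [mem_Icc, not_and_or, not_le, not_le] at hx
      rcases hx with hx | hx
      · rw [h2 x hx.le]; norm_num
      · rw [h1 x hx.le]; norm_num
    rw [hq]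
    beta_reduce
    rw [hκ, κ.deriv_eq_zero h1 h2 hx]
    simp
  have hν2 : 0 < ν ^ 2 := by positivity
  -- Enough cells of length `h = 2L/n` that `2Qh² ≤ ν²`: the gradient part of the Poincaré
  -- inequality, weighted by `Q`, is then absorbed by the kinetic energy.
  obtain ⟨n, hn⟩ := exists_nat_gt (2 * L * Real.sqrt (2 * Q / ν ^ 2))
  have hn0 : (0 : ℝ) < n := lt_of_le_of_lt (by positivity) hn
  set h : ℝ := 2 * L / n with hh
  have hhpos : 0 < h := by positivity
  have hsmall : Q * (2 * h ^ 2) ≤ ν ^ 2 := by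
    have e1 : (2 * L) ^ 2 * (2 * Q / ν ^ 2) ≤ (n : ℝ) ^ 2 := by
      have := pow_le_pow_left₀ (by positivity) hn.le 2
      rwa [mul_pow, Real.sq_sqrt (by positivity)] at this
    rw [hh, div_pow, ← mul_div_assoc, ← mul_div_assoc, div_le_iff₀ (by positivity)]
    rw [← mul_div_assoc, div_le_iff₀ hν2] at e1
    linarith
  set a : ℕ → ℝ := fun k => -L + k * h with ha
  have hastep : ∀ k, a (k + 1) - a k = h := by
    intro k; rw [ha]; push_cast; ring
  have halt : ∀ k, a k < a (k + 1) := fun k => by linarith [hastep k]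
  have ha0 : a 0 = -L := by simp [ha]
  have han : a n = L := by
    rw [ha, hh]; field_simp; ring
  -- The factor `n` compensates for the sup norm on `Fin n → Spinor`: each of the `n` weighted
  -- averages is bounded by `‖P v‖² / n`.
  set s : ℝ := Real.sqrt (Q * (2 / h) * n) with hs
  have hs2 : s ^ 2 = Q * (2 / h) * n := Real.sq_sqrt (by positivity)
  refine ⟨n, ContinuousLinearMap.pi fun k : Fin n => (s : ℂ) • cellIntegral (halt k), ?_⟩
  rintro ⟨v, g, hw⟩
  set P : L2 →L[ℂ] (Fin n → Spinor) :=
    ContinuousLinearMap.pi fun k : Fin n => (s : ℂ) • cellIntegral (halt k) with hP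
  have hE := dirac_energy ν ϑ κ hw ⟨g, hw⟩
  have hpot := κ.integrable_potential ν ϑ v
  have hind : Integrable ((Icc (-L) L).indicator fun x => Q * ‖v x‖ ^ 2) :=
    (v.integrable_norm_sq.const_mul Q).indicator measurableSet_Icc
  have hpotential : ‖ϑ‖ ^ 2 * ‖v‖ ^ 2 ≤ (∫ x, (κ.toFun x ^ 2 * ‖ϑ‖ ^ 2
      - |ν| * ‖ϑ‖ * |deriv κ.toFun x|) * ‖v x‖ ^ 2) + Q * ∫ x in (-L)..L, ‖v x‖ ^ 2 := by
    have e : Q * ∫ x in (-L)..L, ‖v x‖ ^ 2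
        = ∫ x, (Icc (-L) L).indicator (fun x => Q * ‖v x‖ ^ 2) x := by
      rw [integral_indicator measurableSet_Icc, integral_Icc_eq_integral_Ioc,
        integral_const_mul, intervalIntegral.integral_of_le (by linarith)]
    rw [e, ← integral_add hpot hind, L2.norm_sq_eq, ← integral_const_mul]
    refine integral_mono (v.integrable_norm_sq.const_mul _) (hpot.add hind) fun x => ?_
    have hx : ‖ϑ‖ ^ 2 = (κ.toFun x ^ 2 * ‖ϑ‖ ^ 2 - |ν| * ‖ϑ‖ * |deriv κ.toFun x|) + q x := by
      rw [hq]; ring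
    have hx' : ‖ϑ‖ ^ 2 * ‖v x‖ ^ 2 = (κ.toFun x ^ 2 * ‖ϑ‖ ^ 2
        - |ν| * ‖ϑ‖ * |deriv κ.toFun x|) * ‖v x‖ ^ 2 + q x * ‖v x‖ ^ 2 := by
      rw [← add_mul, ← hx]
    change ‖ϑ‖ ^ 2 * ‖v x‖ ^ 2 ≤ _ + _
    rw [hx']
    refine add_le_add le_rfl ?_
    by_cases hxi : x ∈ Icc (-L) L
    · rw [indicator_of_mem hxi]
      exact mul_le_mul_of_nonneg_right (hqQ x hxi) (sq_nonneg _)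
    · rw [indicator_of_notMem hxi, hq0 x hxi, zero_mul]
  have hcells : ∫ x in (-L)..L, ‖v x‖ ^ 2 ≤ 2 / h * (∑ k ∈ Finset.range n,
      ‖cellIntegral (halt k) v‖ ^ 2) + 2 * h ^ 2 * ∫ x in (-L)..L, ‖g x‖ ^ 2 := by
    have eV := intervalIntegral.sum_integral_adjacent_intervals (f := fun x => ‖v x‖ ^ 2)
      (μ := volume) (a := a) (n := n) fun k _ => v.intervalIntegrable_norm_sq _ _
    have eG := intervalIntegral.sum_integral_adjacent_intervals (f := fun x => ‖g x‖ ^ 2)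
      (μ := volume) (a := a) (n := n) fun k _ => g.intervalIntegrable_norm_sq _ _
    rw [ha0, han] at eV eG
    rw [← eV, ← eG, Finset.mul_sum, Finset.mul_sum, ← Finset.sum_add_distrib]
    refine Finset.sum_le_sum fun k _ => ?_
    have := hw.poincare (halt k)
    rwa [hastep k] at this
  have haverages : Q * (2 / h * ∑ k ∈ Finset.range n, ‖cellIntegral (halt k) v‖ ^ 2)
      ≤ ‖P v‖ ^ 2 := by
    have hk : ∀ k ∈ Finset.range n, Q * (2 / h) * ‖cellIntegral (halt k) v‖ ^ 2
        ≤ ‖P v‖ ^ 2 / n := by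
      intro k hk
      have h3 := norm_le_pi_norm (P v) ⟨k, Finset.mem_range.1 hk⟩
      have h4 : P v ⟨k, Finset.mem_range.1 hk⟩ = (s : ℂ) • cellIntegral (halt k) v := rfl
      rw [h4, norm_smul, Complex.norm_real] at h3
      have h5 := pow_le_pow_left₀ (by positivity) h3 2
      rw [mul_pow, Real.norm_eq_abs, sq_abs, hs2] at h5
      rw [le_div_iff₀ hn0]
      linarith
    have := Finset.sum_le_sum hk
    rw [← Finset.mul_sum, Finset.sum_const, Finset.card_range, nsmul_eq_mul] at this
    rw [← mul_assoc]
    refine this.trans (le_of_eq ?_)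
    field_simp
  have hrestrict : ∫ x in (-L)..L, ‖g x‖ ^ 2 ≤ ∫ x, ‖g x‖ ^ 2 := by
    rw [intervalIntegral.integral_of_le (by linarith)]
    exact setIntegral_le_integral g.integrable_norm_sq
      (Filter.Eventually.of_forall fun x => sq_nonneg _)
  have hG0 : 0 ≤ ∫ x in (-L)..L, ‖g x‖ ^ 2 :=
    intervalIntegral.integral_nonneg (by linarith) fun x _ => sq_nonneg _
  have hkinetic : Q * (2 * h ^ 2 * ∫ x in (-L)..L, ‖g x‖ ^ 2) ≤ ν ^ 2 * ∫ x, ‖g x‖ ^ 2 := by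
    rw [← mul_assoc]
    exact mul_le_mul hsmall hrestrict hG0 hν2.le
  have hscaled := mul_le_mul_of_nonneg_left hcells hQpos.le
  rw [mul_add] at hscaled
  change ‖ϑ‖ ^ 2 * ‖v‖ ^ 2 ≤ _ + ‖P v‖ ^ 2
  linarith

/-! ### Eigenfunctions as solutions of a differential equation -/

/-- The coefficient of the first order system solved by the eigenfunctions. -/
def diracCoeff (ν : ℝ) (ϑ : ℂ) (κ : DomainWall) (z : ℂ) (x : ℝ) : Spinor →L[ℂ] Spinor :=
  Matrix.toEuclideanCLM (𝕜 := ℂ) !![Complex.I / ν * z, 0; 0, -Complex.I / ν * z]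
    + (κ.toFun x : ℂ) •
      Matrix.toEuclideanCLM (𝕜 := ℂ) !![0, -Complex.I / ν * conj ϑ; Complex.I / ν * ϑ, 0]

theorem diracCoeff_apply (ν : ℝ) (ϑ : ℂ) (κ : DomainWall) (z : ℂ) (x : ℝ) (v : Spinor) :
    diracCoeff ν ϑ κ z x v 0 = Complex.I / ν * (z * v 0 - κ.toFun x * conj ϑ * v 1) ∧
    diracCoeff ν ϑ κ z x v 1 = -Complex.I / ν * (z * v 1 - κ.toFun x * ϑ * v 0) := by
  rw [diracCoeff, add_apply, smul_apply, PiLp.add_apply,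
    PiLp.add_apply, PiLp.smul_apply, PiLp.smul_apply, Matrix.ofLp_toEuclideanCLM,
    Matrix.ofLp_toEuclideanCLM]
  constructor <;> simp [Matrix.mulVec, dotProduct, Fin.sum_univ_two] <;> ring

theorem continuous_diracCoeff (ν : ℝ) (ϑ : ℂ) (κ : DomainWall) (z : ℂ) :
    Continuous (diracCoeff ν ϑ κ z) :=
  continuous_const.add ((Complex.continuous_ofReal.comp κ.smooth.continuous).smul continuous_const)

theorem exists_norm_diracCoeff_le (ν : ℝ) (ϑ : ℂ) (κ : DomainWall) (z : ℂ) :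
    ∃ K : NNReal, ∀ x, ‖diracCoeff ν ϑ κ z x‖₊ ≤ K := by
  obtain ⟨C, hC⟩ := κ.bounded
  set S : Spinor →L[ℂ] Spinor :=
    Matrix.toEuclideanCLM (𝕜 := ℂ) !![0, -Complex.I / ν * conj ϑ; Complex.I / ν * ϑ, 0]
  set Z : Spinor →L[ℂ] Spinor :=
    Matrix.toEuclideanCLM (𝕜 := ℂ) !![Complex.I / ν * z, 0; 0, -Complex.I / ν * z]
  refine ⟨(‖Z‖ + |C| * ‖S‖).toNNReal, fun x => ?_⟩
  rw [← NNReal.coe_le_coe, Real.coe_toNNReal _ (by positivity), coe_nnnorm]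
  refine (norm_add_le _ _).trans (add_le_add le_rfl ?_)
  rw [norm_smul, Complex.norm_real]
  exact mul_le_mul_of_nonneg_right ((hC x).trans (le_abs_self _)) (norm_nonneg _)

theorem diracCoeff_ode_unique {ν : ℝ} {ϑ : ℂ} {κ : DomainWall} {z : ℂ} {V W : ℝ → Spinor}
    (hV : ∀ x, HasDerivAt V (diracCoeff ν ϑ κ z x (V x)) x)
    (hW : ∀ x, HasDerivAt W (diracCoeff ν ϑ κ z x (W x)) x) {x₀ : ℝ} (h : V x₀ = W x₀) :
    V = W := by
  obtain ⟨K, hK⟩ := exists_norm_diracCoeff_le ν ϑ κ z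
  exact ODE_solution_unique_univ (v := fun x y => diracCoeff ν ϑ κ z x y) (s := fun _ => univ)
    (fun x => (((diracCoeff ν ϑ κ z x).lipschitz.weaken (hK x)).lipschitzOnWith))
    (fun x => ⟨hV x, mem_univ _⟩) (fun x => ⟨hW x, mem_univ _⟩) h

/-- Solving the eigenvalue equation for the weak derivative expresses it through the continuous
representative `V`. The right side is then continuous, so `V` is a classical solution. -/
theorem exists_ode_of_mem_eigenspace {ν : ℝ} (hν : ν ≠ 0) {ϑ : ℂ} {κ : DomainWall} {z : ℂ} {u : L2}
    (hu : u ∈ eigenspace (diracOperator ν ϑ κ) z) :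
    ∃ V : ℝ → Spinor, (∀ x, HasDerivAt V (diracCoeff ν ϑ κ z x (V x)) x) ∧ u =ᵐ[volume] V := by
  have hνC : (ν : ℂ) ≠ 0 := by exact_mod_cast hν
  obtain ⟨⟨g, hg⟩, e⟩ := hu
  obtain ⟨V, hV, eV⟩ := hg.exists_primitive
  refine ⟨V, ?_, eV⟩
  have hae : g =ᵐ[volume] fun x => diracCoeff ν ϑ κ z x (V x) := by
    filter_upwards [diracOperator_coeFn (κ := κ) (ν := ν) (ϑ := ϑ) hg ⟨g, hg⟩, eV,
      Lp.coeFn_smul z u] with x h1 h2 h3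
    rw [e, h3, Pi.smul_apply, PiLp.smul_apply, PiLp.smul_apply, h2] at h1
    obtain ⟨c1, c2⟩ := diracCoeff_apply ν ϑ κ z x (V x)
    ext i
    obtain rfl | rfl : i = 0 ∨ i = 1 := by fin_cases i <;> simp
    · rw [c1, ← smul_eq_mul z, h1.1]
      field_simp
      linear_combination (g x 0 * ν) * Complex.I_sq
    · rw [c2, ← smul_eq_mul z, h1.2]
      field_simp
      linear_combination (g x 1 * ν) * Complex.I_sq
  exact (hV.congr_ae hae).hasDerivAt
    ((continuous_diracCoeff ν ϑ κ z).clm_apply hV.continuous)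

theorem mem_eigenspace_of_ode {ν : ℝ} (hν : ν ≠ 0) {ϑ : ℂ} {κ : DomainWall} {z : ℂ}
    {V : ℝ → Spinor} (hV : ∀ x, HasDerivAt V (diracCoeff ν ϑ κ z x (V x)) x)
    (h2 : MemLp V 2 volume) :
    h2.toLp V ∈ eigenspace (diracOperator ν ϑ κ) z := by
  have hνC : (ν : ℂ) ≠ 0 := by exact_mod_cast hν
  obtain ⟨K, hK⟩ := exists_norm_diracCoeff_le ν ϑ κ z
  have hVc : Continuous V := continuous_iff_continuousAt.2 fun x => (hV x).continuousAt
  have hc : Continuous fun x => diracCoeff ν ϑ κ z x (V x) :=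
    (continuous_diracCoeff ν ϑ κ z).clm_apply hVc
  have h2' : MemLp (fun x => diracCoeff ν ϑ κ z x (V x)) 2 :=
    h2.of_le_mul (c := K) hc.aestronglyMeasurable (Filter.Eventually.of_forall fun x =>
      ((diracCoeff ν ϑ κ z x).le_opNorm (V x)).trans
        (mul_le_mul_of_nonneg_right (hK x) (norm_nonneg _)))
  refine exists_diracOperator_eq (isWeakDeriv_toLp hV hc h2 h2') ?_
  filter_upwards [Lp.coeFn_smul z (h2.toLp V), h2.coeFn_toLp, h2'.coeFn_toLp] with x e1 e2 e3
  rw [e1, Pi.smul_apply, PiLp.smul_apply, PiLp.smul_apply, e2, e3]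
  obtain ⟨c1, c2⟩ := diracCoeff_apply ν ϑ κ z x (V x)
  rw [c1, c2, smul_eq_mul, smul_eq_mul]
  constructor
  · field_simp
    linear_combination (z * V x 0 - κ.toFun x * conj ϑ * V x 1) * Complex.I_sq
  · field_simp
    linear_combination (z * V x 1 - κ.toFun x * ϑ * V x 0) * Complex.I_sq

theorem eq_zero_of_integrable_of_eqOn_Ici {E : Type*} [NormedAddCommGroup E] {F : ℝ → E}
    (hF : Integrable F) {c : E} {L : ℝ} (h : ∀ x, L ≤ x → F x = c) : c = 0 := by
  have h1 : IntegrableOn (fun _ => c) (Ici L) :=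
    (hF.integrableOn (s := Ici L)).congr_fun (fun x hx => h x hx) measurableSet_Ici
  rcases (integrableOn_const_iff).1 h1 with h2 | h2
  · simpa using h2
  · simp at h2

theorem hasDerivAt_coord {V : ℝ → Spinor} {w : Spinor} {x : ℝ} (h : HasDerivAt V w x) (i : Fin 2) :
    HasDerivAt (fun y => V y i) (w i) x :=
  (((EuclideanSpace.proj (𝕜 := ℂ) i).restrictScalars ℝ).hasFDerivAt.comp_hasDerivAt x h)

/-- Two eigenfunctions for the same eigenvalue have vanishing Wronskian. -/
theorem wronskian_eq_zero {ν : ℝ} {ϑ : ℂ} {κ : DomainWall} {z : ℂ} {u v : L2}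
    {U V : ℝ → Spinor} (hU : ∀ x, HasDerivAt U (diracCoeff ν ϑ κ z x (U x)) x)
    (hV : ∀ x, HasDerivAt V (diracCoeff ν ϑ κ z x (V x)) x)
    (eU : u =ᵐ[volume] U) (eV : v =ᵐ[volume] V) (x : ℝ) :
    U x 0 * V x 1 - U x 1 * V x 0 = 0 := by
  -- The coefficient matrix has trace zero, so the Wronskian is constant. As a combination of
  -- products of `L²` functions it is integrable, which forces the constant to be zero.
  have hd : ∀ x, HasDerivAt (fun x => U x 0 * V x 1 - U x 1 * V x 0) 0 x := by
    intro x
    have h := ((hasDerivAt_coord (hU x) 0).mul (hasDerivAt_coord (hV x) 1)).sub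
      ((hasDerivAt_coord (hU x) 1).mul (hasDerivAt_coord (hV x) 0))
    refine h.congr_deriv ?_
    rw [(diracCoeff_apply ν ϑ κ z x (U x)).1, (diracCoeff_apply ν ϑ κ z x (U x)).2,
      (diracCoeff_apply ν ϑ κ z x (V x)).1, (diracCoeff_apply ν ϑ κ z x (V x)).2]
    ring
  have hconst : ∀ y, U y 0 * V y 1 - U y 1 * V y 0 = U x 0 * V x 1 - U x 1 * V x 0 :=
    fun y => is_const_of_deriv_eq_zero (fun x => (hd x).differentiableAt)
      (fun x => (hd x).deriv) y x
  have hi : Integrable fun y => U y 0 * V y 1 - U y 1 * V y 0 := by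
    refine ((((memLp_coord u 0).integrable_mul (memLp_coord v 1)).sub
      ((memLp_coord u 1).integrable_mul (memLp_coord v 0)))).congr ?_
    filter_upwards [eU, eV] with y h1 h2
    simp only [Pi.sub_apply, Pi.mul_apply]
    rw [h1, h2]
  exact eq_zero_of_integrable_of_eqOn_Ici hi (L := 0) fun y _ => hconst y

/-- The vanishing Wronskian makes the values at `0` of two eigenfunctions proportional, and
uniqueness for the system carries the proportionality to the whole line. -/
theorem finrank_eigenspace_eq_one {ν : ℝ} (hν : ν ≠ 0) {ϑ : ℂ} {κ : DomainWall} {z : ℂ}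
    (hne : eigenspace (diracOperator ν ϑ κ) z ≠ ⊥) :
    Module.finrank ℂ (eigenspace (diracOperator ν ϑ κ) z) = 1 := by
  obtain ⟨v, hv, hv0⟩ := Submodule.exists_mem_ne_zero_of_ne_bot hne
  obtain ⟨V, hV, eV⟩ := exists_ode_of_mem_eigenspace hν hv
  refine finrank_eq_one (⟨v, hv⟩ : eigenspace (diracOperator ν ϑ κ) z)
    (fun h => hv0 (congrArg Subtype.val h)) ?_
  rintro ⟨u, hu⟩
  obtain ⟨U, hU, eU⟩ := exists_ode_of_mem_eigenspace hν hu
  have hw := wronskian_eq_zero hU hV eU eV 0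
  have hV0 : V 0 ≠ 0 := by
    intro h
    have : V = fun _ => 0 := diracCoeff_ode_unique hV
      (fun x => by rw [map_zero]; exact hasDerivAt_const x 0) (x₀ := 0) h
    refine hv0 (Lp.ext ?_)
    filter_upwards [eV, Lp.coeFn_zero Spinor 2 (volume : Measure ℝ)] with x h1 h2
    rw [h1, this, h2, Pi.zero_apply]
  obtain ⟨c, hc⟩ : ∃ c : ℂ, c • V 0 = U 0 := by
    by_cases h0 : V 0 0 = 0
    · have h1 : V 0 1 ≠ 0 := by
        intro h1
        refine hV0 ?_
        ext i
        fin_cases i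
        · exact h0
        · exact h1
      refine ⟨U 0 1 / V 0 1, ?_⟩
      ext i
      obtain rfl | rfl : i = 0 ∨ i = 1 := by fin_cases i <;> simp
      · rw [h0, mul_zero, sub_zero] at hw
        rw [PiLp.smul_apply, h0, smul_zero]
        exact ((mul_eq_zero.1 hw).resolve_right h1).symm
      · rw [PiLp.smul_apply, smul_eq_mul, div_mul_cancel₀ _ h1]
    · refine ⟨U 0 0 / V 0 0, ?_⟩
      ext i
      obtain rfl | rfl : i = 0 ∨ i = 1 := by fin_cases i <;> simp
      · rw [PiLp.smul_apply, smul_eq_mul, div_mul_cancel₀ _ h0]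
      · rw [PiLp.smul_apply, smul_eq_mul, div_mul_eq_mul_div, div_eq_iff h0]
        linear_combination hw
  have hcV : (fun x => c • V x) = U := diracCoeff_ode_unique (x₀ := 0)
    (fun x => by rw [map_smul]; exact (hV x).const_smul c) hU hc
  refine ⟨c, Subtype.ext (Lp.ext ?_)⟩
  change (c • v : L2) =ᵐ[volume] u
  filter_upwards [eU, eV, Lp.coeFn_smul c v] with x h1 h2 h3
  rw [h3, Pi.smul_apply, h2, h1, ← hcV]

/-- There are no eigenvalues outside the gap. -/
theorem eigenspace_eq_bot_of_le {ν : ℝ} (hν : ν ≠ 0) {ϑ : ℂ} {κ : DomainWall} {μ : ℝ}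
    (hμ : ‖ϑ‖ ≤ |μ|) : eigenspace (diracOperator ν ϑ κ) (μ : ℂ) = ⊥ := by
  have hνC : (ν : ℂ) ≠ 0 := by exact_mod_cast hν
  obtain ⟨L, -, hκ, -⟩ := κ.eventually_const
  rw [eq_bot_iff]
  intro v hv
  obtain ⟨V, hV, eV⟩ := exists_ode_of_mem_eigenspace hν hv
  have hVc : Continuous V := continuous_iff_continuousAt.2 fun x => (hV x).continuousAt
  -- With `B = μ - σ_⋆` this is `⟨V, BV⟩`. Where `κ = 1` the system reads `V' = (i/ν) σ₃ B V` with
  -- `B` Hermitian, so the form is conserved; being integrable, it vanishes there.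
  set Hf : ℝ → ℂ := fun x => μ * (conj (V x 0) * V x 0 + conj (V x 1) * V x 1)
    - (conj (V x 0) * (conj ϑ * V x 1) + conj (V x 1) * (ϑ * V x 0)) with hHf
  have hdH : ∀ x, L ≤ x → HasDerivAt Hf 0 x := by
    intro x hx
    have h0 := hasDerivAt_coord (hV x) 0
    have h1 := hasDerivAt_coord (hV x) 1
    have h0s : HasDerivAt (fun y => conj (V y 0)) _ x := h0.star
    have h1s : HasDerivAt (fun y => conj (V y 1)) _ x := h1.star
    have h := (((h0s.mul h0).add (h1s.mul h1)).const_mul (μ : ℂ)).sub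
      ((h0s.mul (h1.const_mul (conj ϑ))).add (h1s.mul (h0.const_mul ϑ)))
    refine h.congr_deriv ?_
    rw [(diracCoeff_apply ν ϑ κ μ x (V x)).1, (diracCoeff_apply ν ϑ κ μ x (V x)).2, hκ x hx]
    simp only [← starRingEnd_apply, map_mul, map_sub, map_div₀, map_neg, Complex.conj_I,
      Complex.conj_ofReal, Complex.conj_conj, Complex.ofReal_one, one_mul]
    field_simp
    ring
  have hHconst : ∀ x, L ≤ x → Hf x = Hf L := by
    intro x hx
    have hcont : Continuous Hf := by
      have c0 : Continuous fun x => V x 0 :=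
        (EuclideanSpace.proj (𝕜 := ℂ) (0 : Fin 2)).continuous.comp hVc
      have c1 : Continuous fun x => V x 1 :=
        (EuclideanSpace.proj (𝕜 := ℂ) (1 : Fin 2)).continuous.comp hVc
      rw [hHf]
      fun_prop
    exact constant_of_has_deriv_right_zero hcont.continuousOn
      (fun y hy => (hdH y hy.1).hasDerivWithinAt) x ⟨hx, le_rfl⟩
  have hHi : Integrable Hf := by
    have h := ((((v.integrable_conj_mul v 0 0).add (v.integrable_conj_mul v 1 1)).const_mul
      (μ : ℂ)).sub (((v.integrable_conj_mul v 0 1).const_mul (conj ϑ)).add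
        ((v.integrable_conj_mul v 1 0).const_mul ϑ)))
    refine h.congr ?_
    filter_upwards [eV] with x hx
    simp only [Pi.sub_apply, Pi.add_apply, hHf]
    rw [hx]
    ring
  have hHL := eq_zero_of_integrable_of_eqOn_Ici hHi hHconst
  have hcoef : ∀ x, L ≤ x → diracCoeff ν ϑ κ μ x (V x) = 0 := by
    intro x hx
    have hH := hHconst x hx
    rw [hHL] at hH
    set p := (μ : ℂ) * V x 0 - conj ϑ * V x 1 with hp
    set r := (μ : ℂ) * V x 1 - ϑ * V x 0 with hr
    -- The left side is `|BV|²`, and `B² = 2μB - (μ² - |ϑ|²)` because `σ_⋆² = |ϑ|²`. With `⟨V, BV⟩ =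
    -- 0` this gives `BV = 0`, so `V' = 0` on the half-line, also when `|μ| = |ϑ|`.
    have hsum : ‖p‖ ^ 2 + ‖r‖ ^ 2 = -(μ ^ 2 - ‖ϑ‖ ^ 2) * (‖V x 0‖ ^ 2 + ‖V x 1‖ ^ 2) := by
      have : ((‖p‖ ^ 2 + ‖r‖ ^ 2 : ℝ) : ℂ)
          = ((-(μ ^ 2 - ‖ϑ‖ ^ 2) * (‖V x 0‖ ^ 2 + ‖V x 1‖ ^ 2) : ℝ) : ℂ) := by
        push_cast
        simp only [← Complex.conj_mul', hp, hr]
        simp only [map_sub, map_mul, Complex.conj_ofReal, Complex.conj_conj]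
        rw [hHf] at hH
        linear_combination (2 * (μ : ℂ)) * hH
      exact_mod_cast this
    have hgap : 0 ≤ μ ^ 2 - ‖ϑ‖ ^ 2 := by
      rw [← sq_abs μ]
      have := pow_le_pow_left₀ (norm_nonneg ϑ) hμ 2
      linarith
    have hle : ‖p‖ ^ 2 + ‖r‖ ^ 2 ≤ 0 := by
      rw [hsum]
      have := mul_nonneg hgap (add_nonneg (sq_nonneg ‖V x 0‖) (sq_nonneg ‖V x 1‖))
      linarith
    have hp0 : p = 0 := by
      have : ‖p‖ ^ 2 = 0 := by nlinarith [sq_nonneg ‖p‖, sq_nonneg ‖r‖]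
      simpa using this
    have hr0 : r = 0 := by
      have : ‖r‖ ^ 2 = 0 := by nlinarith [sq_nonneg ‖p‖, sq_nonneg ‖r‖]
      simpa using this
    ext i
    obtain rfl | rfl : i = 0 ∨ i = 1 := by fin_cases i <;> simp
    · rw [(diracCoeff_apply ν ϑ κ μ x (V x)).1, hκ x hx, Complex.ofReal_one, one_mul, ← hp, hp0]
      simp
    · rw [(diracCoeff_apply ν ϑ κ μ x (V x)).2, hκ x hx, Complex.ofReal_one, one_mul, ← hr, hr0]
      simp
  have hVconst : ∀ x, L ≤ x → V x = V L := by
    intro x hx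
    refine constant_of_has_deriv_right_zero hVc.continuousOn (fun y hy => ?_) x ⟨hx, le_rfl⟩
    rw [← hcoef y hy.1]
    exact (hV y).hasDerivWithinAt
  have hVL : V L = 0 := by
    have hi : Integrable fun x => ‖V x‖ ^ 2 := by
      refine v.integrable_norm_sq.congr ?_
      filter_upwards [eV] with x hx
      rw [hx]
    have := eq_zero_of_integrable_of_eqOn_Ici hi (c := ‖V L‖ ^ 2) (L := L)
      fun x hx => by rw [hVconst x hx]
    simpa using this
  have hV0 : V = fun _ => 0 := diracCoeff_ode_unique hV
    (fun x => by rw [map_zero]; exact hasDerivAt_const x 0) (x₀ := L) hVL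
  refine (Submodule.mem_bot ℂ).2 (Lp.ext ?_)
  filter_upwards [eV, Lp.coeFn_zero Spinor 2 (volume : Measure ℝ)] with x h1 h2
  rw [h1, hV0, h2, Pi.zero_apply]

/-! ### Chiral symmetry of the eigenvalues -/

/-- Constant matrices commute with the weak derivative. -/
theorem IsWeakDeriv.matL2 {u g : L2} (h : IsWeakDeriv u g) (M : Matrix (Fin 2) (Fin 2) ℂ) :
    IsWeakDeriv (DiracWall.matL2 M u) (DiracWall.matL2 M g) := by
  rw [isWeakDeriv_iff_coord] at h ⊢
  intro i χ hχ hc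
  have hχ' : Continuous (deriv χ) := hχ.continuous_deriv (by simp)
  have e1 : ∫ x, ((deriv χ x : ℝ) : ℂ) * DiracWall.matL2 M u x i
      = ∫ x, (M i 0 * (((deriv χ x : ℝ) : ℂ) * u x 0)
        + M i 1 * (((deriv χ x : ℝ) : ℂ) * u x 1)) := by
    refine integral_congr_ae ?_
    filter_upwards [matL2_coeFn M u] with x hx
    rw [hx i]; ring
  have e2 : ∫ x, (χ x : ℂ) * DiracWall.matL2 M g x i
      = ∫ x, (M i 0 * ((χ x : ℂ) * g x 0) + M i 1 * ((χ x : ℂ) * g x 1)) := by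
    refine integral_congr_ae ?_
    filter_upwards [matL2_coeFn M g] with x hx
    rw [hx i]; ring
  rw [e1, e2, integral_add ((integrable_test_mul u hχ' hc.deriv 0).const_mul _)
    ((integrable_test_mul u hχ' hc.deriv 1).const_mul _),
    integral_add ((integrable_test_mul g hχ.continuous hc 0).const_mul _)
    ((integrable_test_mul g hχ.continuous hc 1).const_mul _), integral_const_mul,
    integral_const_mul, integral_const_mul, integral_const_mul, h 0 χ hχ hc, h 1 χ hχ hc]
  ring

/-- The spectrum is symmetric: a constant matrix anticommutes with the Dirac operator. -/
theorem eigenspace_neg_ne_bot {ν : ℝ} {ϑ : ℂ} (hϑ : ϑ ≠ 0) {κ : DomainWall} {z : ℂ}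
    (hne : eigenspace (diracOperator ν ϑ κ) z ≠ ⊥) :
    eigenspace (diracOperator ν ϑ κ) (-z) ≠ ⊥ := by
  obtain ⟨v, ⟨⟨g, hg⟩, e⟩, hv0⟩ := Submodule.exists_mem_ne_zero_of_ne_bot hne
  -- This is `σ₃ σ_⋆`, which anticommutes with both `σ₃` and `σ_⋆`; it is invertible since `ϑ ≠ 0`.
  set M : Matrix (Fin 2) (Fin 2) ℂ := !![0, conj ϑ; -ϑ, 0] with hM
  have hϑ' : conj ϑ ≠ 0 := (map_ne_zero _).2 hϑ
  have hmem : matL2 M v ∈ eigenspace (diracOperator ν ϑ κ) (-z) := by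
    refine exists_diracOperator_eq (hg.matL2 M) ?_
    filter_upwards [diracOperator_coeFn (κ := κ) (ν := ν) (ϑ := ϑ) hg ⟨g, hg⟩,
      Lp.coeFn_smul z v, Lp.coeFn_smul (-z) (matL2 M v), matL2_coeFn M v,
      matL2_coeFn M g] with x h1 h2 h3 h4 h5
    rw [e, h2, Pi.smul_apply, PiLp.smul_apply, PiLp.smul_apply, smul_eq_mul, smul_eq_mul] at h1
    rw [h3, Pi.smul_apply, PiLp.smul_apply, PiLp.smul_apply, h4, h4, h5, h5]
    simp only [hM, Matrix.of_apply, Matrix.cons_val', Matrix.cons_val_zero, Matrix.cons_val_one,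
      Matrix.cons_val_fin_one, smul_eq_mul]
    constructor
    · linear_combination (-conj ϑ) * h1.2
    · linear_combination ϑ * h1.1
  intro hbot
  rw [hbot, Submodule.mem_bot] at hmem
  refine hv0 (L2.ext_coord ?_)
  filter_upwards [matL2_coeFn M v, Lp.coeFn_zero Spinor 2 (volume : Measure ℝ)] with x h1 h2
  rw [hmem] at h1
  have a0 := h1 0
  have a1 := h1 1
  rw [h2, Pi.zero_apply] at a0 a1
  rw [h2, Pi.zero_apply]
  simp [hM, hϑ] at a0 a1
  exact ⟨by simpa using a1, by simpa using a0⟩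

/-! ### The zero mode -/

theorem integrable_exp_neg_mul_abs {c : ℝ} (hc : 0 < c) :
    Integrable fun x : ℝ => Real.exp (-c * |x|) := by
  rw [← integrableOn_univ, ← Iic_union_Ioi (a := (0 : ℝ))]
  refine IntegrableOn.union ?_ ?_
  · refine (integrableOn_exp_mul_Iic hc 0).congr_fun (fun x hx => ?_) measurableSet_Iic
    simp only
    rw [abs_of_nonpos hx, neg_mul_neg]
  · refine (integrableOn_exp_mul_Ioi (neg_lt_zero.2 hc) 0).congr_fun (fun x hx => ?_)
      measurableSet_Ioi
    simp only
    rw [abs_of_pos hx]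

/-- The primitive of `κ` has slope `±1` outside a compact interval, on which `|x|` minus the
primitive is bounded. This is the decay of the zero mode. -/
theorem DomainWall.exists_abs_sub_le_integral (κ : DomainWall) :
    ∃ M : ℝ, ∀ x, |x| - M ≤ ∫ t in (0 : ℝ)..x, κ.toFun t := by
  obtain ⟨L, hL, h1, h2⟩ := κ.eventually_const
  have hint : ∀ a b, IntervalIntegrable κ.toFun volume a b :=
    fun a b => κ.smooth.continuous.intervalIntegrable a b
  set K : ℝ → ℝ := fun x => ∫ t in (0 : ℝ)..x, κ.toFun t with hK
  have hKc : Continuous K := intervalIntegral.continuous_primitive hint 0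
  obtain ⟨M, hM⟩ := (isCompact_Icc (a := -L) (b := L)).exists_bound_of_continuousOn
    (f := fun x => |x| - K x) (continuous_abs.sub hKc).continuousOn
  have hM' : ∀ x ∈ Icc (-L) L, |x| - M ≤ K x := fun x hx => by
    have := (le_abs_self _).trans (hM x hx)
    linarith
  refine ⟨M, fun x => ?_⟩
  change |x| - M ≤ K x
  by_cases hx : x ∈ Icc (-L) L
  · exact hM' x hx
  rw [mem_Icc, not_and_or, not_le, not_le] at hx
  rcases hx with hx | hx
  · have e : K x = K (-L) + ∫ t in (-L)..x, κ.toFun t :=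
      (intervalIntegral.integral_add_adjacent_intervals (hint _ _) (hint _ _)).symm
    have e2 : ∫ t in (-L)..x, κ.toFun t = ∫ t in (-L)..x, (-1 : ℝ) := by
      refine intervalIntegral.integral_congr fun t ht => ?_
      rw [uIcc_of_ge hx.le] at ht
      exact h2 t ht.2
    rw [e, e2, intervalIntegral.integral_const, smul_eq_mul, abs_of_neg (by linarith)]
    have := hM' (-L) ⟨le_rfl, by linarith⟩
    rw [abs_neg, abs_of_pos hL] at this
    linarith
  · have e : K x = K L + ∫ t in L..x, κ.toFun t :=
      (intervalIntegral.integral_add_adjacent_intervals (hint _ _) (hint _ _)).symm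
    have e2 : ∫ t in L..x, κ.toFun t = ∫ t in L..x, (1 : ℝ) := by
      refine intervalIntegral.integral_congr fun t ht => ?_
      rw [uIcc_of_le hx.le] at ht
      exact h1 t ht.1
    rw [e, e2, intervalIntegral.integral_const, smul_eq_mul, abs_of_pos (by linarith)]
    have := hM' L ⟨by linarith, le_rfl⟩
    rw [abs_of_pos hL] at this
    linarith

/-- Zero is an eigenvalue. -/
theorem eigenspace_zero_ne_bot {ν : ℝ} (hν : ν ≠ 0) {ϑ : ℂ} (hϑ : ϑ ≠ 0) (κ : DomainWall) :
    eigenspace (diracOperator ν ϑ κ) 0 ≠ ⊥ := by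
  have hνC : (ν : ℂ) ≠ 0 := by exact_mod_cast hν
  set c : ℝ := ‖ϑ‖ / |ν| with hc
  have hcpos : 0 < c := div_pos (norm_pos_iff.2 hϑ) (abs_pos.2 hν)
  have hc2 : (c : ℂ) ^ 2 * ν ^ 2 = conj ϑ * ϑ := by
    rw [Complex.conj_mul', hc]
    have : (‖ϑ‖ / |ν|) ^ 2 * ν ^ 2 = ‖ϑ‖ ^ 2 := by
      rw [div_pow, sq_abs]; field_simp
    exact_mod_cast this
  set K : ℝ → ℝ := fun x => ∫ t in (0 : ℝ)..x, κ.toFun t with hK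
  have hKd : ∀ x, HasDerivAt K (κ.toFun x) x := fun x =>
    intervalIntegral.integral_hasDerivAt_right (κ.smooth.continuous.intervalIntegrable _ _)
      κ.smooth.continuous.aestronglyMeasurable.stronglyMeasurableAtFilter
      κ.smooth.continuous.continuousAt
  -- At energy zero the coefficient matrix is `κ` times a constant matrix with eigenvalues `±c`. The
  -- vector `w` belongs to `-c`, the sign for which `exp(-cK)` decays at both ends.
  set w : Spinor := !₂[conj ϑ, -Complex.I * ν * c] with hw
  have hw0 : w 0 = conj ϑ := rfl
  have hw1 : w 1 = -Complex.I * ν * c := rfl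
  set V : ℝ → Spinor := fun x => Real.exp (-c * K x) • w with hV
  have hVd : ∀ x, HasDerivAt V (diracCoeff ν ϑ κ 0 x (V x)) x := by
    intro x
    have h := (((hKd x).const_mul (-c)).exp).smul_const w
    refine h.congr_deriv ?_
    ext i
    obtain rfl | rfl : i = 0 ∨ i = 1 := by fin_cases i <;> simp
    · rw [(diracCoeff_apply ν ϑ κ 0 x (V x)).1, hV]
      simp only [PiLp.smul_apply, hw0, hw1, Complex.real_smul]
      push_cast
      field_simp
      linear_combination (-(c * κ.toFun x * conj ϑ * ν : ℂ)) * Complex.I_sq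
    · rw [(diracCoeff_apply ν ϑ κ 0 x (V x)).2, hV]
      simp only [PiLp.smul_apply, hw0, hw1, Complex.real_smul]
      push_cast
      field_simp
      linear_combination ((κ.toFun x : ℂ)) * hc2
  have hVc : Continuous V := continuous_iff_continuousAt.2 fun x => (hVd x).continuousAt
  obtain ⟨M, hM⟩ := κ.exists_abs_sub_le_integral
  have hV2 : MemLp V 2 volume := by
    rw [memLp_two_iff_integrable_sq_norm hVc.aestronglyMeasurable]
    refine ((integrable_exp_neg_mul_abs (c := 2 * c) (by positivity)).const_mul
      (Real.exp (2 * c * M) * ‖w‖ ^ 2)).mono' (hVc.norm.pow 2).aestronglyMeasurable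
      (Filter.Eventually.of_forall fun x => ?_)
    rw [Real.norm_eq_abs, abs_of_nonneg (sq_nonneg _), hV]
    beta_reduce
    rw [norm_smul, Real.norm_eq_abs, abs_of_pos (Real.exp_pos _), mul_pow]
    have h1 : Real.exp (-c * K x) ^ 2 ≤ Real.exp (2 * c * M) * Real.exp (-(2 * c) * |x|) := by
      rw [← Real.exp_nat_mul, ← Real.exp_add, Real.exp_le_exp]
      have := mul_le_mul_of_nonneg_left (hM x) hcpos.le
      push_cast
      change 2 * (-c * K x) ≤ _
      change _ ≤ c * K x at this
      linarith
    calc _ ≤ Real.exp (2 * c * M) * Real.exp (-(2 * c) * |x|) * ‖w‖ ^ 2 :=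
          mul_le_mul_of_nonneg_right h1 (sq_nonneg _)
      _ = _ := by ring
  have hmem := mem_eigenspace_of_ode hν hVd hV2
  intro hbot
  rw [hbot, Submodule.mem_bot, ← MemLp.toLp_zero (MemLp.zero' (p := 2)), MemLp.toLp_eq_toLp_iff]
    at hmem
  have hV0 := (hVc.ae_eq_iff_eq volume continuous_const).1 hmem
  have h0 := congrFun hV0 0
  rw [hV] at h0
  beta_reduce at h0
  have hw0' : w = 0 := (smul_eq_zero.1 h0).resolve_left (Real.exp_ne_zero _)
  have := congrArg (fun s : Spinor => s 0) hw0'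
  simp only [hw0] at this
  exact hϑ ((map_eq_zero _).1 this)

/-! ### The essential spectrum -/

/-- A plane wave with a slowly varying amplitude. -/
def wavePacket (η : ℝ → ℝ) (r a k : ℝ) (w : Spinor) (x : ℝ) : Spinor :=
  ((η ((x - a) / r) : ℂ) * Complex.exp (Complex.I * k * x)) • w

theorem norm_wavePacket (η : ℝ → ℝ) (r a k : ℝ) (w : Spinor) (x : ℝ) :
    ‖wavePacket η r a k w x‖ = |η ((x - a) / r)| * ‖w‖ := by
  rw [wavePacket, norm_smul, norm_mul, Complex.norm_real, Real.norm_eq_abs]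
  have : Complex.I * k * x = ((k * x : ℝ) : ℂ) * Complex.I := by push_cast; ring
  rw [this, Complex.norm_exp_ofReal_mul_I, mul_one]

theorem integral_norm_sq_wavePacket (η : ℝ → ℝ) {r : ℝ} (hr : 0 < r) (a k : ℝ) (w : Spinor) :
    ∫ x, ‖wavePacket η r a k w x‖ ^ 2 = r * ‖w‖ ^ 2 * ∫ x, η x ^ 2 := by
  simp_rw [norm_wavePacket, mul_pow, sq_abs]
  rw [integral_mul_const, integral_sub_right_eq_self (fun x => η (x / r) ^ 2) a,
    Measure.integral_comp_div (fun x => η x ^ 2) r, abs_of_pos hr, smul_eq_mul]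
  ring

theorem continuous_wavePacket {η : ℝ → ℝ} (hη : Continuous η) (r a k : ℝ) (w : Spinor) :
    Continuous (wavePacket η r a k w) := by
  unfold wavePacket
  fun_prop

theorem memLp_wavePacket {η : ℝ → ℝ} (hη : Continuous η) (hc : HasCompactSupport η) {r : ℝ}
    (hr : 0 < r) (a k : ℝ) (w : Spinor) : MemLp (wavePacket η r a k w) 2 := by
  rw [memLp_two_iff_integrable_sq_norm (continuous_wavePacket hη r a k w).aestronglyMeasurable]
  simp_rw [norm_wavePacket, mul_pow, sq_abs]
  refine Integrable.mul_const ?_ _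
  have h1 : Integrable fun x => η x ^ 2 :=
    (hη.pow 2).integrable_of_hasCompactSupport (by
      simp_rw [pow_two]; exact hc.mul_left)
  exact (h1.comp_div hr.ne').comp_sub_right a

theorem hasDerivAt_wavePacket {η : ℝ → ℝ} (hη : ContDiff ℝ ∞ η) (r a k : ℝ) (w : Spinor) (x : ℝ) :
    HasDerivAt (wavePacket η r a k w) ((1 / r : ℂ) • wavePacket (deriv η) r a k w x
      + (Complex.I * k) • wavePacket η r a k w x) x := by
  have h1 : HasDerivAt (fun x : ℝ => (x - a) / r) (1 / r) x :=
    ((hasDerivAt_id x).sub_const a).div_const r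
  have h2 : HasDerivAt (fun x : ℝ => η ((x - a) / r)) (deriv η ((x - a) / r) * (1 / r)) x :=
    ((hη.differentiable (by simp) _).hasDerivAt).comp x h1
  have h3 : HasDerivAt (fun x : ℝ => Complex.exp (Complex.I * k * x))
      (Complex.exp (Complex.I * k * x) * (Complex.I * k * 1)) x :=
    ((hasDerivAt_id x).ofReal_comp.const_mul (Complex.I * k)).cexp
  refine ((h2.ofReal_comp.mul h3).smul_const w).congr_deriv ?_
  rw [wavePacket, wavePacket, smul_smul, smul_smul, ← add_smul]
  congr 1
  push_cast
  ring

/-- Wave packets are approximate eigenvectors. -/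
theorem exists_approx_eigenvector {ν : ℝ} {ϑ : ℂ} (κ : DomainWall) {L : ℝ}
    (hκ : ∀ y, L ≤ y → κ.toFun y = 1) {η : ℝ → ℝ} (hηs : ContDiff ℝ ∞ η)
    (hηc : HasCompactSupport η) (hη0 : ∀ x, η x ≠ 0 → -2 < x) {μ k : ℝ}
    (hk2 : conj ϑ * ϑ = (μ : ℂ) ^ 2 - (ν : ℂ) ^ 2 * k ^ 2) {w : Spinor}
    (hw0 : w 0 = conj ϑ) (hw1 : w 1 = μ - ν * k) {r : ℝ} (hr : 0 < r) :
    ∃ u : (diracOperator ν ϑ κ).domain, ‖(u : L2)‖ ^ 2 = r * ‖w‖ ^ 2 * ∫ x, η x ^ 2 ∧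
      ‖diracOperator ν ϑ κ u - (μ : ℂ) • (u : L2)‖ ^ 2
        = ν ^ 2 / r ^ 2 * (r * ‖w‖ ^ 2 * ∫ x, deriv η x ^ 2) := by
  have hη' : Continuous (deriv η) := hηs.continuous_deriv (by simp)
  -- Since `η` vanishes at or below `-2`, the packet centred here lives in `x > L`, where `κ = 1`.
  set a := L + 2 * r with ha
  have m0 := memLp_wavePacket hηs.continuous hηc hr a k w
  have m1 := memLp_wavePacket hη' hηc.deriv hr a k w
  have md : MemLp (fun x => (1 / r : ℂ) • wavePacket (deriv η) r a k w x
    + (Complex.I * k) • wavePacket η r a k w x) 2 :=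
    (m1.const_smul (1 / r : ℂ)).add (m0.const_smul (Complex.I * k))
  have c0 := continuous_wavePacket hηs.continuous r a k w
  have c1 := continuous_wavePacket hη' r a k w
  have hcd : Continuous fun x => (1 / r : ℂ) • wavePacket (deriv η) r a k w x
      + (Complex.I * k) • wavePacket η r a k w x := by fun_prop
  have hwd := isWeakDeriv_toLp (hasDerivAt_wavePacket hηs r a k w)
    hcd m0 md
  have hdom : m0.toLp ∈ (diracOperator ν ϑ κ).domain := ⟨_, hwd⟩
  set u : L2 := m0.toLp with hu
  set f : L2 := diracOperator ν ϑ κ ⟨u, hdom⟩ - (μ : ℂ) • u with hf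
  have hunorm : ‖u‖ ^ 2 = r * ‖w‖ ^ 2 * ∫ x, η x ^ 2 := by
    rw [L2.norm_sq_eq, ← integral_norm_sq_wavePacket η hr a k w]
    refine integral_congr_ae ?_
    filter_upwards [m0.coeFn_toLp] with x hx
    rw [hu, hx]
  have hfnorm : ‖f‖ ^ 2 = ν ^ 2 / r ^ 2 * (r * ‖w‖ ^ 2 * ∫ x, deriv η x ^ 2) := by
    rw [L2.norm_sq_eq, ← integral_norm_sq_wavePacket (deriv η) hr a k w, ← integral_const_mul]
    refine integral_congr_ae ?_
    filter_upwards [m0.coeFn_toLp, md.coeFn_toLp, diracOperator_coeFn hwd hdom,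
      Lp.coeFn_sub (diracOperator ν ϑ κ ⟨u, hdom⟩) ((μ : ℂ) • u), Lp.coeFn_smul (μ : ℂ) u]
      with x e0 ed eD es em
    set ζ := wavePacket (deriv η) r a k w x with hζ
    have hκη : (κ.toFun x : ℂ) * η ((x - a) / r) = η ((x - a) / r) := by
      by_cases hz : η ((x - a) / r) = 0
      · rw [hz]; simp
      · have h2 := hη0 _ hz
        rw [lt_div_iff₀ hr] at h2
        rw [hκ x (by rw [ha] at h2; linarith)]; simp
    -- By `hk2` the vector `w` is an eigenvector of the symbol `ν k σ₃ + σ_⋆` for `μ`. Only the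
    -- derivative of the amplitude survives, with its factor `1/r`.
    have hf0 : f x 0 = -Complex.I * ν / r * ζ 0 := by
      rw [hf, es, Pi.sub_apply, PiLp.sub_apply, eD.1, em, Pi.smul_apply, PiLp.smul_apply, ed,
        hu, e0]
      simp only [PiLp.add_apply, PiLp.smul_apply, smul_eq_mul]
      simp only [wavePacket, PiLp.smul_apply, smul_eq_mul, hw0, hw1]
      linear_combination (conj ϑ * (μ - ν * k) * Complex.exp (Complex.I * k * x)) * hκη
        - (ν * k * η ((x - a) / r) * Complex.exp (Complex.I * k * x) * conj ϑ) * Complex.I_sq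
    have hf1 : f x 1 = Complex.I * ν / r * ζ 1 := by
      rw [hf, es, Pi.sub_apply, PiLp.sub_apply, eD.2, em, Pi.smul_apply, PiLp.smul_apply, ed,
        hu, e0]
      simp only [PiLp.add_apply, PiLp.smul_apply, smul_eq_mul]
      simp only [wavePacket, PiLp.smul_apply, smul_eq_mul, hw0, hw1]
      linear_combination (ϑ * conj ϑ * Complex.exp (Complex.I * k * x)) * hκη
        + (ν * k * η ((x - a) / r) * Complex.exp (Complex.I * k * x) * (μ - ν * k))
          * Complex.I_sq
        + (η ((x - a) / r) * Complex.exp (Complex.I * k * x)) * hk2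
    rw [Spinor.norm_sq_eq, Spinor.norm_sq_eq, hf0, hf1]
    simp only [norm_mul, norm_div, norm_neg, Complex.norm_I, Complex.norm_real, one_mul,
      Real.norm_eq_abs, mul_pow, div_pow, sq_abs]
    ring
  exact ⟨⟨u, hdom⟩, hunorm, hfnorm⟩

theorem mem_spectrum_of_le {ν : ℝ} (hν : ν ≠ 0) {ϑ : ℂ} (hϑ : ϑ ≠ 0) (κ : DomainWall) {μ : ℝ}
    (hμ : ‖ϑ‖ ≤ |μ|) : (μ : ℂ) ∈ spectrum (diracOperator ν ϑ κ) := by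
  rintro ⟨R, -, hR⟩
  have hνC : (ν : ℂ) ≠ 0 := by exact_mod_cast hν
  obtain ⟨L, hL, hκ, -⟩ := κ.eventually_const
  have hgap : 0 ≤ μ ^ 2 - ‖ϑ‖ ^ 2 := by
    rw [← sq_abs μ]
    have := pow_le_pow_left₀ (norm_nonneg ϑ) hμ 2
    linarith
  set k : ℝ := Real.sqrt (μ ^ 2 - ‖ϑ‖ ^ 2) / ν with hk
  have hk2 : conj ϑ * ϑ = (μ : ℂ) ^ 2 - (ν : ℂ) ^ 2 * k ^ 2 := by
    rw [Complex.conj_mul']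
    have : ‖ϑ‖ ^ 2 = μ ^ 2 - ν ^ 2 * k ^ 2 := by
      rw [hk, div_pow, Real.sq_sqrt hgap]; field_simp; ring
    exact_mod_cast this
  set w : Spinor := !₂[conj ϑ, μ - ν * k] with hw
  have hw0 : w 0 = conj ϑ := rfl
  have hw1 : w 1 = μ - ν * k := rfl
  have hwpos : 0 < ‖w‖ ^ 2 := by
    rw [Spinor.norm_sq_eq, hw0, RCLike.norm_conj]
    have := norm_pos_iff.2 hϑ
    positivity
  let b : ContDiffBump (0 : ℝ) := ⟨1, 2, by norm_num, by norm_num⟩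
  set η : ℝ → ℝ := fun x => b x with hη
  have hηs : ContDiff ℝ ∞ η := b.contDiff
  have hηc : HasCompactSupport η := b.hasCompactSupport
  have hη' : Continuous (deriv η) := hηs.continuous_deriv (by simp)
  have hη0 : ∀ x, η x ≠ 0 → -2 < x := by
    intro x hx
    have : x ∈ Function.support b := hx
    rw [b.support_eq, Metric.mem_ball, dist_zero_right, Real.norm_eq_abs, abs_lt] at this
    exact this.1
  have hη2 : Integrable fun x => η x ^ 2 :=
    (hηs.continuous.pow 2).integrable_of_hasCompactSupport (by
      simp_rw [pow_two]; exact hηc.mul_left)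
  have hI : 0 < ∫ x, η x ^ 2 := by
    rw [integral_pos_iff_support_of_nonneg (fun x => sq_nonneg _) hη2]
    have : Function.support (fun x => η x ^ 2) = Metric.ball 0 2 := by
      rw [← b.support_eq]
      ext x
      simp [hη]
    rw [this]
    exact Metric.measure_ball_pos _ _ (by norm_num)
  set I₀ := ∫ x, η x ^ 2 with hI₀
  set I₁ := ∫ x, deriv η x ^ 2 with hI₁
  have hI₁0 : 0 ≤ I₁ := integral_nonneg fun x => sq_nonneg _
  -- A bounded left inverse of `D - μ` would bound the width `r` of the packets; taking `r² = (B +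
  -- 1)/I₀` below contradicts this.
  have key : ∀ r : ℝ, 0 < r → r ^ 2 * I₀ ≤ ‖R‖ ^ 2 * ν ^ 2 * I₁ := by
    intro r hr
    obtain ⟨u, hunorm, hfnorm⟩ := exists_approx_eigenvector κ hκ hηs hηc hη0 hk2 hw0 hw1 hr
    have hle := R.le_opNorm (diracOperator ν ϑ κ u - (μ : ℂ) • (u : L2))
    rw [hR u] at hle
    have hle2 := pow_le_pow_left₀ (norm_nonneg _) hle 2
    rw [mul_pow, hunorm, hfnorm] at hle2
    have e : ‖R‖ ^ 2 * (ν ^ 2 / r ^ 2 * (r * ‖w‖ ^ 2 * I₁))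
        = (r * ‖w‖ ^ 2) * (‖R‖ ^ 2 * ν ^ 2 * I₁ / r ^ 2) := by ring
    rw [e] at hle2
    have h3 := le_of_mul_le_mul_left hle2 (mul_pos hr hwpos)
    rw [le_div_iff₀ (by positivity)] at h3
    linarith
  set B := ‖R‖ ^ 2 * ν ^ 2 * I₁ with hB
  have hB0 : 0 ≤ B := by positivity
  have h1 := key (Real.sqrt ((B + 1) / I₀)) (Real.sqrt_pos.2 (by positivity))
  rw [Real.sq_sqrt (by positivity), div_mul_cancel₀ _ hI.ne'] at h1
  linarith

/-! ### Gauge invariance -/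

/-- The matrix `diag(1, c)` commutes with `σ₃` and, for unimodular `c`, intertwines `σ_⋆` for `ϑ`
with `σ_⋆` for `c ϑ`. It appears as a continuous map because `resolventSet_subset_of_intertwine`
needs one. -/
theorem exists_gauge {ν c ϑ : ℂ} (hc : conj c * c = 1) (κ : DomainWall)
    (u : (diracOperator ν ϑ κ).domain) :
    ∃ h : (Matrix.toEuclideanCLM (𝕜 := ℂ) !![1, 0; 0, c]).compLpL 2 (volume : Measure ℝ) (u : L2)
        ∈ (diracOperator ν (c * ϑ) κ).domain,
      diracOperator ν (c * ϑ) κ ⟨_, h⟩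
        = (Matrix.toEuclideanCLM (𝕜 := ℂ) !![1, 0; 0, c]).compLpL 2 (volume : Measure ℝ)
          (diracOperator ν ϑ κ u) := by
  obtain ⟨u, g, hg⟩ := u
  set M : Matrix (Fin 2) (Fin 2) ℂ := !![1, 0; 0, c] with hM
  change ∃ h : matL2 M u ∈ (diracOperator ν (c * ϑ) κ).domain,
    diracOperator ν (c * ϑ) κ ⟨matL2 M u, h⟩ = matL2 M (diracOperator ν ϑ κ ⟨u, g, hg⟩)
  refine exists_diracOperator_eq (hg.matL2 M) ?_
  filter_upwards [diracOperator_coeFn (κ := κ) (ν := ν) (ϑ := ϑ) hg ⟨g, hg⟩,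
    matL2_coeFn M u, matL2_coeFn M g, matL2_coeFn M (diracOperator ν ϑ κ ⟨u, g, hg⟩)]
    with x h1 h2 h3 h4
  rw [h4, h4, h3, h3, h2, h2, h1.1, h1.2]
  simp only [hM, Matrix.of_apply, Matrix.cons_val', Matrix.cons_val_zero, Matrix.cons_val_one,
    Matrix.cons_val_fin_one, map_mul]
  constructor
  · linear_combination (-(κ.toFun x * conj ϑ * u x 1)) * hc
  · ring

theorem matL2_gauge_inv {c d : ℂ} (h : c * d = 1) (u : L2) :
    (Matrix.toEuclideanCLM (𝕜 := ℂ) !![1, 0; 0, c]).compLpL 2 (volume : Measure ℝ)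
      ((Matrix.toEuclideanCLM (𝕜 := ℂ) !![1, 0; 0, d]).compLpL 2 (volume : Measure ℝ) u) = u := by
  change matL2 !![1, 0; 0, c] (matL2 !![1, 0; 0, d] u) = u
  refine L2.ext_coord ?_
  filter_upwards [matL2_coeFn !![1, 0; 0, c] (matL2 !![1, 0; 0, d] u),
    matL2_coeFn !![1, 0; 0, d] u] with x h1 h2
  rw [h1, h1, h2, h2]
  simp only [Matrix.of_apply, Matrix.cons_val', Matrix.cons_val_zero, Matrix.cons_val_one,
    Matrix.cons_val_fin_one]
  constructor
  · ring
  · linear_combination (u x 1) * h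

theorem resolventSet_gauge_subset {c : ℂ} (hc : conj c * c = 1) (ν ϑ : ℂ) (κ : DomainWall) :
    resolventSet (diracOperator ν ϑ κ) ⊆ resolventSet (diracOperator ν (c * ϑ) κ) := by
  have hc' : conj (conj c) * conj c = 1 := by rw [Complex.conj_conj, mul_comm, hc]
  refine resolventSet_subset_of_intertwine
    ((Matrix.toEuclideanCLM (𝕜 := ℂ) !![1, 0; 0, c]).compLpL 2 (volume : Measure ℝ))
    ((Matrix.toEuclideanCLM (𝕜 := ℂ) !![1, 0; 0, conj c]).compLpL 2 (volume : Measure ℝ))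
    (matL2_gauge_inv (by rw [mul_comm, hc])) (exists_gauge hc κ) ?_
  have h := exists_gauge (ν := ν) (ϑ := c * ϑ) hc' κ
  rwa [← mul_assoc, hc, one_mul] at h

theorem spectrum_gauge {c : ℂ} (hc : conj c * c = 1) (ν ϑ : ℂ) (κ : DomainWall) :
    spectrum (diracOperator ν (c * ϑ) κ) = spectrum (diracOperator ν ϑ κ) := by
  have hc' : conj (conj c) * conj c = 1 := by rw [Complex.conj_conj, mul_comm, hc]
  have h := resolventSet_gauge_subset hc' ν (c * ϑ) κ
  rw [← mul_assoc, hc, one_mul] at h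
  exact congrArg compl (Subset.antisymm h (resolventSet_gauge_subset hc ν ϑ κ))

/-! ### Dirac eigenbases -/

/-- Uniqueness for the Cauchy problem of a scalar second order equation. -/
theorem second_order_unique {q : ℝ → ℝ} {C : ℝ} (hq : ∀ x, |q x| ≤ C) {f f' : ℝ → ℂ}
    (h1 : ∀ x, HasDerivAt f (f' x) x) (h2 : ∀ x, HasDerivAt f' (q x * f x) x)
    (h0 : f 0 = 0) (h0' : f' 0 = 0) (x : ℝ) : f x = 0 := by
  have hC : 0 ≤ C := (abs_nonneg _).trans (hq 0)
  have hl : ∀ t, LipschitzOnWith (max 1 C).toNNReal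
      (fun y : ℂ × ℂ => (y.2, (q t : ℂ) * y.1)) univ := by
    intro t
    refine (LipschitzWith.of_dist_le_mul fun y z => ?_).lipschitzOnWith
    rw [Real.coe_toNNReal _ (by positivity), Prod.dist_eq, Prod.dist_eq]
    refine max_le ?_ ?_
    · calc dist y.2 z.2 ≤ 1 * max (dist y.1 z.1) (dist y.2 z.2) := by
            rw [one_mul]; exact le_max_right _ _
        _ ≤ _ := by gcongr; exact le_max_left _ _
    · rw [dist_eq_norm, ← mul_sub, norm_mul, Complex.norm_real, ← dist_eq_norm]
      exact mul_le_mul ((hq t).trans (le_max_right _ _)) (le_max_left _ _) dist_nonneg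
        (by positivity)
  have := ODE_solution_unique_univ (v := fun t (y : ℂ × ℂ) => (y.2, (q t : ℂ) * y.1))
    (s := fun _ => univ) (f := fun t => (f t, f' t)) (g := fun _ => (0, 0)) (t₀ := 0) hl
    (fun t => ⟨(h1 t).prodMk (h2 t), mem_univ _⟩)
    (fun t => ⟨(hasDerivAt_const t ((0 : ℂ), (0 : ℂ))).congr_deriv (by simp [Prod.ext_iff]),
      mem_univ _⟩)
    (by simp [h0, h0'])
  exact congrArg Prod.fst (congrFun this x)

theorem IsDiracEigenbasis.hasDerivAt_p {V : ℝ → ℝ} {E : ℝ} {φp φm : ℝ → ℂ}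
    (h : IsDiracEigenbasis V E φp φm) (x : ℝ) : HasDerivAt φp (deriv φp x) x :=
  (h.smooth_p.differentiable (by norm_num) x).hasDerivAt

theorem IsDiracEigenbasis.continuous_deriv_p {V : ℝ → ℝ} {E : ℝ} {φp φm : ℝ → ℂ}
    (h : IsDiracEigenbasis V E φp φm) : Continuous (deriv φp) :=
  h.smooth_p.continuous_deriv (by norm_num)

theorem IsDiracEigenbasis.hasDerivAt_deriv_p {V : ℝ → ℝ} {E : ℝ} {φp φm : ℝ → ℂ}
    (h : IsDiracEigenbasis V E φp φm) (x : ℝ) :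
    HasDerivAt (deriv φp) (((V x - E : ℝ) : ℂ) * φp x) x := by
  have h1 : ContDiff ℝ 1 (deriv φp) := by
    have := h.smooth_p
    rw [show (2 : WithTop ℕ∞) = 1 + 1 by norm_num, contDiff_succ_iff_deriv] at this
    exact this.2.2
  refine (h1.differentiable (by norm_num) x).hasDerivAt.congr_deriv ?_
  push_cast
  linear_combination -(h.eigen_p x)

theorem IsDiracEigenbasis.hasDerivAt_m {V : ℝ → ℝ} {E : ℝ} {φp φm : ℝ → ℂ}
    (h : IsDiracEigenbasis V E φp φm) (x : ℝ) : HasDerivAt φm (conj (deriv φp x)) x := by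
  have : φm = fun x => conj (φp x) := funext fun x => (h.conj_eq x).symm
  rw [this]
  exact (h.hasDerivAt_p x).star

theorem IsDiracEigenbasis.hasDerivAt_deriv_m {V : ℝ → ℝ} {E : ℝ} {φp φm : ℝ → ℂ}
    (h : IsDiracEigenbasis V E φp φm) (x : ℝ) :
    HasDerivAt (fun x => conj (deriv φp x)) (((V x - E : ℝ) : ℂ) * φm x) x := by
  refine ((h.hasDerivAt_deriv_p x).star).congr_deriv ?_
  rw [← starRingEnd_apply, map_mul, Complex.conj_ofReal, h.conj_eq]

theorem IsDiracEigenbasis.wronskian_const {V : ℝ → ℝ} {E : ℝ} {φp φm : ℝ → ℂ}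
    (h : IsDiracEigenbasis V E φp φm) (x : ℝ) :
    φm x * deriv φp x - conj (deriv φp x) * φp x
      = φm 0 * deriv φp 0 - conj (deriv φp 0) * φp 0 := by
  have hd : ∀ x, HasDerivAt (fun x => φm x * deriv φp x - conj (deriv φp x) * φp x) 0 x := by
    intro x
    refine (((h.hasDerivAt_m x).mul (h.hasDerivAt_deriv_p x)).sub
      ((h.hasDerivAt_deriv_m x).mul (h.hasDerivAt_p x))).congr_deriv ?_
    ring
  exact is_const_of_deriv_eq_zero (fun x => (hd x).differentiableAt) (fun x => (hd x).deriv) x 0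

theorem IsDiracEigenbasis.wronskian_re {V : ℝ → ℝ} {E : ℝ} {φp φm : ℝ → ℂ}
    (h : IsDiracEigenbasis V E φp φm) :
    (φm 0 * deriv φp 0 - conj (deriv φp 0) * φp 0).re = 0 := by
  have hc : conj (φm 0 * deriv φp 0 - conj (deriv φp 0) * φp 0)
      = -(φm 0 * deriv φp 0 - conj (deriv φp 0) * φp 0) := by
    rw [map_sub, map_mul, map_mul, Complex.conj_conj, ← h.conj_eq, Complex.conj_conj]
    ring
  have := congrArg Complex.re hc
  rw [Complex.conj_re, Complex.neg_re] at this
  linarith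

/-- The integral of `(φm φp)'` over a cell is zero, as both factors change sign under the unit
shift. Hence twice the integral of `φm φp'` is the integral of the constant Wronskian `w`, and `ν =
-i w` with `w` imaginary. -/
theorem IsDiracEigenbasis.nuStar_eq {V : ℝ → ℝ} {E : ℝ} {φp φm : ℝ → ℂ}
    (h : IsDiracEigenbasis V E φp φm) :
    nuStar φp = (((φm 0 * deriv φp 0 - conj (deriv φp 0) * φp 0).im : ℝ) : ℂ) := by
  set w := φm 0 * deriv φp 0 - conj (deriv φp 0) * φp 0 with hw
  have cp : Continuous φp := h.smooth_p.continuous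
  have cm : Continuous φm := h.smooth_m.continuous
  have cd := h.continuous_deriv_p
  have cds : Continuous fun x => conj (deriv φp x) := Complex.continuous_conj.comp cd
  have i1 : IntervalIntegrable (fun x => φm x * deriv φp x) volume 0 1 :=
    (cm.mul cd).intervalIntegrable _ _
  have i2 : IntervalIntegrable (fun x => conj (deriv φp x) * φp x) volume 0 1 :=
    (cds.mul cp).intervalIntegrable _ _
  have hp1 : φp 1 = -φp 0 := by
    have a := h.shift_p 0
    have b := h.shift_p (1 / 2)
    norm_num at a b
    rw [b, a, ← mul_assoc, Complex.I_mul_I]; ring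
  have hm1 : φm 1 = -φm 0 := by rw [← h.conj_eq, ← h.conj_eq, hp1, map_neg]
  have hsum : ∫ x in (0 : ℝ)..1, (conj (deriv φp x) * φp x + φm x * deriv φp x) = 0 := by
    rw [intervalIntegral.integral_eq_sub_of_hasDerivAt
      (fun x _ => (h.hasDerivAt_m x).mul (h.hasDerivAt_p x)) (i2.add i1)]
    simp [hp1, hm1]
  have hdiff : ∫ x in (0 : ℝ)..1, (φm x * deriv φp x - conj (deriv φp x) * φp x) = w := by
    simp_rw [h.wronskian_const]
    simp [hw]
  rw [intervalIntegral.integral_add i2 i1] at hsum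
  rw [intervalIntegral.integral_sub i1 i2] at hdiff
  have hν : nuStar φp = -Complex.I * w := by
    have : cellInner φp (fun x => 1 / Complex.I * deriv φp x)
        = -Complex.I * ∫ x in (0 : ℝ)..1, φm x * deriv φp x := by
      rw [cellInner, ← intervalIntegral.integral_const_mul]
      refine intervalIntegral.integral_congr fun x _ => ?_
      simp only [h.conj_eq]
      rw [one_div, Complex.inv_I]; ring
    rw [nuStar, this]
    linear_combination (-Complex.I) * hsum + (-Complex.I) * hdiff
  have hre : w.re = 0 := h.wronskian_re
  rw [hν]
  apply Complex.ext <;> simp [hre]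

theorem IsDiracEigenbasis.eq_zero_of_cauchy {V : ℝ → ℝ} {E : ℝ} {φp φm ψ ψ' : ℝ → ℂ}
    (h : IsDiracEigenbasis V E φp φm) {C : ℝ} (hC : ∀ x, |V x - E| ≤ C) {a b : ℂ}
    (h1 : ∀ x, HasDerivAt ψ (ψ' x) x) (h2 : ∀ x, HasDerivAt ψ' (((V x - E : ℝ) : ℂ) * ψ x) x)
    (e1 : ψ 0 + a * φp 0 + b * φm 0 = 0)
    (e2 : ψ' 0 + a * deriv φp 0 + b * conj (deriv φp 0) = 0) (x : ℝ) :
    ψ x + a * φp x + b * φm x = 0 :=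
  second_order_unique (q := fun x => V x - E) hC (f := fun x => ψ x + a * φp x + b * φm x)
    (f' := fun x => ψ' x + a * deriv φp x + b * conj (deriv φp x))
    (fun x => ((h1 x).add ((h.hasDerivAt_p x).const_mul a)).add ((h.hasDerivAt_m x).const_mul b))
    (fun x => (((h2 x).add ((h.hasDerivAt_deriv_p x).const_mul a)).add
      ((h.hasDerivAt_deriv_m x).const_mul b)).congr_deriv (by ring)) e1 e2 x

theorem IsDiracEigenbasis.exists_ne_zero {V : ℝ → ℝ} {E : ℝ} {φp φm : ℝ → ℂ}
    (h : IsDiracEigenbasis V E φp φm) : ∃ x, φp x ≠ 0 := by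
  by_contra hcon
  push Not at hcon
  have := h.norm_p
  rw [cellInner] at this
  simp [hcon] at this

/-- The half-period shift acts by `i` and `-i`, so evaluation at `x` and `x + 1/2` separates the two
terms. -/
theorem IsDiracEigenbasis.coeff_eq_zero {V : ℝ → ℝ} {E : ℝ} {φp φm : ℝ → ℂ}
    (h : IsDiracEigenbasis V E φp φm) {a b : ℂ} (hab : ∀ x, a * φp x + b * φm x = 0) :
    a = 0 ∧ b = 0 := by
  obtain ⟨x, hx⟩ := h.exists_ne_zero
  have hm : φm x ≠ 0 := by
    rw [← h.conj_eq]; exact (map_ne_zero _).2 hx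
  have e1 := hab x
  have e2 := hab (x + 1 / 2)
  rw [h.shift_p, h.shift_m] at e2
  have e3 : a * φp x - b * φm x = 0 := by
    have : Complex.I * (a * φp x - b * φm x) = 0 := by linear_combination e2
    exact (mul_eq_zero.1 this).resolve_left Complex.I_ne_zero
  constructor
  · have : a * φp x = 0 := by linear_combination (e1 + e3) / 2
    exact (mul_eq_zero.1 this).resolve_right hx
  · have : b * φm x = 0 := by linear_combination (e1 - e3) / 2
    exact (mul_eq_zero.1 this).resolve_right hm

theorem IsDiracEigenbasis.wronskian_ne_zero {V : ℝ → ℝ} {E : ℝ} {φp φm : ℝ → ℂ}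
    (h : IsDiracEigenbasis V E φp φm) {C : ℝ} (hC : ∀ x, |V x - E| ≤ C) :
    φm 0 * deriv φp 0 - conj (deriv φp 0) * φp 0 ≠ 0 := by
  intro hw
  have key : ∀ a b : ℂ, a * φp 0 + b * φm 0 = 0 → a * deriv φp 0 + b * conj (deriv φp 0) = 0 →
      a = 0 ∧ b = 0 := by
    intro a b e1 e2
    refine h.coeff_eq_zero fun x => ?_
    have := h.eq_zero_of_cauchy hC (ψ := fun _ => 0) (ψ' := fun _ => 0) (a := a) (b := b)
      (fun x => hasDerivAt_const x 0) (fun x => by simpa using hasDerivAt_const x (0 : ℂ))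
      (by rw [zero_add]; exact e1) (by rw [zero_add]; exact e2) x
    simpa using this
  -- With zero Wronskian these coefficients produce a solution with zero Cauchy data, which forces
  -- `φp 0 = 0`. The next combination forces `φp' 0 = 0`, and then `φp` itself has zero data.
  have k1 := key (φm 0) (-φp 0) (by ring) (by linear_combination hw)
  have hp0 : φp 0 = 0 := by simpa using k1.2
  have k2 := key (conj (deriv φp 0)) (-deriv φp 0) (by rw [hp0, k1.1]; ring) (by ring)
  have k3 := key 1 0 (by rw [hp0]; ring) (by
    have : deriv φp 0 = 0 := by simpa using k2.2
    rw [this]; simp)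
  exact one_ne_zero k3.1

/-- A Dirac eigenbasis is unique up to a phase. -/
theorem IsDiracEigenbasis.exists_phase {V : ℝ → ℝ} {E : ℝ} {φp φm ψp ψm : ℝ → ℂ}
    (hφ : IsDiracEigenbasis V E φp φm) (hψ : IsDiracEigenbasis V E ψp ψm) {C : ℝ}
    (hC : ∀ x, |V x - E| ≤ C) :
    ∃ c : ℂ, conj c * c = 1 ∧ (∀ x, ψp x = c * φp x) ∧ ∀ x, ψm x = conj c * φm x := by
  set w := φm 0 * deriv φp 0 - conj (deriv φp 0) * φp 0 with hw
  have hw0 : w ≠ 0 := hφ.wronskian_ne_zero hC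
  -- Cramer's rule: `a φp + b φm` has the Cauchy data of `ψp` at `0`. The shift by a half period
  -- then removes the `φm` component.
  set a := (φm 0 * deriv ψp 0 - conj (deriv φp 0) * ψp 0) / w with ha
  set b := (deriv φp 0 * ψp 0 - φp 0 * deriv ψp 0) / w with hb
  have hz : ∀ x, ψp x + (-a) * φp x + (-b) * φm x = 0 := by
    refine hφ.eq_zero_of_cauchy hC hψ.hasDerivAt_p hψ.hasDerivAt_deriv_p ?_ ?_
    · rw [ha, hb]; field_simp; rw [hw]; ring
    · rw [ha, hb]; field_simp; rw [hw]; ring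
  have hp : ∀ x, ψp x = a * φp x := by
    intro x
    have e1 := hz x
    have e2 := hz (x + 1 / 2)
    rw [hφ.shift_p, hφ.shift_m, hψ.shift_p] at e2
    have e3 : ψp x + (-a) * φp x - (-b) * φm x = 0 := by
      have : Complex.I * (ψp x + (-a) * φp x - (-b) * φm x) = 0 := by linear_combination e2
      exact (mul_eq_zero.1 this).resolve_left Complex.I_ne_zero
    linear_combination (e1 + e3) / 2
  refine ⟨a, ?_, hp, fun x => by rw [← hψ.conj_eq, hp, map_mul, hφ.conj_eq]⟩
  have hn := hψ.norm_p
  have : cellInner ψp ψp = conj a * a * cellInner φp φp := by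
    rw [cellInner, cellInner, ← intervalIntegral.integral_const_mul]
    refine intervalIntegral.integral_congr fun x _ => ?_
    simp only [hp, map_mul]
    ring
  rw [this, hφ.norm_p, mul_one] at hn
  exact hn

theorem nuStar_phase {φ ψ : ℝ → ℂ} {c : ℂ} (hc : conj c * c = 1) (h : ∀ x, ψ x = c * φ x) :
    nuStar ψ = nuStar φ := by
  have hψ : ψ = fun x => c * φ x := funext h
  rw [nuStar, nuStar, cellInner, cellInner]
  congr 1
  refine intervalIntegral.integral_congr fun x _ => ?_
  simp only [hψ, map_mul, deriv_const_mul_field']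
  linear_combination (conj (φ x) * (1 / Complex.I * deriv φ x)) * hc

theorem thetaStar_phase (W : ℝ → ℝ) {φp φm ψp ψm : ℝ → ℂ} {c : ℂ} (hp : ∀ x, ψp x = c * φp x)
    (hm : ∀ x, ψm x = conj c * φm x) :
    thetaStar W ψp ψm = conj c ^ 2 * thetaStar W φp φm := by
  rw [thetaStar, thetaStar, cellInner, cellInner, ← intervalIntegral.integral_const_mul]
  refine intervalIntegral.integral_congr fun x _ => ?_
  simp only [hp, hm, map_mul]
  ring

theorem exists_bound_of_periodic {V : ℝ → ℝ} (hV : Continuous V) (hV1 : ∀ x, V (x + 1) = V x)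
    (E : ℝ) : ∃ C, ∀ x, |V x - E| ≤ C := by
  obtain ⟨C, hC⟩ := (isCompact_Icc (a := (0 : ℝ)) (b := 1)).exists_bound_of_continuousOn
    (f := fun x => V x - E) (hV.sub continuous_const).continuousOn
  refine ⟨C, fun x => ?_⟩
  have hper : Function.Periodic V 1 := hV1
  obtain ⟨y, hy, e⟩ := hper.exists_mem_Ico₀ one_pos x
  rw [e]
  exact hC y ⟨hy.1, hy.2.le⟩

/-! ### Enumeration of a symmetric finite set -/

/-- Only the positive elements need listing in increasing order; zero and the odd extension supply
the rest. -/
theorem exists_odd_enumeration {S : Set ℝ} (hS : S.Finite) (h0 : (0 : ℝ) ∈ S)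
    (hneg : ∀ x ∈ S, -x ∈ S) :
    ∃ (N : ℕ) (ϑ : ℤ → ℝ), StrictMonoOn ϑ (Icc (-N : ℤ) N) ∧ ϑ 0 = 0 ∧
      (∀ j ∈ Icc (-N : ℤ) N, ϑ (-j) = -ϑ j) ∧ ϑ '' Icc (-N : ℤ) N = S := by
  classical
  set T : Finset ℝ := hS.toFinset.filter (0 < ·) with hT
  have hTmem : ∀ x, x ∈ T ↔ x ∈ S ∧ 0 < x := by intro x; simp [hT]
  set N := T.card with hN
  set e := T.orderEmbOfFin hN.symm with he
  have heT : ∀ i, e i ∈ T := fun i => T.orderEmbOfFin_mem hN.symm i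
  -- Positive elements are numbered from `1`, whereas `Fin N` starts at `0`. The default value makes
  -- `p 0 = 0`.
  set p : ℕ → ℝ := fun k => if h : 1 ≤ k ∧ k ≤ N then e ⟨k - 1, by omega⟩ else 0 with hp
  have hpe : ∀ k (h : 1 ≤ k ∧ k ≤ N), p k = e ⟨k - 1, by omega⟩ := fun k h => by
    rw [hp]; exact dif_pos h
  have hp0 : p 0 = 0 := by simp [hp]
  have hpS : ∀ k, 1 ≤ k → k ≤ N → p k ∈ S ∧ 0 < p k := by
    intro k h1 h2
    rw [hpe k ⟨h1, h2⟩]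
    exact (hTmem _).1 (heT _)
  have hpmono : ∀ k l, k < l → l ≤ N → p k < p l := by
    intro k l hkl hl
    rcases Nat.eq_zero_or_pos k with rfl | hk
    · rw [hp0]; exact (hpS l hkl hl).2
    · rw [hpe k ⟨hk, by omega⟩, hpe l ⟨by omega, hl⟩]
      exact e.strictMono (by rw [Fin.mk_lt_mk]; omega)
  have hpsurj : ∀ x ∈ S, 0 < x → ∃ k, 1 ≤ k ∧ k ≤ N ∧ p k = x := by
    intro x hx hpos
    have : x ∈ Set.range e := by
      rw [he, Finset.range_orderEmbOfFin]
      exact (hTmem x).2 ⟨hx, hpos⟩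
    obtain ⟨i, hi⟩ := this
    refine ⟨i + 1, by omega, by omega, ?_⟩
    rw [hpe _ ⟨by omega, by omega⟩, ← hi]
    rfl
  set ϑ : ℤ → ℝ := fun j => (j.sign : ℝ) * p j.natAbs with hϑ
  have hpos : ∀ j : ℤ, 0 ≤ j → ϑ j = p j.natAbs := by
    intro j hj
    rcases hj.lt_or_eq with h | h
    · rw [hϑ]; simp [Int.sign_eq_one_of_pos h]
    · rw [← h, hϑ]; simp [hp0]
  have hodd : ∀ j, ϑ (-j) = -ϑ j := by intro j; simp [hϑ]
  refine ⟨N, ϑ, ?_, by simp [hϑ], fun j _ => hodd j, ?_⟩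
  · have hnn : ∀ i j : ℤ, 0 ≤ i → i < j → j ≤ N → ϑ i < ϑ j := by
      intro i j hi hij hj
      rw [hpos i hi, hpos j (by omega)]
      exact hpmono _ _ (by omega) (by omega)
    intro i hi j hj hij
    rcases le_or_gt 0 i with h | h
    · exact hnn i j h hij hj.2
    · have hi' : ϑ i = -ϑ (-i) := by rw [hodd]; simp
      have hϑ0 : ϑ 0 = 0 := by simp [hϑ]
      rcases le_or_gt 0 j with h' | h'
      · have h1 := hnn 0 (-i) le_rfl (by omega) (by have := hi.1; omega)
        have h2 : 0 ≤ ϑ j := by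
          rcases h'.lt_or_eq with h3 | h3
          · have := hnn 0 j le_rfl h3 hj.2
            linarith
          · rw [← h3, hϑ0]
        linarith
      · have hj' : ϑ j = -ϑ (-j) := by rw [hodd]; simp
        have h1 := hnn (-j) (-i) (by omega) (by omega) (by have := hi.1; omega)
        linarith
  · ext x
    constructor
    · rintro ⟨j, hj, rfl⟩
      have hmem : ∀ i : ℤ, 0 ≤ i → i ≤ N → ϑ i ∈ S := by
        intro i hi hiN
        rw [hpos i hi]
        rcases hi.lt_or_eq with h | h
        · exact (hpS _ (by omega) (by omega)).1
        · rw [← h]; simpa [hp0] using h0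
      rcases le_or_gt 0 j with h | h
      · exact hmem j h hj.2
      · have hj' : ϑ j = -ϑ (-j) := by rw [hodd]; simp
        rw [hj']
        exact hneg _ (hmem _ (by omega) (by have := hj.1; omega))
    · intro hx
      rcases lt_trichotomy x 0 with h | h | h
      · obtain ⟨k, h1, h2, e1⟩ := hpsurj (-x) (hneg x hx) (by linarith)
        refine ⟨-(k : ℤ), ⟨by omega, by omega⟩, ?_⟩
        rw [hodd, hpos _ (by omega), Int.natAbs_natCast, e1, neg_neg]
      · exact ⟨0, ⟨by omega, by omega⟩, by rw [h]; simp [hϑ]⟩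
      · obtain ⟨k, h1, h2, e1⟩ := hpsurj x hx h
        refine ⟨(k : ℤ), ⟨by omega, by omega⟩, ?_⟩
        rw [hpos _ (by omega), Int.natAbs_natCast, e1]

/-! ### The spectrum of the Dirac operator -/

/-- The eigenvalues of the Dirac operator in the gap. -/
def gapEigenvalues (ν : ℝ) (ϑ : ℂ) (κ : DomainWall) : Set ℝ :=
  {μ : ℝ | |μ| < ‖ϑ‖ ∧ eigenspace (diracOperator ν ϑ κ) (μ : ℂ) ≠ ⊥}

theorem finite_gapEigenvalues {ν : ℝ} (hν : ν ≠ 0) (ϑ : ℂ) (κ : DomainWall) :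
    (gapEigenvalues ν ϑ κ).Finite := by
  obtain ⟨n, P, hP⟩ := dirac_coercive hν ϑ κ
  exact (isSelfAdj_diracOperator hν ϑ κ).finite_eigenvalues P hP

theorem pointSpectrum_eq {ν : ℝ} (hν : ν ≠ 0) (ϑ : ℂ) (κ : DomainWall) :
    pointSpectrum (diracOperator ν ϑ κ) = Complex.ofReal '' gapEigenvalues ν ϑ κ := by
  ext z
  constructor
  · intro hz
    have him : z.im = 0 := by
      by_contra h
      exact hz ((isSelfAdj_diracOperator hν ϑ κ).eigenspace_eq_bot_of_im_ne_zero h)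
    have hzr : ((z.re : ℝ) : ℂ) = z := Complex.ext (by simp) (by simp [him])
    refine ⟨z.re, ⟨?_, by rw [hzr]; exact hz⟩, hzr⟩
    by_contra h
    push Not at h
    refine hz ?_
    rw [← hzr]
    exact eigenspace_eq_bot_of_le hν h
  · rintro ⟨μ, hμ, rfl⟩
    exact hμ.2

theorem mem_gapEigenvalues_of_mem_spectrum {ν : ℝ} (hν : ν ≠ 0) {ϑ : ℂ} {κ : DomainWall} {z : ℂ}
    (hz : z ∈ spectrum (diracOperator ν ϑ κ)) (hre : |z.re| < ‖ϑ‖) :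
    ((z.re : ℝ) : ℂ) = z ∧ z.re ∈ gapEigenvalues ν ϑ κ := by
  have hA := isSelfAdj_diracOperator hν ϑ κ
  have him : z.im = 0 := by
    by_contra h
    exact hz (hA.mem_resolventSet_of_im_ne_zero h)
  have hzr : ((z.re : ℝ) : ℂ) = z := Complex.ext (by simp) (by simp [him])
  refine ⟨hzr, hre, fun hbot => ?_⟩
  obtain ⟨n, P, hP⟩ := dirac_coercive hν ϑ κ
  exact hz (hzr ▸ hA.mem_resolventSet_of_gap P hP hre hbot)

/-- Spectral points closer to `μ` than the edge of the gap are themselves gap eigenvalues. These are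
finite in number, so `μ` is isolated. -/
theorem gapEigenvalues_subset_discreteSpectrum {ν : ℝ} (hν : ν ≠ 0) {ϑ : ℂ} {κ : DomainWall} {μ : ℝ}
    (hμ : μ ∈ gapEigenvalues ν ϑ κ) : (μ : ℂ) ∈ discreteSpectrum (diracOperator ν ϑ κ) := by
  refine ⟨hμ.2, Module.finite_of_finrank_pos (by
    rw [finrank_eigenspace_eq_one hν hμ.2]; exact one_pos), ?_⟩
  have hclosed : IsClosed (gapEigenvalues ν ϑ κ \ {μ}) :=
    ((finite_gapEigenvalues hν ϑ κ).subset sdiff_subset).isClosed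
  obtain ⟨ε, hε, hball⟩ := Metric.isOpen_iff.1 hclosed.isOpen_compl μ (by simp)
  refine ⟨min ε (‖ϑ‖ - |μ|), lt_min hε (sub_pos.2 hμ.1), fun w hw hdist => ?_⟩
  have hre : |w.re - μ| < min ε (‖ϑ‖ - |μ|) := by
    refine lt_of_le_of_lt ?_ hdist
    have := Complex.abs_re_le_norm (w - μ)
    simpa using this
  have hlt : |w.re| < ‖ϑ‖ := by
    have h1 := lt_of_lt_of_le hre (min_le_right _ _)
    have h2 := abs_add_le (w.re - μ) μ
    rw [sub_add_cancel] at h2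
    linarith
  obtain ⟨hwr, hwS⟩ := mem_gapEigenvalues_of_mem_spectrum hν hw hlt
  have hwb : w.re ∈ Metric.ball μ ε := by
    rw [Metric.mem_ball, Real.dist_eq]
    exact lt_of_lt_of_le hre (min_le_left _ _)
  have hmem := hball hwb
  rw [← hwr]
  by_contra hne
  exact hmem ⟨hwS, fun h => hne (by rw [mem_singleton_iff.1 h])⟩

/-- Inside the gap every spectral point is a discrete eigenvalue. Outside it, every real point is
spectral but not an eigenvalue, hence not discrete. -/
theorem essentialSpectrum_eq {ν : ℝ} (hν : ν ≠ 0) {ϑ : ℂ} (hϑ : ϑ ≠ 0) (κ : DomainWall) :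
    essentialSpectrum (diracOperator ν ϑ κ) = Complex.ofReal '' (univ \ Ioo (-‖ϑ‖) ‖ϑ‖) := by
  ext z
  constructor
  · rintro ⟨hz, hnd⟩
    have him : z.im = 0 := by
      by_contra h
      exact hz ((isSelfAdj_diracOperator hν ϑ κ).mem_resolventSet_of_im_ne_zero h)
    have hzr : ((z.re : ℝ) : ℂ) = z := Complex.ext (by simp) (by simp [him])
    refine ⟨z.re, ⟨mem_univ _, fun hI => ?_⟩, hzr⟩
    obtain ⟨-, hS⟩ := mem_gapEigenvalues_of_mem_spectrum hν hz (abs_lt.2 hI)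
    exact hnd (hzr ▸ gapEigenvalues_subset_discreteSpectrum hν hS)
  · rintro ⟨μ, ⟨-, hμ⟩, rfl⟩
    have hle : ‖ϑ‖ ≤ |μ| := by
      by_contra h
      exact hμ (abs_lt.1 (not_le.1 h))
    exact ⟨mem_spectrum_of_le hν hϑ κ hle, fun hd => hd.1 (eigenspace_eq_bot_of_le hν hle)⟩

end DiracWall

end

/-! ### The Dirac operator of an eigenbasis -/

theorem theorem3
    (V W : ℝ → ℝ) (hV : ContDiff ℝ ∞ V) (hW : ContDiff ℝ ∞ W)
    (hV1 : ∀ x, V (x + 1) = V x) (hW1 : ∀ x, W (x + 1) = W x)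
    (hVS : ∀ x, V (x + 1 / 2) = V x) (hWS : ∀ x, W (x + 1 / 2) = -W x)
    (κ : DiracWall.DomainWall) (E : ℝ) (φp φm : ℝ → ℂ)
    (hφ : DiracWall.IsDiracEigenbasis V E φp φm)
    (hϑ : DiracWall.thetaStar W φp φm ≠ 0) :
    (∀ ψp ψm : ℝ → ℂ, DiracWall.IsDiracEigenbasis V E ψp ψm →
      DiracWall.spectrum (DiracWall.slashedD W κ ψp ψm)
        = DiracWall.spectrum (DiracWall.slashedD W κ φp φm)) ∧
    DiracWall.essentialSpectrum (DiracWall.slashedD W κ φp φm)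
      = Complex.ofReal '' (Set.univ \
          Set.Ioo (-‖DiracWall.thetaStar W φp φm‖) ‖DiracWall.thetaStar W φp φm‖) ∧
    ∃ (N : ℕ) (ϑ : ℤ → ℝ),
      StrictMonoOn ϑ (Set.Icc (-N : ℤ) N) ∧
      ϑ 0 = 0 ∧
      (∀ j ∈ Set.Icc (-N : ℤ) N, ϑ (-j) = -ϑ j) ∧
      (∀ j ∈ Set.Icc (-N : ℤ) N,
        -‖DiracWall.thetaStar W φp φm‖ < ϑ j ∧ ϑ j < ‖DiracWall.thetaStar W φp φm‖) ∧
      DiracWall.pointSpectrum (DiracWall.slashedD W κ φp φm)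
        = (fun j : ℤ => (ϑ j : ℂ)) '' Set.Icc (-N : ℤ) N ∧
      ∀ j ∈ Set.Icc (-N : ℤ) N,
        Module.finrank ℂ (DiracWall.eigenspace (DiracWall.slashedD W κ φp φm) (ϑ j)) = 1 := by
  obtain ⟨C, hC⟩ := DiracWall.exists_bound_of_periodic hV.continuous hV1 E
  have hw := hφ.wronskian_ne_zero hC
  set ν : ℝ := (φm 0 * deriv φp 0 - conj (deriv φp 0) * φp 0).im with hν
  have hνφ : DiracWall.nuStar φp = (ν : ℂ) := hφ.nuStar_eq
  have hν0 : ν ≠ 0 := fun h => hw (Complex.ext hφ.wronskian_re h)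
  have hD : DiracWall.slashedD W κ φp φm
      = DiracWall.diracOperator ν (DiracWall.thetaStar W φp φm) κ := by
    rw [DiracWall.slashedD, hνφ]
  refine ⟨fun ψp ψm hψ => ?_, ?_, ?_⟩
  · obtain ⟨c, hc, hp, hm⟩ := hφ.exists_phase hψ hC
    rw [DiracWall.slashedD, DiracWall.slashedD, DiracWall.nuStar_phase hc hp,
      DiracWall.thetaStar_phase W hp hm]
    refine DiracWall.spectrum_gauge ?_ _ _ κ
    rw [map_pow, Complex.conj_conj]
    -- The phase acting on `ϑ` is `conj c ^ 2`, and `|c|⁴ - 1 = (|c|² + 1)(|c|² - 1)`.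
    linear_combination (conj c * c + 1) * hc
  · rw [hD]
    exact DiracWall.essentialSpectrum_eq hν0 hϑ κ
  · rw [hD]
    obtain ⟨N, ϑ, h1, h2, h3, h4⟩ := DiracWall.exists_odd_enumeration
      (DiracWall.finite_gapEigenvalues hν0 (DiracWall.thetaStar W φp φm) κ)
      ⟨by rw [abs_zero]; exact norm_pos_iff.2 hϑ, by
        rw [Complex.ofReal_zero]; exact DiracWall.eigenspace_zero_ne_bot hν0 hϑ κ⟩
      (fun x hx => ⟨by rw [abs_neg]; exact hx.1, by
        rw [Complex.ofReal_neg]; exact DiracWall.eigenspace_neg_ne_bot hϑ hx.2⟩)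
    have hmem : ∀ j ∈ Set.Icc (-N : ℤ) N,
        ϑ j ∈ DiracWall.gapEigenvalues ν (DiracWall.thetaStar W φp φm) κ :=
      fun j hj => h4 ▸ Set.mem_image_of_mem ϑ hj
    refine ⟨N, ϑ, h1, h2, h3, fun j hj => abs_lt.1 (hmem j hj).1, ?_,
      fun j hj => DiracWall.finrank_eigenspace_eq_one hν0 (hmem j hj).2⟩
    rw [DiracWall.pointSpectrum_eq hν0, ← h4, Set.image_image]
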